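/- Let $P$ be a prime, let $r,d,n\ge 1$ be integers, and let $X>Y\ge 1$ be real numbers with $4P^2>r^2(X+Y)$. Let $\mathcal A_{r,d}$ be the set of square-free integers $N$ with $\gcd(P,N)=1$, $d^2\mid r^2N-4P^2$ and $\frac{r^2N^2-4P^2N}{d^2}\equiv 0$ or $1\pmod 4$, and put \[ S_{n,d,r}=\sum_{\substack{N\in[X,X+Y]\\ N\in\mathcal A_{r,d}}}\left(\frac{N}{n}\right)\left(\frac{(r^2N-4P^2)/d^2}{n}\right), \] where $\left(\frac{\cdot}{n}\right)$ is the Kronecker symbol. Put \[ B=\prod_{p}\frac{p^4-2p^2-p+1}{(p^2-1)^2},\qquad C(r)=\prod_{p\mid r}\left(1+\frac{p^2}{p^4-2p^2-p+1}\right), \] the products being over primes $p$. Then for every $\varepsilon>0$ and every cut-off parameter $T\gg Y$, \[ \sum_{1\le d\le 2P}\ \sum_{1\le n\le T}\frac{S_{n,d,r}}{nd}=\frac{Y}{\zeta(2)}\,B\,C(r)+O\!\left(\sqrt X\,Y^{5/18}+\sqrt Y\,T^{1/4+\varepsilon}+(PX)^{\varepsilon}\,Y^{8/9}\right), \] where the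 implied constant depends only on $\varepsilon$ and on the implied constant in $T\gg Y$; it does not depend on $P$, $r$, $X$, $Y$ or $T$. -/

import Mathlib

/-- The Kronecker symbol `(a / n)` for an integer `a` and a positive integer `n`. It is completely
multiplicative in `n`, is the Legendre symbol at odd primes, and at `n = 2` it is `0` for `a` even,
`1` for `a ≡ ±1 (mod 8)` and `-1` for `a ≡ ±3 (mod 8)`. (`jacobiSym` treats the prime `2` in a
different way, so only the odd part of `n` is given to it.) -/
def kroneckerSymbol (a : ℤ) (n : ℕ) : ℤ :=
  (ZMod.χ₈ (a : ZMod 8)) ^ (n.factorization 2) * jacobiSym a (n / 2 ^ (n.factorization 2))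

/-- The set `𝒜_{r,d}` of admissible levels `N` (for the prime `P`). -/
def admissibleLevels (P r d : ℕ) : Set ℤ :=
  {N : ℤ | Squarefree N ∧ Int.gcd (P : ℤ) N = 1 ∧
    (d : ℤ) ^ 2 ∣ (r : ℤ) ^ 2 * N - 4 * (P : ℤ) ^ 2 ∧
    (((r : ℤ) ^ 2 * N ^ 2 - 4 * (P : ℤ) ^ 2 * N) / (d : ℤ) ^ 2 ≡ 0 [ZMOD 4] ∨
      ((r : ℤ) ^ 2 * N ^ 2 - 4 * (P : ℤ) ^ 2 * N) / (d : ℤ) ^ 2 ≡ 1 [ZMOD 4])}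

open scoped Classical in
/-- The twisted character sum `S_{n,d,r}` over the admissible `N ∈ [X, X + Y]`. The integer
division by `d ^ 2` is exact for every `N` that occurs. -/
noncomputable def twistedSum (P : ℕ) (X Y : ℝ) (n d r : ℕ) : ℤ :=
  ∑ N ∈ (Finset.Icc ⌈X⌉ ⌊X + Y⌋).filter (fun N => N ∈ admissibleLevels P r d),
    kroneckerSymbol N n *
      kroneckerSymbol (((r : ℤ) ^ 2 * N - 4 * (P : ℤ) ^ 2) / (d : ℤ) ^ 2) n

/-- The constant `B`, an Euler product over all primes. -/
noncomputable def constB : ℝ :=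
  ∏' p : Nat.Primes, ((p : ℝ) ^ 4 - 2 * (p : ℝ) ^ 2 - (p : ℝ) + 1) / ((p : ℝ) ^ 2 - 1) ^ 2

/-- The arithmetic factor `C(r)`, a product over the primes dividing `r`. -/
noncomputable def factorC (r : ℕ) : ℝ :=
  ∏ p ∈ r.primeFactors,
    (1 + (p : ℝ) ^ 2 / ((p : ℝ) ^ 4 - 2 * (p : ℝ) ^ 2 - (p : ℝ) + 1))

/-- The Euler product defining `constB` converges, so `constB` is not a default value. -/
theorem multipliable_constB :
    Multipliable fun p : Nat.Primes =>
      ((p : ℝ) ^ 4 - 2 * (p : ℝ) ^ 2 - (p : ℝ) + 1) / ((p : ℝ) ^ 2 - 1) ^ 2 := by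
  have key : ∀ p : Nat.Primes, (2 : ℝ) ≤ (p : ℝ) := fun p => by exact_mod_cast p.2.two_le
  have hs : Summable fun p : Nat.Primes => -((p : ℝ) / ((p : ℝ) ^ 2 - 1) ^ 2) := by
    have h1 : Summable fun n : ℕ => 1 / (n : ℝ) ^ 2 :=
      Real.summable_one_div_nat_pow.mpr (by norm_num)
    have h2 : Summable fun p : Nat.Primes => 1 / ((p : ℕ) : ℝ) ^ 2 :=
      h1.comp_injective (i := fun p : Nat.Primes => (p : ℕ)) Subtype.val_injective
    refine Summable.neg (Summable.of_nonneg_of_le (fun p => by positivity) (fun p => ?_) h2)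
    have hp := key p
    have hpos : (0 : ℝ) < (p : ℝ) ^ 2 - 1 := by nlinarith
    rw [div_le_div_iff₀ (by positivity) (by positivity)]
    nlinarith [mul_nonneg (sub_nonneg.mpr hp) (sq_nonneg (p : ℝ)),
      mul_nonneg (mul_nonneg (sub_nonneg.mpr hp) (sq_nonneg (p : ℝ))) (by linarith : (0 : ℝ) ≤ p)]
  refine (Real.multipliable_one_add_of_summable hs).congr (fun p => ?_)
  have hp := key p
  have hpos : (0 : ℝ) < (p : ℝ) ^ 2 - 1 := by nlinarith
  field_simp
  ring

/-! ### Stepanov's method: counting points of given trace. -/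

section

open Polynomial Finset

/-! The square-free condition is written as a sum of `μ(a)` over `a ^ 2 ∣ N`, cut at `a ≤ A`, and
the condition `P ∤ N` is dropped at a cost of `Y / P + 1` terms. For compatible `a, d, n` the
conditions `a ^ 2 ∣ N` and `d ^ 2 ∣ r ^ 2 N - 4 P ^ 2` define one residue class. Along it, `N` and
the cofactor are linear forms in one variable whose determinant is a unit at the odd primes of `n`
and whose leading coefficients multiply to a square. Completing the sum modulo 8 times the odd
radical of `n` gives a density times `Y`, with error `O(n^(1/2+δ))` uniform in `a`, `d`, `r`
(`abs_sum_jacobi_linear_sub_le`, `abs_sum_sieveTerm_sub_le`). The prime 2 is settled by finite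
tables modulo 8.

The complete sums needed are quadratic character sums of a product of two linear forms, twisted by
an additive character. Completing the square turns them into Kloosterman sums, so Weil's bound `2
√p` is required (`norm_kloostermanSum_le`). It is proved in two moves. Stepanov's auxiliary
polynomial (`card_filter_trace_le`) gives a square-root bound, with a constant depending on `p`,
over extensions of even degree. The identity `K_E = 2|F| - K_F²` for a quadratic extension `E / F`
(`kloostermanSum_quadratic`) magnifies any excess over `2 √p` under iteration until it contradicts
that bound.

The density, weighted by `μ(a) / (n d)`, is `3/4` times a multiplicative function of `(a, d, n)`
(`moebius_mul_sieveDensity_div`). It is absolutely summable because an odd prime `q` dividing `n` to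
an odd power has a local mean of size at most `1/q`. Its Euler product gives the constant `B C(r) /
ζ(2)`. Convergence leaves a factor `(dn)^(-1/4)` to spare, so truncation costs `1/A + P^(-1/4) +
T^(-1/4)`.

Up to logarithms the errors are `A √T`, `Y/A`, `√X`, `Y/P` and `Y (P^(-1/4) + T^(-1/4))`. The choice
`A ≈ √Y / T^(1/4)` balances the first two. Since `P ≫ √Y`, the term in `P^(-1/4)` is `O(Y^(7/8))`.
The ranges where logarithms cannot be absorbed, namely `Y` below a small power of `PX` and `T ≥ Y²`,
follow from the trivial bound. -/

theorem exists_ne_zero_sum_smul_eq_zero {F : Type*} [Field F] {N D : ℕ} (hND : D < N)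
    (e : ℕ → F[X]) (he : ∀ t < N, (e t).natDegree < D) :
    ∃ c : Fin N → F, c ≠ 0 ∧ ∑ t : Fin N, C (c t) * e t = 0 := by
  let L : (Fin N → F) →ₗ[F] (Fin D → F) :=
    Matrix.mulVecLin (Matrix.of fun (s : Fin D) (t : Fin N) => (e t).coeff s)
  have hk : LinearMap.ker L ≠ ⊥ := by
    apply LinearMap.ker_ne_bot_of_finrank_lt
    simpa using hND
  obtain ⟨c, hc, hc0⟩ := (Submodule.ne_bot_iff _).1 hk
  refine ⟨c, hc0, ?_⟩
  ext s
  rw [finsetSum_coeff, coeff_zero]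
  by_cases hs : s < D
  · have := congrFun (LinearMap.mem_ker.1 hc) ⟨s, hs⟩
    simp only [L, Matrix.mulVecLin_apply, Matrix.mulVec, dotProduct, Matrix.of_apply,
      Pi.zero_apply] at this
    rw [← this]
    exact sum_congr rfl fun t _ => by rw [coeff_C_mul, mul_comm]
  · refine sum_eq_zero fun t _ => ?_
    rw [coeff_C_mul, coeff_eq_zero_of_natDegree_lt (by have := he t t.2; omega), mul_zero]

/-- Terms with nonzero coefficient have distinct degrees, so leading terms cannot cancel. This keeps
the auxiliary polynomial from vanishing identically and caps its number of roots. -/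
theorem sum_C_mul_ne_zero_of_natDegree {F : Type*} [Field F] {N Q : ℕ} (hQ : 0 < Q)
    (g : ℕ → F[X]) (hg : ∀ t < N, (g t).natDegree = t + Q) (d : Fin N → F) (hd : d ≠ 0) :
    ∑ t : Fin N, C (d t) * g t ≠ 0 ∧ (∑ t : Fin N, C (d t) * g t).natDegree < N + Q := by
  obtain ⟨t₀, ht₀⟩ := Function.ne_iff.1 hd
  have hdeg : ∀ t : Fin N, d t ≠ 0 → (C (d t) * g t).natDegree = t + Q := fun t ht => by
    rw [natDegree_C_mul ht, hg t t.2]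
  have hne : ∀ t : Fin N, C (d t) * g t ≠ 0 → d t ≠ 0 := by
    intro t ht h; simp [h] at ht
  have hsup := natDegree_sum_eq_of_disjoint (fun t : Fin N => C (d t) * g t) univ (by
    intro i hi j hj hij h
    simp only [Set.mem_ofPred_eq, mem_univ, true_and] at hi hj
    simp only [Function.comp_apply, hdeg i (hne i hi), hdeg j (hne j hj)] at h
    exact hij (Fin.ext (by omega)))
  constructor
  · intro h0
    rw [h0, natDegree_zero] at hsup
    have := le_sup (f := fun t : Fin N => (C (d t) * g t).natDegree) (mem_univ t₀)
    rw [← hsup, hdeg t₀ ht₀] at this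
    omega
  · rw [hsup, Finset.sup_lt_iff (by positivity)]
    intro t _
    by_cases ht : d t = 0
    · simp [ht, hQ]
    · rw [hdeg t ht]; have := t.2; omega

/-- `X ^ (p ^ n)` times the partial trace of `a X + b / X`. -/
noncomputable def partialTracePoly {F : Type*} [Field F] (p n : ℕ) (a b : F) : F[X] :=
  ∑ i ∈ range (n + 1), (C a * X ^ (p ^ n + p ^ i) + C b * X ^ (p ^ n - p ^ i))

theorem natDegree_partialTracePoly {F : Type*} [Field F] {p : ℕ} (hp : 1 < p) (n : ℕ) {a : F}
    (ha : a ≠ 0) (b : F) : (partialTracePoly p n a b).natDegree = 2 * p ^ n := by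
  have hlt : ∀ i ∈ range (n + 1), p ^ i ≤ p ^ n := fun i hi =>
    Nat.pow_le_pow_right (by omega) (by simp at hi; omega)
  have hpos : 0 < p ^ n := by positivity
  refine natDegree_eq_of_le_of_coeff_ne_zero ?_ ?_
  · refine natDegree_sum_le_of_forall_le _ _ fun i hi => ?_
    have := hlt i hi
    refine natDegree_add_le_of_degree_le ?_ ?_
    · exact (natDegree_C_mul_X_pow_le _ _).trans (by omega)
    · exact (natDegree_C_mul_X_pow_le _ _).trans (by omega)
  · rw [partialTracePoly, finsetSum_coeff, sum_eq_single n]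
    · rw [coeff_add, coeff_C_mul_X_pow, coeff_C_mul_X_pow, if_pos (by ring), if_neg (by omega),
        add_zero]
      exact ha
    · intro i hi hin
      have h1 := hlt i hi
      have h2 : p ^ i ≠ p ^ n := fun h => hin (Nat.pow_right_injective hp h)
      have h3 : 0 < p ^ i := by positivity
      rw [coeff_add, coeff_C_mul_X_pow, coeff_C_mul_X_pow, if_neg (by omega), if_neg (by omega),
        add_zero]
    · simp

/-- `a` and `b` are fixed by Frobenius, so the conjugates of `a x + b / x` are `a x^(p^i) + b
x^(-p^i)`; the factor `x^(p^n)` clears the denominators. -/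
theorem eval_partialTracePoly {F : Type*} [Field F] {p : ℕ} [Fact p.Prime] [CharP F p] (n : ℕ)
    {a b : F} (ha : a ^ p = a) (hb : b ^ p = b) {x : F} (hx : x ≠ 0) :
    (partialTracePoly p n a b).eval x =
      x ^ p ^ n * ∑ i ∈ range (n + 1), (a * x + b * x⁻¹) ^ p ^ i := by
  have hfix : ∀ {y : F}, y ^ p = y → ∀ i, y ^ p ^ i = y := by
    intro y hy i
    induction i with
    | zero => simp
    | succ i ih => rw [pow_succ, pow_mul, ih, hy]
  rw [partialTracePoly, eval_finsetSum, mul_sum]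
  refine sum_congr rfl fun i hi => ?_
  have hle : p ^ i ≤ p ^ n :=
    Nat.pow_le_pow_right (Nat.Prime.pos Fact.out) (by simp at hi; omega)
  rw [add_pow_char_pow, mul_pow, mul_pow, hfix ha, hfix hb]
  simp only [eval_add, eval_mul, eval_C, eval_pow, eval_X]
  rw [pow_add, pow_sub₀ x hx hle, inv_pow]
  ring

/-- With `Q² = |F|`, let `u` be the first half of the trace of `a x + b / x`. The trace is then `u +
u^Q`, so on the solution set `u^Q = s - u`. A polynomial `G` whose `Q`-th power collapses there, by
this rule and `x^(Q²) = x`, to an expression of low degree can be made to vanish at every solution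
by linear algebra. Its degree then bounds the count. -/
theorem card_filter_trace_le {F : Type*} [Field F] [Fintype F] [DecidableEq F] {p : ℕ}
    [Fact p.Prime] [CharP F p] (hp : 3 ≤ p) (n : ℕ) (hF : Fintype.card F = p ^ (2 * (n + 1)))
    {a b : F} (ha : a ^ p = a) (hb : b ^ p = b) (ha0 : a ≠ 0) (s : F) :
    #{x : F | x ≠ 0 ∧ ∑ i ∈ range (2 * (n + 1)), (a * x + b * x⁻¹) ^ p ^ i = s} ≤
      p ^ (2 * n + 1) + 4 * p ^ (n + 1) := by
  set R := p ^ n with hR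
  set Q := p ^ (n + 1) with hQ
  have hQR : Q = p * R := by rw [hQ, hR, pow_succ']
  have hR0 : 0 < R := by positivity
  have hQ0 : 0 < Q := by positivity
  have hQ3 : 3 * R ≤ Q := by rw [hQR]; exact Nat.mul_le_mul_right _ hp
  set U := partialTracePoly p n a b with hU
  have hUdeg : U.natDegree = 2 * R := natDegree_partialTracePoly (by omega) n ha0 b
  have hU0 : U ≠ 0 := fun h => by rw [h, natDegree_zero] at hUdeg; omega
  set N := (R + 3) * Q with hN
  -- Mixed-radix digits `t = l + j R + i Q` with `l < R` and `j < p`; they index monomials in `X`,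
  -- `X^Q` and `U`.
  set l : ℕ → ℕ := fun t => t % R
  set j : ℕ → ℕ := fun t => (t / R) % p
  set i : ℕ → ℕ := fun t => t / Q
  have hl : ∀ t, l t < R := fun t => Nat.mod_lt _ hR0
  have hj : ∀ t, j t < p := fun t => Nat.mod_lt _ (by omega)
  have hjR : ∀ t, j t * R + R ≤ Q := fun t => by
    rw [hQR, ← Nat.succ_mul]; exact Nat.mul_le_mul_right _ (hj t)
  have ht : ∀ t, t = l t + j t * R + i t * Q := fun t => by
    have h1 := Nat.mod_add_div t R
    have h2 := Nat.mod_add_div (t / R) p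
    have h3 : i t = t / R / p := by rw [Nat.div_div_eq_div_mul, mul_comm R p, ← hQR]
    rw [h3, hQR]
    show t = t % R + (t / R) % p * R + (t / R / p) * (p * R)
    conv_lhs => rw [← h1, ← h2]
    ring
  have hi : ∀ t < N, i t < R + 3 := fun t h => Nat.div_lt_of_lt_mul (by rwa [mul_comm])
  -- The degree of `g t` is exactly `t + Q`, as `U ^ j` contributes `2 j R`. On the solution set
  -- `x^Q * (g t)(x)^Q = (e t)(x)`. The extra `Q` in both exponents keeps the subtraction of `j R`
  -- from truncating.
  set g : ℕ → F[X] := fun t => X ^ (l t + (i t + 1) * Q - j t * R) * U ^ j t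
  set e : ℕ → F[X] := fun t => X ^ (l t * Q + i t + 1 + Q - j t * R) * (C s * X ^ R - U) ^ j t
  have hg : ∀ t < N, (g t).natDegree = t + Q := by
    intro t _
    have h1 := hjR t
    have h2 := ht t
    rw [natDegree_mul (by simp) (pow_ne_zero _ hU0), natDegree_X_pow, natDegree_pow, hUdeg]
    have h3 : (i t + 1) * Q = i t * Q + Q := by ring
    have h4 : j t * (2 * R) = j t * R + j t * R := by ring
    omega
  have he : ∀ t < N, (e t).natDegree < R * Q + Q + R + 4 := by
    intro t htN
    have h1 := hjR t
    have h2 := hl t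
    have h3 := hi t htN
    have h4 : (C s * X ^ R - U).natDegree ≤ 2 * R :=
      (natDegree_sub_le _ _).trans (max_le ((natDegree_C_mul_X_pow_le _ _).trans (by omega)) hUdeg.le)
    have h5 : ((C s * X ^ R - U) ^ j t).natDegree ≤ j t * (2 * R) :=
      natDegree_pow_le.trans (Nat.mul_le_mul_left _ h4)
    have h6 : (e t).natDegree ≤ (l t * Q + i t + 1 + Q - j t * R) + j t * (2 * R) :=
      natDegree_mul_le.trans (Nat.add_le_add (natDegree_X_pow_le _) h5)
    have h7 : j t * (2 * R) = j t * R + j t * R := by ring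
    have h8 : l t * Q + Q ≤ R * Q := by rw [← Nat.succ_mul]; exact Nat.mul_le_mul_right _ h2
    omega
  -- The choice `N = (R + 3) Q` leaves more unknowns than the `R Q + Q + R + 4` coefficient
  -- conditions, because `R + 4 < 2 Q` when `Q ≥ 3 R` and `R ≥ 1`.
  obtain ⟨c, hc0, hc⟩ := exists_ne_zero_sum_smul_eq_zero (N := N) (by
    rw [hN]
    have : (R + 3) * Q = R * Q + 3 * Q := by ring
    omega) e he
  have hinj : ∀ y : F, y ^ Q = 0 → y = 0 := fun y hy => by simpa using pow_eq_zero_iff hQ0.ne' |>.1 hy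
  have hd0 : (fun t => c t ^ Q) ≠ 0 := by
    obtain ⟨t, htt⟩ := Function.ne_iff.1 hc0
    exact Function.ne_iff.2 ⟨t, fun h => htt (hinj _ h)⟩
  obtain ⟨hG0, hGdeg⟩ := sum_C_mul_ne_zero_of_natDegree hQ0 g hg _ hd0
  set G := ∑ t : Fin N, C (c t ^ Q) * g t with hG
  have hcard : ∀ y : F, (y ^ Q) ^ Q = y := fun y => by
    rw [← pow_mul, hQ, ← pow_add, show n + 1 + (n + 1) = 2 * (n + 1) by ring, ← hF,
      FiniteField.pow_card]
  have hroot : ∀ x ∈ ({x : F | x ≠ 0 ∧ ∑ i ∈ range (2 * (n + 1)), (a * x + b * x⁻¹) ^ p ^ i = s} :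
      Finset F), G.eval x = 0 := by
    intro x hx
    simp only [mem_filter, mem_univ, true_and] at hx
    obtain ⟨hx, hs⟩ := hx
    set u := ∑ i ∈ range (n + 1), (a * x + b * x⁻¹) ^ p ^ i with hu
    have hUx : U.eval x = x ^ R * u := eval_partialTracePoly n ha hb hx
    have huQ : u ^ Q = s - u := by
      rw [← hs, two_mul, sum_range_add, add_sub_cancel_left, hu, hQ, sum_pow_char_pow]
      exact sum_congr rfl fun i _ => by rw [← pow_mul, ← pow_add, add_comm i]
    apply hinj
    -- The coefficients of `G` are `c t ^ Q`; a second `Q`-th power restores `c t`, which gives the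
    -- combination chosen to be zero.
    have h1 : x ^ Q * (G.eval x) ^ Q = (∑ t : Fin N, C (c t) * e t).eval x := by
      rw [hG, eval_finsetSum, eval_finsetSum, hQ, sum_pow_char_pow, ← hQ, mul_sum]
      refine sum_congr rfl fun t _ => ?_
      simp only [g, e, eval_mul, eval_C, eval_pow, eval_X, eval_sub, hUx]
      have h1 := hjR t
      have h3 : (i t + 1) * Q = i t * Q + Q := by ring
      have hcan : ∀ (A : ℕ) (w : F),
          x ^ A * (x ^ (j t * R))⁻¹ * (x ^ R * w) ^ j t = x ^ A * w ^ j t := by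
        intro A w
        rw [mul_pow, ← pow_mul, mul_comm R]
        field_simp
      have h4 : (x ^ (l t + (i t + 1) * Q)) ^ Q = x ^ (l t * Q) * x ^ (i t + 1) := by
        rw [pow_add, mul_pow, pow_mul x (i t + 1) Q, hcard, pow_mul]
      rw [mul_pow, hcard, pow_sub₀ x hx (by omega), pow_sub₀ x hx (by omega),
        show s * x ^ R - x ^ R * u = x ^ R * u ^ Q by rw [huQ]; ring, hcan, hcan, mul_pow, h4]
      ring
    rw [hc, eval_zero] at h1
    exact (mul_eq_zero.1 h1).resolve_left (pow_ne_zero _ hx)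
  have := Polynomial.card_le_degree_of_subset_roots (p := G) (Z := {x : F | x ≠ 0 ∧ ∑ i ∈ range (2 * (n + 1)), (a * x + b * x⁻¹) ^ p ^ i = s}) (by
    intro x hx
    exact (mem_roots hG0).2 (hroot x hx))
  refine this.trans ?_
  have h2 : N + Q = p ^ (2 * n + 1) + 4 * p ^ (n + 1) := by
    rw [hN, hQ, hR]; ring
  omega

end

/-! ### Kloosterman sums under a quadratic extension. -/

section

open Polynomial Finset

/-- The Kloosterman sum over a finite field. -/
noncomputable def kloostermanSum {F : Type*} [Field F] [Fintype F] [DecidableEq F]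
    (ψ : AddChar F ℂ) (a b : F) : ℂ :=
  ∑ x ∈ univ.filter (fun x : F => x ≠ 0), ψ (a * x + b * x⁻¹)

theorem sum_comp_eq_sum_card_mul {ι κ : Type*} [Fintype ι] [Fintype κ] [DecidableEq κ]
    (h : κ → ℂ) (g : ι → κ) : ∑ x, h (g x) = ∑ z : κ, (#{x | g x = z} : ℂ) * h z := by
  rw [← sum_fiberwise univ g]
  refine sum_congr rfl fun z _ => ?_
  rw [sum_congr rfl (g := fun _ => h z) (fun x hx => by rw [(mem_filter.1 hx).2]), sum_const,
    nsmul_eq_mul]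

section Quadratic

variable {F E : Type*} [Field F] [Fintype F] [Field E] [Fintype E] [Algebra F E]

theorem algebraMap_trace_of_finrank_two (h2 : Module.finrank F E = 2) (x : E) :
    algebraMap F E (Algebra.trace F E x) = x + x ^ Fintype.card F := by
  rw [FiniteField.algebraMap_trace_eq_sum_pow, h2, sum_range_succ, sum_range_one,
    Nat.card_eq_fintype_card]
  simp

theorem algebraMap_norm_of_finrank_two (h2 : Module.finrank F E = 2) (x : E) :
    algebraMap F E (Algebra.norm F x) = x * x ^ Fintype.card F := by
  rw [FiniteField.algebraMap_norm_eq_prod_pow, h2, prod_range_succ, prod_range_one,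
    Nat.card_eq_fintype_card]
  simp

variable [DecidableEq F] [DecidableEq E]

/-- Both fibres over `(t, n)` embed in the roots of `X² - t X + n` in `E`. If they are disjoint
there, two roots bound their union. A common element lies in `F` and has trace twice itself, hence
is a double root, and each fibre has at most one element. -/
theorem card_trace_norm_add_card_sum_prod_le (h2 : Module.finrank F E = 2) (z : F × F) :
    #{x : E | (Algebra.trace F E x, Algebra.norm F x) = z} +
      #{y : F × F | (y.1 + y.2, y.1 * y.2) = z} ≤ 2 := by
  obtain ⟨t, n⟩ := z
  set A : Finset E := {x : E | (Algebra.trace F E x, Algebra.norm F x) = (t, n)} with hA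
  set B : Finset (F × F) := {y : F × F | (y.1 + y.2, y.1 * y.2) = (t, n)} with hB
  set φ := algebraMap F E
  have hφ : Function.Injective φ := φ.injective
  set B' : Finset E := B.image (fun y => φ y.1) with hB'
  have hBcard : #B' = #B := by
    refine card_image_of_injOn fun y hy y' hy' h => ?_
    simp only [hB, coe_filter, mem_univ, true_and, Prod.mk.injEq, Set.mem_ofPred_eq] at hy hy'
    have h1 := hφ h
    exact Prod.ext h1 (by have := hy.1.trans hy'.1.symm; rw [h1] at this; exact add_left_cancel this)
  have hZA : ∀ x ∈ A, x * (φ t - x) = φ n := by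
    intro x hx
    simp only [hA, mem_filter, mem_univ, true_and, Prod.mk.injEq] at hx
    rw [← hx.1, ← hx.2, algebraMap_trace_of_finrank_two h2, algebraMap_norm_of_finrank_two h2]
    ring
  have hZB : ∀ x ∈ B', x * (φ t - x) = φ n := by
    intro x hx
    obtain ⟨y, hy, rfl⟩ := mem_image.1 hx
    simp only [hB, mem_filter, mem_univ, true_and, Prod.mk.injEq] at hy
    rw [← hy.1, ← hy.2, map_add, map_mul]
    ring
  have hpair : ∀ x w : E, x * (φ t - x) = φ n → w * (φ t - w) = φ n → w = x ∨ w = φ t - x := by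
    intro x w hx hw
    have : (w - x) * (w - (φ t - x)) = 0 := by linear_combination hx - hw
    rcases mul_eq_zero.1 this with h | h
    · exact Or.inl (sub_eq_zero.1 h)
    · exact Or.inr (sub_eq_zero.1 h)
  have hsub : ∀ C : Finset E, (∀ x ∈ C, x * (φ t - x) = φ n) → ∀ x ∈ C, C ⊆ {x, φ t - x} := by
    intro C hC x hx w hw
    simpa using hpair x w (hC x hx) (hC w hw)
  rw [← hBcard]
  by_cases hdis : Disjoint A B'
  · rw [← card_union_of_disjoint hdis]
    by_cases hne : (A ∪ B').Nonempty
    · obtain ⟨x, hx⟩ := hne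
      refine (card_le_card (hsub _ (fun w hw => ?_) x hx)).trans card_le_two
      rcases mem_union.1 hw with h | h
      · exact hZA w h
      · exact hZB w h
    · rw [not_nonempty_iff_eq_empty.1 hne]; simp
  · obtain ⟨x, hxA, hxB⟩ := not_disjoint_iff.1 hdis
    obtain ⟨y, hy, hyx⟩ := mem_image.1 hxB
    have hq : x ^ Fintype.card F = x := by rw [← hyx, ← map_pow, FiniteField.pow_card]
    have hxt : φ t - x = x := by
      have hx' := hxA
      simp only [hA, mem_filter, mem_univ, true_and, Prod.mk.injEq] at hx'
      rw [← hx'.1, algebraMap_trace_of_finrank_two h2, hq]; ring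
    have h1 := card_le_card (hsub A hZA x hxA)
    have h3 := card_le_card (hsub B' hZB x hxB)
    rw [hxt, pair_eq_singleton, card_singleton] at h1 h3
    omega

/-- Summed over all `z`, the bound 2 is attained: `|E| + |F|² = 2 |F|²`. So equality holds for each
`z`. -/
theorem card_trace_norm_add_card_sum_prod (h2 : Module.finrank F E = 2) (z : F × F) :
    #{x : E | (Algebra.trace F E x, Algebra.norm F x) = z} +
      #{y : F × F | (y.1 + y.2, y.1 * y.2) = z} = 2 := by
  have hE : Fintype.card E = Fintype.card F ^ 2 := by rw [← h2, ← Module.card_eq_pow_finrank]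
  have h := (sum_eq_sum_iff_of_le (s := univ)
    (f := fun z : F × F => #{x : E | (Algebra.trace F E x, Algebra.norm F x) = z} +
      #{y : F × F | (y.1 + y.2, y.1 * y.2) = z}) (g := fun _ => 2)
    (fun z _ => card_trace_norm_add_card_sum_prod_le h2 z)).1 (by
      rw [sum_add_distrib, ← card_eq_sum_card_fiberwise (fun _ _ => by simp),
        ← card_eq_sum_card_fiberwise (fun _ _ => by simp)]
      simp [hE]
      ring)
  exact h z (mem_univ z)

/-- Both `K_E` and `K_F²` are sums of one function `h` of two quantities: trace and norm, or sum and
product, since `Tr(1/x) = Tr(x)/N(x)` and `1/x + 1/y = (x+y)/(xy)`. Each pair `(t, n)` is hit twice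
in all, so `K_E + K_F²` is twice the sum of `h` over `F × F`. -/
theorem kloostermanSum_quadratic (h2 : Module.finrank F E = 2) (ψ : AddChar F ℂ) (hψ : ψ ≠ 1)
    {a b : F} (ha : a ≠ 0) (hb : b ≠ 0) :
    kloostermanSum (ψ.compAddMonoidHom (Algebra.trace F E).toAddMonoidHom)
      (algebraMap F E a) (algebraMap F E b) = 2 * Fintype.card F - kloostermanSum ψ a b ^ 2 := by
  set h : F × F → ℂ := fun z => if z.2 = 0 then 0 else ψ (a * z.1 + b * (z.1 * z.2⁻¹)) with hh
  have hKE : kloostermanSum (ψ.compAddMonoidHom (Algebra.trace F E).toAddMonoidHom)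
      (algebraMap F E a) (algebraMap F E b) =
      ∑ x : E, h (Algebra.trace F E x, Algebra.norm F x) := by
    rw [kloostermanSum, sum_filter]
    refine sum_congr rfl fun x _ => ?_
    by_cases hx : x = 0
    · subst hx
      simp [hh]
    · have hn : Algebra.norm F x ≠ 0 := by simpa [Algebra.norm_eq_zero_iff] using hx
      simp only [hh, if_neg hn, ne_eq, hx, not_false_eq_true]
      rw [if_pos trivial, AddChar.compAddMonoidHom_apply]
      congr 1
      have hinv : Algebra.trace F E x⁻¹ = Algebra.trace F E x * (Algebra.norm F x)⁻¹ := by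
        apply (algebraMap F E).injective
        rw [map_mul, map_inv₀ (algebraMap F E), algebraMap_trace_of_finrank_two h2,
          algebraMap_trace_of_finrank_two h2, algebraMap_norm_of_finrank_two h2]
        have : x ^ Fintype.card F ≠ 0 := pow_ne_zero _ hx
        rw [inv_pow]
        field_simp
        ring
      show Algebra.trace F E _ = _
      rw [map_add, ← Algebra.smul_def, ← Algebra.smul_def, map_smul, map_smul, hinv, smul_eq_mul,
        smul_eq_mul]
  have hKF : kloostermanSum ψ a b ^ 2 = ∑ y : F × F, h (y.1 + y.2, y.1 * y.2) := by
    rw [kloostermanSum, sum_filter, sq, sum_mul_sum, ← univ_product_univ, sum_product]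
    refine sum_congr rfl fun x _ => sum_congr rfl fun y _ => ?_
    by_cases hx : x = 0
    · simp [hh, hx]
    by_cases hy : y = 0
    · simp [hh, hy]
    simp only [hh, ne_eq, hx, hy, not_false_eq_true, if_true, mul_eq_zero, or_self, if_false]
    rw [← AddChar.map_add_eq_mul]
    congr 1
    field_simp
    ring
  rw [eq_sub_iff_add_eq, hKE, hKF, sum_comp_eq_sum_card_mul, sum_comp_eq_sum_card_mul, ← sum_add_distrib]
  have : ∀ z : F × F, (#{x : E | (Algebra.trace F E x, Algebra.norm F x) = z} : ℂ) * h z +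
      (#{y : F × F | (y.1 + y.2, y.1 * y.2) = z} : ℂ) * h z = 2 * h z := by
    intro z
    rw [← add_mul]
    congr 1
    exact_mod_cast card_trace_norm_add_card_sum_prod h2 z
  rw [sum_congr rfl fun z _ => this z, ← mul_sum]
  congr 1
  -- For fixed `n ≠ 0` the summand is the character `t ↦ ψ (t (a + b / n))`, whose sum vanishes
  -- except at `n = -b / a`.
  rw [← univ_product_univ, sum_product_right, sum_eq_single (-b / a)]
  · have hn : -b / a ≠ 0 := div_ne_zero (neg_ne_zero.2 hb) ha
    have : ∀ t : F, h (t, -b / a) = 1 := by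
      intro t
      simp only [hh, if_neg hn]
      rw [show a * t + b * (t * (-b / a)⁻¹) = 0 by field_simp; ring, AddChar.map_zero_eq_one]
    simp [this]
  · intro n _ hn
    by_cases hn0 : n = 0
    · simp [hh, hn0]
    · have hc : a + b * n⁻¹ ≠ 0 := by
        intro h0
        apply hn
        field_simp at h0 ⊢
        linear_combination h0
      have : ∀ t : F, h (t, n) = ψ (t * (a + b * n⁻¹)) := by
        intro t
        simp only [hh, if_neg hn0]
        congr 1; ring
      simp only [this]
      rw [AddChar.sum_mulShift _ (AddChar.IsPrimitive.of_ne_one hψ), if_neg hc]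
      simp
  · simp

end Quadratic

end

/-! ### Weil's bound for Kloosterman sums over the prime field. -/

section

open Polynomial Finset

theorem norm_addChar_eq_one {A : Type*} [AddGroup A] [Finite A] (ψ : AddChar A ℂ) (x : A) :
    ‖ψ x‖ = 1 := AddChar.norm_apply ψ x

/-- A one-sided bound suffices: if no `N s` exceeds the mean by more than `E`, the known total
forbids any from falling short by more than `|A| E`. The constant `M` is then removed by
orthogonality. -/
theorem norm_sum_mul_addChar_le {A : Type*} [AddCommGroup A] [Fintype A] (ψ : AddChar A ℂ)
    (hψ : ψ ≠ 1) (N : A → ℕ) {M E : ℝ} (hM : ∀ s, (N s : ℝ) ≤ M + E)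
    (htot : (∑ s, (N s : ℝ)) = Fintype.card A * M - 1) (hE : 1 ≤ E) :
    ‖∑ s, (N s : ℂ) * ψ s‖ ≤ (Fintype.card A : ℝ) ^ 2 * E := by
  classical
  have hlow : ∀ s, -(Fintype.card A * E) ≤ (N s : ℝ) - M := by
    intro s
    have h1 : ∑ s' ∈ univ.erase s, (N s' : ℝ) ≤ ∑ s' ∈ univ.erase s, (M + E) :=
      sum_le_sum fun s' _ => hM s'
    have h2 := add_sum_erase univ (fun s => (N s : ℝ)) (mem_univ s)
    have hpos : 1 ≤ Fintype.card A := Fintype.card_pos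
    rw [sum_const, card_erase_of_mem (mem_univ s), card_univ, nsmul_eq_mul, Nat.cast_sub hpos] at h1
    push_cast at h1
    nlinarith
  have habs : ∀ s, |(N s : ℝ) - M| ≤ Fintype.card A * E := by
    intro s
    have hpos : (1 : ℝ) ≤ Fintype.card A := by exact_mod_cast Fintype.card_pos
    exact abs_le.2 ⟨hlow s, by nlinarith [hM s]⟩
  have h0 : ∑ s, (N s : ℂ) * ψ s = ∑ s, (((N s : ℝ) - M : ℝ) : ℂ) * ψ s := by
    have : ∑ s, (M : ℂ) * ψ s = 0 := by
      rw [← mul_sum, AddChar.sum_eq_zero_of_ne_one hψ, mul_zero]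
    rw [← sub_zero (∑ s, (N s : ℂ) * ψ s), ← this, ← sum_sub_distrib]
    refine sum_congr rfl fun s _ => ?_
    push_cast
    ring
  rw [h0]
  refine (norm_sum_le _ _).trans ?_
  refine (sum_le_sum fun s _ => (?_ : _ ≤ (Fintype.card A : ℝ) * E)).trans ?_
  · rw [norm_mul, norm_addChar_eq_one, mul_one, Complex.norm_real]
    exact habs s
  · rw [sum_const, card_univ, nsmul_eq_mul]
    apply le_of_eq; ring

section Trace

variable {p : ℕ} [Fact p.Prime]

/-- The Kloosterman sum over an extension of the prime field, for the lifted character. -/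
noncomputable def liftedKloosterman (ψ : AddChar (ZMod p) ℂ) (a b : ZMod p) (F : Type*) [Field F]
    [Fintype F] [DecidableEq F] [Algebra (ZMod p) F] : ℂ :=
  kloostermanSum (ψ.compAddMonoidHom (Algebra.trace (ZMod p) F).toAddMonoidHom)
    (algebraMap (ZMod p) F a) (algebraMap (ZMod p) F b)

theorem norm_liftedKloosterman_le (hp : 3 ≤ p) {ψ : AddChar (ZMod p) ℂ} (hψ : ψ ≠ 1)
    {a b : ZMod p} (ha : a ≠ 0) (F : Type*) [Field F] [Fintype F] [DecidableEq F]
    [Algebra (ZMod p) F] (n : ℕ) (hF : Fintype.card F = p ^ (2 * (n + 1))) :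
    ‖liftedKloosterman ψ a b F‖ ≤ 4 * p ^ 2 * p ^ (n + 1) := by
  have : CharP F p := charP_of_injective_algebraMap (algebraMap (ZMod p) F).injective p
  set φ := algebraMap (ZMod p) F
  have hp0 : 0 < p := by omega
  have hrank : Module.finrank (ZMod p) F = 2 * (n + 1) := by
    have h := Module.card_eq_pow_finrank (K := ZMod p) (V := F)
    rw [hF, ZMod.card] at h
    exact (Nat.pow_right_injective (by omega) h).symm
  have hfix : ∀ c : ZMod p, φ c ^ p = φ c := fun c => by rw [← map_pow, ZMod.pow_card]
  set g : F → ZMod p := fun x => Algebra.trace (ZMod p) F (φ a * x + φ b * x⁻¹) with hg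
  set N : ZMod p → ℕ := fun s => #{x : F | x ≠ 0 ∧ g x = s} with hN
  have hK : liftedKloosterman ψ a b F = ∑ s, (N s : ℂ) * ψ s := by
    rw [liftedKloosterman, kloostermanSum, ← sum_fiberwise _ g]
    refine sum_congr rfl fun s _ => ?_
    rw [sum_congr rfl (g := fun _ => ψ s), sum_const, nsmul_eq_mul, filter_filter]
    intro x hx
    rw [← (mem_filter.1 hx).2]
    rfl
  have hNle : ∀ s, N s ≤ p ^ (2 * n + 1) + 4 * p ^ (n + 1) := by
    intro s
    refine le_trans (le_of_eq ?_)
      (card_filter_trace_le hp n hF (hfix a) (hfix b) ((map_ne_zero φ).2 ha) (φ s))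
    simp only [hN]
    congr 1
    ext x
    simp only [mem_filter, mem_univ, true_and, and_congr_right_iff]
    intro _
    rw [← φ.injective.eq_iff, hg]
    simp only [φ]
    rw [FiniteField.algebraMap_trace_eq_sum_pow, hrank, Nat.card_eq_fintype_card, ZMod.card]
  have htot : (∑ s, (N s : ℝ)) = Fintype.card (ZMod p) * (p : ℝ) ^ (2 * n + 1) - 1 := by
    have h1 : ∑ s, N s + 1 = p ^ (2 * (n + 1)) := by
      rw [← hF]
      have h2 := card_eq_sum_card_fiberwise (s := univ.filter fun x : F => x ≠ 0) (f := g)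
        (t := univ) (fun _ _ => by simp)
      have h3 : #(univ.filter fun x : F => x ≠ 0) + 1 = Fintype.card F := by
        rw [filter_ne', card_erase_of_mem (mem_univ _), card_univ]
        exact Nat.sub_add_cancel Fintype.card_pos
      rw [← h3, h2]
      simp only [hN, filter_filter]
    have h2 : ((∑ s, N s : ℕ) : ℝ) + 1 = (p : ℝ) ^ (2 * (n + 1)) := by exact_mod_cast h1
    push_cast at h2
    rw [ZMod.card]
    rw [show 2 * (n + 1) = (2 * n + 1) + 1 by ring, pow_succ'] at h2
    linarith
  rw [hK]
  have hone : (1 : ℝ) ≤ (p : ℝ) ^ (n + 1) := one_le_pow₀ (by exact_mod_cast hp0)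
  refine (norm_sum_mul_addChar_le ψ hψ N (M := (p : ℝ) ^ (2 * n + 1)) (E := 4 * p ^ (n + 1))
    (fun s => by exact_mod_cast hNle s) htot (by linarith)).trans (le_of_eq ?_)
  rw [ZMod.card]; ring

theorem liftedKloosterman_quadratic {ψ : AddChar (ZMod p) ℂ} (hψ : ψ ≠ 1)
    {a b : ZMod p} (ha : a ≠ 0) (hb : b ≠ 0) (F E : Type*) [Field F] [Fintype F] [DecidableEq F]
    [Algebra (ZMod p) F] [Field E] [Fintype E] [DecidableEq E] [Algebra (ZMod p) E] [Algebra F E]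
    [IsScalarTower (ZMod p) F E] (h2 : Module.finrank F E = 2) :
    liftedKloosterman ψ a b E = 2 * Fintype.card F - liftedKloosterman ψ a b F ^ 2 := by
  have hψ' : ψ.compAddMonoidHom (Algebra.trace (ZMod p) F).toAddMonoidHom ≠ 1 := by
    intro h
    apply hψ
    ext s
    obtain ⟨x, rfl⟩ := Algebra.trace_surjective (ZMod p) F s
    exact DFunLike.congr_fun h x
  rw [liftedKloosterman, liftedKloosterman,
    ← kloostermanSum_quadratic h2 _ hψ' ((map_ne_zero (algebraMap (ZMod p) F)).2 ha)
      ((map_ne_zero (algebraMap (ZMod p) F)).2 hb),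
    ← IsScalarTower.algebraMap_apply, ← IsScalarTower.algebraMap_apply]
  congr 1
  ext x
  simp only [AddChar.compAddMonoidHom_apply]
  congr 1
  exact (Algebra.trace_trace (R := ZMod p) (S := F) x).symm

/-- With `S = √|F|`, the quadratic identity gives `‖K_E‖ ≥ ‖K_F‖² - 2 S²`, and `(2 + δ)² - 2 ≥ 2 + 4
δ`. Each quadratic extension therefore multiplies the normalised excess by at least 4. -/
theorem exists_extension_kloosterman_large {ψ : AddChar (ZMod p) ℂ} (hψ : ψ ≠ 1)
    {a b : ZMod p} (ha : a ≠ 0) (hb : b ≠ 0) {δ : ℝ} (hδ : 0 ≤ δ)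
    (h0 : (2 + δ) * Real.sqrt p ≤ ‖kloostermanSum ψ a b‖) (j : ℕ) :
    ∃ (F : Type) (_ : Field F) (_ : Fintype F) (_ : DecidableEq F) (_ : Algebra (ZMod p) F),
      Fintype.card F = p ^ 2 ^ j ∧
        (2 + 4 ^ j * δ) * Real.sqrt p ^ 2 ^ j ≤ ‖liftedKloosterman ψ a b F‖ := by
  induction j with
  | zero =>
    refine ⟨ZMod p, inferInstance, inferInstance, inferInstance, inferInstance, by simp, ?_⟩
    have : liftedKloosterman ψ a b (ZMod p) = kloostermanSum ψ a b := by
      rw [liftedKloosterman]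
      congr 1
      ext x
      simp
    simpa [this] using h0
  | succ j ih =>
    obtain ⟨F, _, _, _, _, hcard, hF⟩ := ih
    have : CharP F p := charP_of_injective_algebraMap (algebraMap (ZMod p) F).injective p
    let E := FiniteField.Extension F p 2
    let : Fintype E := Fintype.ofFinite E
    let : DecidableEq E := Classical.decEq E
    have h2 : Module.finrank F E = 2 := FiniteField.finrank_extension F p 2
    refine ⟨E, inferInstance, inferInstance, inferInstance, inferInstance, ?_, ?_⟩
    · rw [Module.card_eq_pow_finrank (K := F) (V := E), h2, hcard, ← pow_mul, pow_succ]
    · rw [liftedKloosterman_quadratic hψ ha hb F E h2]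
      set S := Real.sqrt p ^ 2 ^ j with hS
      have hSS : (Fintype.card F : ℝ) = S ^ 2 := by
        rw [hcard, hS, ← pow_mul, mul_comm, pow_mul, Real.sq_sqrt (by positivity)]
        simp
      have hS' : Real.sqrt p ^ 2 ^ (j + 1) = S ^ 2 := by rw [hS, ← pow_mul, pow_succ]
      have hS0 : 0 ≤ S := by positivity
      rw [hS']
      set k := liftedKloosterman ψ a b F
      have hk : ‖k‖ ^ 2 - 2 * S ^ 2 ≤ ‖2 * (Fintype.card F : ℂ) - k ^ 2‖ := by
        have := norm_sub_norm_le (k ^ 2) (2 * (Fintype.card F : ℂ))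
        rw [norm_sub_rev, norm_pow, norm_mul, Complex.norm_natCast, hSS] at this
        simpa using this
      refine le_trans ?_ hk
      have h4 : 0 ≤ (4 : ℝ) ^ j * δ := by positivity
      have hk2 : ((2 + 4 ^ j * δ) * S) ^ 2 ≤ ‖k‖ ^ 2 :=
        pow_le_pow_left₀ (by positivity) hF 2
      rw [pow_succ]
      nlinarith [mul_nonneg (sq_nonneg ((4 : ℝ) ^ j * δ)) (sq_nonneg S)]

/-- Weil's bound for Kloosterman sums. -/
theorem norm_kloostermanSum_le (hp : 3 ≤ p) {ψ : AddChar (ZMod p) ℂ} (hψ : ψ ≠ 1)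
    {a b : ZMod p} (ha : a ≠ 0) (hb : b ≠ 0) : ‖kloostermanSum ψ a b‖ ≤ 2 * Real.sqrt p := by
  by_contra! hlt
  have hs : 0 < Real.sqrt p := Real.sqrt_pos.2 (by exact_mod_cast (by omega : 0 < p))
  set δ := ‖kloostermanSum ψ a b‖ / Real.sqrt p - 2 with hδ
  have hδ0 : 0 < δ := by rw [hδ, sub_pos, lt_div_iff₀ hs]; exact hlt
  have h0 : (2 + δ) * Real.sqrt p ≤ ‖kloostermanSum ψ a b‖ := by
    rw [hδ, add_sub_cancel, div_mul_cancel₀ _ hs.ne']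
  obtain ⟨j, hj⟩ := pow_unbounded_of_one_lt (4 * (p : ℝ) ^ 2 / δ) (by norm_num : (1 : ℝ) < 4)
  obtain ⟨F, _, _, _, _, hcard, hF⟩ := exists_extension_kloosterman_large hψ ha hb hδ0.le h0 (j + 1)
  -- One extension beyond `j` makes the degree even, in the shape `2 (n + 1)` that the Stepanov
  -- bound requires.
  have hpow : 2 ^ (j + 1) = 2 * ((2 ^ j - 1) + 1) := by
    rw [Nat.sub_add_cancel (Nat.one_le_two_pow), pow_succ']
  rw [hpow] at hcard hF
  have hle := norm_liftedKloosterman_le hp hψ (b := b) ha F _ hcard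
  rw [pow_mul, Real.sq_sqrt (by positivity)] at hF
  set S := (p : ℝ) ^ (2 ^ j - 1 + 1)
  have hS : 0 < S := by have : 0 < p := by omega
                        positivity
  have h1 := le_of_mul_le_mul_right (hF.trans hle) hS
  rw [div_lt_iff₀ hδ0] at hj
  rw [pow_succ] at h1
  nlinarith [mul_pos (pow_pos (by norm_num : (0 : ℝ) < 4) j) hδ0]

end Trace

end

/-! ### Twisted quadratic character sums of two linear forms. -/

section

open Finset

section TwistedQuadratic

variable {p : ℕ} [Fact p.Prime]

/-- The quadratic character of `ZMod p` with complex values. -/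
noncomputable def quadC (p : ℕ) [Fact p.Prime] : MulChar (ZMod p) ℂ :=
  (quadraticChar (ZMod p)).ringHomComp (Int.castRingHom ℂ)

theorem quadC_apply (x : ZMod p) : quadC p x = (quadraticChar (ZMod p) x : ℤ) := rfl

theorem quadC_ne_one (hp : 3 ≤ p) : quadC p ≠ 1 := by
  have h := quadraticChar_ne_one (F := ZMod p) (by rw [ZMod.ringChar_zmod_n]; omega)
  exact (MulChar.ringHomComp_ne_one_iff (RingHom.injective_int (Int.castRingHom ℂ))).2 h

theorem quadC_isQuadratic : (quadC p).IsQuadratic :=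
  (quadraticChar_isQuadratic (ZMod p)).comp _

theorem norm_quadC {x : ZMod p} (hx : x ≠ 0) : ‖quadC p x‖ = 1 := by
  rw [quadC_apply]
  rcases quadraticChar_dichotomy hx with h | h <;> simp [h]

theorem norm_quadC_le (x : ZMod p) : ‖quadC p x‖ ≤ 1 := by
  by_cases hx : x = 0
  · rw [hx, MulChar.map_zero, norm_zero]; exact zero_le_one
  · exact (norm_quadC hx).le

theorem norm_gaussSum_quadC (hp : 3 ≤ p) {ψ : AddChar (ZMod p) ℂ} (hψ : ψ ≠ 1) :
    ‖gaussSum (quadC p) ψ‖ = Real.sqrt p := by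
  have h : gaussSum (quadC p) ψ ^ 2 = quadC p (-1) * Fintype.card (ZMod p) := gaussSum_sq (quadC_ne_one hp) quadC_isQuadratic
    (AddChar.IsPrimitive.of_ne_one hψ)
  have h' := congrArg norm h
  rw [norm_pow, norm_mul, norm_quadC (neg_ne_zero.2 one_ne_zero), one_mul, Complex.norm_natCast,
    ZMod.card] at h'
  rw [← h', Real.sqrt_sq (norm_nonneg _)]

theorem sum_quadC_linear_mul (hp : 3 ≤ p) {γ : ZMod p} (hγ : γ ≠ 0) (δ : ZMod p)
    (ψ : AddChar (ZMod p) ℂ) :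
    ‖∑ k, quadC p (γ * k + δ) * ψ k‖ ≤ Real.sqrt p := by
  have h : ∑ k, quadC p (γ * k + δ) * ψ k = ψ (-δ / γ) * gaussSum (quadC p) (ψ.mulShift γ⁻¹) := by
    rw [gaussSum, mul_sum]
    refine Fintype.sum_equiv ((Equiv.mulLeft₀ γ hγ).trans (Equiv.addRight δ)) _ _ fun k => ?_
    simp only [Equiv.trans_apply, Equiv.mulLeft₀_apply, Equiv.coe_addRight,
      AddChar.mulShift_apply]
    rw [mul_left_comm, ← AddChar.map_add_eq_mul]
    congr 2
    field_simp
    ring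
  rw [h, norm_mul, norm_addChar_eq_one, one_mul]
  by_cases hψ : ψ.mulShift γ⁻¹ = 1
  · rw [hψ, gaussSum_one_right (quadC_ne_one hp)]
    simp
  · exact (norm_gaussSum_quadC hp hψ).le

theorem sum_quadC_linear (hp : 3 ≤ p) {γ : ZMod p} (hγ : γ ≠ 0) (δ : ZMod p) :
    ∑ k, quadC p (γ * k + δ) = 0 := by
  rw [← MulChar.sum_eq_zero_of_ne_one (quadC_ne_one hp)]
  exact Fintype.sum_equiv ((Equiv.mulLeft₀ γ hγ).trans (Equiv.addRight δ)) _ _ fun k => rfl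

theorem two_ne_zero_zmod (hp : 3 ≤ p) : (2 : ZMod p) ≠ 0 := by
  intro h
  have h' : ((2 : ℕ) : ZMod p) = 0 := by exact_mod_cast h
  rw [ZMod.natCast_eq_zero_iff] at h'
  exact absurd (Nat.le_of_dvd (by norm_num) h') (by omega)

/-- `1 + χ(y² - c)` counts the square roots `z` of `y² - c`. The hyperbola `(y + z)(y - z) = c` is
parametrised by `u = y + z ≠ 0`, with `y = (u + c / u) / 2`, and this is a Kloosterman sum. -/
theorem sum_quadC_sq_sub_mul (hp : 3 ≤ p) (c : ZMod p) (hc : c ≠ 0) (ψ : AddChar (ZMod p) ℂ) :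
    ∑ y, quadC p (y ^ 2 - c) * ψ y = kloostermanSum ψ 2⁻¹ (c * 2⁻¹) - ∑ y, ψ y := by
  have h2 := two_ne_zero_zmod hp
  rw [eq_sub_iff_add_eq, ← sum_add_distrib]
  have h1 : ∀ y : ZMod p, quadC p (y ^ 2 - c) * ψ y + ψ y =
      ∑ z : ZMod p, if z ^ 2 = y ^ 2 - c then ψ y else 0 := by
    intro y
    have := quadraticChar_card_sqrts (F := ZMod p) (by rw [ZMod.ringChar_zmod_n]; omega) (y ^ 2 - c)
    rw [← sum_filter, sum_const, nsmul_eq_mul, quadC_apply]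
    rw [← add_one_mul]
    congr 1
    have h3 : ((#({x : ZMod p | x ^ 2 = y ^ 2 - c}) : ℤ) : ℂ) =
        ((quadraticChar (ZMod p) (y ^ 2 - c) + 1 : ℤ) : ℂ) := by
      rw [← this]
      simp
    push_cast at h3
    rw [h3]
  rw [sum_congr rfl fun y _ => h1 y, ← sum_product', ← sum_filter, kloostermanSum]
  refine sum_bij' (fun x _ => x.1 + x.2) (fun u _ => ((u + c * u⁻¹) * 2⁻¹, (u - c * u⁻¹) * 2⁻¹))
    ?_ ?_ ?_ ?_ ?_
  · intro x hx
    simp only [mem_filter, univ_product_univ, mem_univ, true_and] at hx ⊢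
    intro h
    apply hc
    have : x.2 = -x.1 := by linear_combination h
    rw [this] at hx
    linear_combination hx
  · intro u hu
    simp only [mem_filter, univ_product_univ, mem_univ, true_and] at hu ⊢
    field_simp
    ring
  · rintro ⟨y, z⟩ hx
    simp only [mem_filter, univ_product_univ, mem_univ, true_and] at hx
    have h0 : y + z ≠ 0 := by
      intro h
      apply hc
      have : z = -y := by linear_combination h
      rw [this] at hx
      linear_combination hx
    have h3 : c * (y + z)⁻¹ = y - z := by
      field_simp
      linear_combination hx
    simp only [h3]
    ext
    · field_simp; ring
    · field_simp; ring
  · intro u hu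
    simp only [mem_filter, mem_univ, true_and] at hu
    field_simp
    ring
  · rintro ⟨y, z⟩ hx
    simp only [mem_filter, univ_product_univ, mem_univ, true_and] at hx
    have h0 : y + z ≠ 0 := by
      intro h
      apply hc
      have : z = -y := by linear_combination h
      rw [this] at hx
      linear_combination hx
    congr 1
    field_simp
    linear_combination -hx

theorem kloostermanSum_one_sub (a b : ZMod p) :
    kloostermanSum (1 : AddChar (ZMod p) ℂ) a b - ∑ y : ZMod p, (1 : AddChar (ZMod p) ℂ) y = -1 := by
  rw [kloostermanSum, filter_ne', ← add_sum_erase univ _ (mem_univ (0 : ZMod p))]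
  simp

/-- Complete the square: `η` is the midpoint of the two roots and `e` half their difference, nonzero
precisely because the determinant is. -/
theorem sum_quadC_mul_quadratic (α β γ δ : ZMod p) (hp : 3 ≤ p) (hα : α ≠ 0) (hγ : γ ≠ 0)
    (hdet : α * δ - β * γ ≠ 0) (ψ : AddChar (ZMod p) ℂ) :
    ∃ c η : ZMod p, c ≠ 0 ∧ ∑ k, quadC p ((α * k + β) * (γ * k + δ)) * ψ k =
      quadC p (α * γ) * ψ η * (kloostermanSum ψ 2⁻¹ (c * 2⁻¹) - ∑ y, ψ y) := by
  have h2 := two_ne_zero_zmod hp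
  set η := -(β / α + δ / γ) / 2 with hη
  set e := (δ / γ - β / α) / 2 with he
  have he0 : e ≠ 0 := by
    rw [he]
    refine div_ne_zero ?_ h2
    intro h
    apply hdet
    field_simp at h
    linear_combination h
  refine ⟨e ^ 2, η, pow_ne_zero 2 he0, ?_⟩
  rw [← sum_quadC_sq_sub_mul hp _ (pow_ne_zero 2 he0), mul_sum, ← Equiv.sum_comp (Equiv.addRight η)]
  refine sum_congr rfl fun k _ => ?_
  rw [Equiv.coe_addRight, AddChar.map_add_eq_mul,
    show (α * (k + η) + β) * (γ * (k + η) + δ) = α * γ * (k ^ 2 - e ^ 2) by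
      rw [hη, he]; field_simp; ring, map_mul]
  ring

/-- Three regimes share the bound: Gauss sums when one form is constant, the value `±1` for trivial
`ψ`, and Weil's bound otherwise. Completion needs all characters at once. -/
theorem norm_sum_quadC_mul_le (hp : 3 ≤ p) (α β γ δ : ZMod p) (hdet : α * δ - β * γ ≠ 0)
    (ψ : AddChar (ZMod p) ℂ) :
    ‖∑ k, quadC p ((α * k + β) * (γ * k + δ)) * ψ k‖ ≤ 2 * Real.sqrt p := by
  have hs : 0 ≤ Real.sqrt p := Real.sqrt_nonneg _
  have hone : ∀ (c u v : ZMod p), u ≠ 0 →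
      ‖∑ k, quadC p (c * (u * k + v)) * ψ k‖ ≤ 2 * Real.sqrt p := by
    intro c u v hu
    simp only [map_mul, mul_assoc]
    rw [← mul_sum, norm_mul]
    have := sum_quadC_linear_mul hp hu v ψ
    have h2 := norm_quadC_le c
    nlinarith [norm_nonneg (∑ k, quadC p (u * k + v) * ψ k)]
  by_cases hα : α = 0
  · have hγ : γ ≠ 0 := by rintro rfl; simp [hα] at hdet
    simpa [hα] using hone β γ δ hγ
  by_cases hγ : γ = 0
  · simpa [hγ, mul_comm] using hone δ α β hα
  obtain ⟨c, η, hc, h⟩ := sum_quadC_mul_quadratic α β γ δ hp hα hγ hdet ψ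
  rw [h, norm_mul, norm_mul, norm_addChar_eq_one, norm_quadC (mul_ne_zero hα hγ), one_mul, one_mul]
  have h2 := two_ne_zero_zmod hp
  by_cases hψ : ψ = 1
  · subst hψ
    rw [kloostermanSum_one_sub, norm_neg, norm_one]
    have : 1 ≤ Real.sqrt p := Real.one_le_sqrt.2 (by exact_mod_cast (by omega : 1 ≤ p))
    linarith
  · rw [AddChar.sum_eq_zero_of_ne_one hψ, sub_zero]
    exact norm_kloostermanSum_le hp hψ (inv_ne_zero h2) (mul_ne_zero hc (inv_ne_zero h2))

theorem sum_quadC_mul_of_ne_zero (hp : 3 ≤ p) (α β γ δ : ZMod p) (hα : α ≠ 0) (hγ : γ ≠ 0)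
    (hdet : α * δ - β * γ ≠ 0) :
    ∑ k, quadC p ((α * k + β) * (γ * k + δ)) = -quadC p (α * γ) := by
  obtain ⟨c, η, hc, h⟩ := sum_quadC_mul_quadratic α β γ δ hp hα hγ hdet 1
  rw [kloostermanSum_one_sub] at h
  simpa using h

end TwistedQuadratic

end

/-! ### Completion of incomplete sums and the Chinese remainder theorem. -/

section

open Finset

/-- The left side equals `4 ‖j/m‖`, with distance to the nearest integer; the bound is `|e(x) - 1| =
2 |sin πx|` with Jordan's inequality. -/
theorem norm_stdAddChar_sub_one_ge {m : ℕ} [NeZero m] (j : ZMod m) :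
    4 * min (j.val : ℝ) (m - j.val) / m ≤ ‖ZMod.stdAddChar j - 1‖ := by
  have hm : (0 : ℝ) < m := by exact_mod_cast NeZero.pos m
  have hlt : (j.val : ℝ) < m := by exact_mod_cast ZMod.val_lt j
  have h0 : (0 : ℝ) ≤ j.val := by positivity
  have hz : ZMod.stdAddChar j = Complex.exp (Complex.I * ((2 * Real.pi * j.val / m : ℝ) : ℂ)) := by
    conv_lhs => rw [← ZMod.natCast_zmod_val j]
    have := ZMod.stdAddChar_coe (N := m) (j.val : ℤ)
    push_cast at this
    rw [this]
    congr 1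
    push_cast
    ring
  rw [hz, Complex.norm_exp_I_mul_ofReal_sub_one, Real.norm_eq_abs, abs_mul,
    abs_of_pos (by norm_num : (0 : ℝ) < 2)]
  set x : ℝ := j.val / m with hx
  have hx0 : 0 ≤ x := by positivity
  have hx1 : x ≤ 1 := by rw [hx, div_le_one hm]; exact hlt.le
  rw [show 2 * Real.pi * (j.val : ℝ) / m / 2 = Real.pi * x by rw [hx]; ring]
  have hmin : min (j.val : ℝ) (m - j.val) = m * min x (1 - x) := by
    rw [mul_min_of_nonneg _ _ hm.le, hx]
    congr 1
    · field_simp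
    · field_simp
  rw [hmin, show 4 * (m * min x (1 - x)) / m = 2 * (2 * min x (1 - x)) by field_simp; ring]
  refine mul_le_mul_of_nonneg_left ?_ (by norm_num)
  refine le_trans ?_ (le_abs_self _)
  have hpi := Real.pi_pos
  rcases le_total x (1 / 2) with h | h
  · have := Real.mul_le_sin (x := Real.pi * x) (by positivity) (by nlinarith)
    rw [show 2 / Real.pi * (Real.pi * x) = 2 * x by field_simp] at this
    exact le_trans (by linarith [min_le_left x (1 - x)]) this
  · have := Real.mul_le_sin (x := Real.pi * (1 - x)) (by
      have : 0 ≤ 1 - x := by linarith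
      positivity) (by nlinarith)
    rw [show 2 / Real.pi * (Real.pi * (1 - x)) = 2 * (1 - x) by field_simp,
      show Real.pi * (1 - x) = Real.pi - Real.pi * x by ring, Real.sin_pi_sub] at this
    exact le_trans (by linarith [min_le_right x (1 - x)]) this

/-- A geometric series. Adding both reciprocals, instead of taking the larger one, makes the sum
over `j` harmonic and avoids splitting at `m / 2`. -/
theorem norm_sum_stdAddChar_range_le {m : ℕ} [NeZero m] {j : ZMod m} (hj : j ≠ 0) (a : ZMod m)
    (n : ℕ) : ‖∑ i ∈ range n, ZMod.stdAddChar (j * (a + (i : ZMod m)))‖ ≤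
      m / 2 * ((j.val : ℝ)⁻¹ + (m - j.val : ℝ)⁻¹) := by
  have hm : (0 : ℝ) < m := by exact_mod_cast NeZero.pos m
  have hlt : (j.val : ℝ) < m := by exact_mod_cast ZMod.val_lt j
  have h0 : (0 : ℝ) < j.val := by
    exact_mod_cast Nat.pos_of_ne_zero (by rwa [ne_eq, ZMod.val_eq_zero])
  set z := ZMod.stdAddChar j with hz
  have hmin : 0 < min (j.val : ℝ) (m - j.val) := lt_min h0 (by linarith)
  have hz1 : 0 < ‖z - 1‖ := lt_of_lt_of_le (by positivity) (norm_stdAddChar_sub_one_ge j)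
  have hsum : ∑ i ∈ range n, ZMod.stdAddChar (j * (a + (i : ZMod m))) =
      ZMod.stdAddChar (j * a) * ∑ i ∈ range n, z ^ i := by
    rw [mul_sum]
    refine sum_congr rfl fun i _ => ?_
    rw [mul_add, AddChar.map_add_eq_mul, mul_comm j (i : ZMod m), ← nsmul_eq_mul,
      AddChar.map_nsmul_eq_pow]
  have hgeom : ‖∑ i ∈ range n, z ^ i‖ * ‖z - 1‖ ≤ 2 := by
    rw [← norm_mul, geom_sum_mul]
    refine (norm_sub_le _ _).trans ?_
    rw [norm_pow, hz, norm_addChar_eq_one]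
    norm_num
  rw [hsum, norm_mul, norm_addChar_eq_one, one_mul]
  have h4 : ‖∑ i ∈ range n, z ^ i‖ * (4 * min (j.val : ℝ) (m - j.val) / m) ≤ 2 :=
    (mul_le_mul_of_nonneg_left (norm_stdAddChar_sub_one_ge j) (norm_nonneg _)).trans hgeom
  have h5 : ‖∑ i ∈ range n, z ^ i‖ ≤ m / 2 * (min (j.val : ℝ) (m - j.val))⁻¹ := by
    rw [← div_eq_mul_inv, le_div_iff₀ hmin]
    have : ‖∑ i ∈ range n, z ^ i‖ * (4 * min (j.val : ℝ) (m - j.val) / m) * m ≤ 2 * m :=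
      mul_le_mul_of_nonneg_right h4 hm.le
    rw [mul_assoc, div_mul_cancel₀ _ hm.ne'] at this
    linarith
  refine h5.trans (mul_le_mul_of_nonneg_left ?_ (by positivity))
  rcases min_choice (j.val : ℝ) (m - j.val) with h | h <;> rw [h]
  · have : 0 ≤ ((m : ℝ) - j.val)⁻¹ := inv_nonneg.2 (by linarith)
    linarith
  · have : 0 ≤ (j.val : ℝ)⁻¹ := inv_nonneg.2 h0.le
    linarith

theorem sum_inv_val_le (m : ℕ) [NeZero m] :
    ∑ j ∈ univ.filter (fun j : ZMod m => j ≠ 0), ((j.val : ℝ)⁻¹ + (m - j.val : ℝ)⁻¹) ≤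
      2 * (1 + Real.log m) := by
  have h1 : ∑ j ∈ univ.filter (fun j : ZMod m => j ≠ 0), (j.val : ℝ)⁻¹ ≤ 1 + Real.log m := by
    have h2 : ∑ j ∈ univ.filter (fun j : ZMod m => j ≠ 0), (j.val : ℝ)⁻¹ ≤
        ∑ i ∈ Icc 1 m, (i : ℝ)⁻¹ := by
      rw [← sum_image (f := fun i : ℕ => (i : ℝ)⁻¹) (g := fun j : ZMod m => j.val)
        (fun x _ y _ h => ZMod.val_injective m h)]
      refine sum_le_sum_of_subset_of_nonneg ?_ fun _ _ _ => by positivity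
      intro i hi
      obtain ⟨j, hj, rfl⟩ := mem_image.1 hi
      have hj' : j.val ≠ 0 := by rw [ne_eq, ZMod.val_eq_zero]; exact (mem_filter.1 hj).2
      exact mem_Icc.2 ⟨by omega, (ZMod.val_lt j).le⟩
    have h3 := harmonic_le_one_add_log m
    rw [harmonic_eq_sum_Icc] at h3
    push_cast at h3
    exact h2.trans h3
  have h2 : ∑ j ∈ univ.filter (fun j : ZMod m => j ≠ 0), (m - j.val : ℝ)⁻¹ =
      ∑ j ∈ univ.filter (fun j : ZMod m => j ≠ 0), (j.val : ℝ)⁻¹ := by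
    refine sum_bij' (fun j _ => -j) (fun j _ => -j) ?_ ?_ ?_ ?_ ?_
    · intro j hj; simpa using hj
    · intro j hj; simpa using hj
    · simp
    · simp
    · intro j hj
      have hj' : j ≠ 0 := (mem_filter.1 hj).2
      have : NeZero j := ⟨hj'⟩
      rw [ZMod.val_neg_of_ne_zero, Nat.cast_sub (ZMod.val_lt j).le]
  rw [sum_add_distrib, h2]
  linarith

/-- The Pólya–Vinogradov completion method. -/
theorem norm_sum_range_sub_mean_le {m : ℕ} [NeZero m] (f : ZMod m → ℂ) {B : ℝ}
    (hB : ∀ ψ : AddChar (ZMod m) ℂ, ‖∑ x, f x * ψ x‖ ≤ B) (a : ℤ) (n : ℕ) :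
    ‖∑ i ∈ range n, f ((a + i : ℤ)) - n / m * ∑ x, f x‖ ≤ B * (1 + Real.log m) := by
  have hm : (m : ℂ) ≠ 0 := by exact_mod_cast NeZero.ne m
  have hm' : (0 : ℝ) < m := by exact_mod_cast NeZero.pos m
  have hB0 : 0 ≤ B := (norm_nonneg _).trans (hB 1)
  set D : ZMod m → ℂ := fun j => ∑ i ∈ range n, ZMod.stdAddChar (j * ((a : ZMod m) + (i : ZMod m))) with hD
  set T := ZMod.dft f with hT
  have hinv : ∀ x, f x = (m : ℂ)⁻¹ * ∑ j, ZMod.stdAddChar (j * x) * T j := by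
    intro x
    have := ZMod.invDFT_apply T x
    rw [hT, LinearEquiv.symm_apply_apply] at this
    rw [this]
    simp [hT]
  have hTB : ∀ j, ‖T j‖ ≤ B := by
    intro j
    rw [hT, ZMod.dft_apply]
    refine le_trans (le_of_eq ?_) (hB (ZMod.stdAddChar.mulShift (-j)))
    congr 1
    refine sum_congr rfl fun x _ => ?_
    rw [AddChar.mulShift_apply, smul_eq_mul, mul_comm]
    congr 2
    ring
  have hT0 : T 0 = ∑ x, f x := by rw [hT, ZMod.dft_apply]; simp
  have hD0 : D 0 = n := by simp [hD]
  have hsum : ∑ i ∈ range n, f ((a + i : ℤ)) = (m : ℂ)⁻¹ * ∑ j, D j * T j := by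
    simp only [hinv, ← mul_sum]
    rw [sum_comm]
    congr 1
    refine sum_congr rfl fun j _ => ?_
    rw [hD, sum_mul]
    refine sum_congr rfl fun i _ => ?_
    push_cast
    rfl
  rw [hsum, ← add_sum_erase univ _ (mem_univ (0 : ZMod m)), hD0, hT0, mul_add,
    show (m : ℂ)⁻¹ * (n * ∑ x, f x) = n / m * ∑ x, f x by ring, add_sub_cancel_left, norm_mul,
    norm_inv, Complex.norm_natCast, ← filter_ne']
  have hbound : ‖∑ j ∈ univ.filter (fun j : ZMod m => j ≠ 0), D j * T j‖ ≤
      ∑ j ∈ univ.filter (fun j : ZMod m => j ≠ 0),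
        (m / 2 * B) * ((j.val : ℝ)⁻¹ + (m - j.val : ℝ)⁻¹) := by
    refine (norm_sum_le _ _).trans (sum_le_sum fun j hj => ?_)
    rw [norm_mul]
    have h1 := norm_sum_stdAddChar_range_le (mem_filter.1 hj).2 (a : ZMod m) n
    calc ‖D j‖ * ‖T j‖ ≤ (m / 2 * ((j.val : ℝ)⁻¹ + (m - j.val : ℝ)⁻¹)) * B :=
          mul_le_mul h1 (hTB j) (norm_nonneg _) ((norm_nonneg _).trans h1)
      _ = _ := by ring
  rw [← mul_sum] at hbound
  have h2 := hbound.trans (mul_le_mul_of_nonneg_left (sum_inv_val_le m) (by positivity))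
  rw [inv_mul_le_iff₀ hm']
  refine h2.trans (le_of_eq (by ring))

/-- An additive character modulo a product of coprime moduli is a product of characters to each
modulus, so complete sums factor. Both the means and the bounds multiply without loss. -/
theorem exists_crt_product {ι : Type*} [DecidableEq ι] (s : Finset ι) (m : ι → ℕ)
    [∀ i, NeZero (m i)] (hcop : ∀ i ∈ s, ∀ j ∈ s, i ≠ j → (m i).Coprime (m j))
    (f : ∀ i, ZMod (m i) → ℂ) (B : ι → ℝ)
    (hB : ∀ i ∈ s, ∀ ψ : AddChar (ZMod (m i)) ℂ, ‖∑ x, f i x * ψ x‖ ≤ B i) :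
    ∃ (M : ℕ) (_ : NeZero M) (g : ZMod M → ℂ), M = ∏ i ∈ s, m i ∧
      (∀ k : ℤ, g k = ∏ i ∈ s, f i k) ∧ (∑ x, g x = ∏ i ∈ s, ∑ x, f i x) ∧
      ∀ ψ : AddChar (ZMod M) ℂ, ‖∑ x, g x * ψ x‖ ≤ ∏ i ∈ s, B i := by
  induction s using Finset.induction_on with
  | empty =>
    refine ⟨1, inferInstance, fun _ => 1, by simp, by simp, by simp, fun ψ => ?_⟩
    simp
  | insert i s hi ih =>
    obtain ⟨M, _, g, hM, hg, hgs, hgB⟩ := ih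
      (fun a ha b hb => hcop a (mem_insert_of_mem ha) b (mem_insert_of_mem hb))
      (fun a ha => hB a (mem_insert_of_mem ha))
    have hc : (m i).Coprime M := by
      rw [hM]
      exact Nat.Coprime.prod_right fun j hj => hcop i (mem_insert_self i s) j
        (mem_insert_of_mem hj) (fun h => hi (h ▸ hj))
    let e := ZMod.chineseRemainder hc
    have hsum : ∀ h : ZMod (m i) × ZMod M → ℂ,
        ∑ x : ZMod (m i * M), h (e x) = ∑ u, ∑ v, h (u, v) := by
      intro h
      rw [← sum_product', univ_product_univ]
      exact Fintype.sum_equiv e.toEquiv _ _ fun x => rfl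
    refine ⟨m i * M, inferInstance, fun x => f i (e x).1 * g (e x).2, ?_, ?_, ?_, ?_⟩
    · rw [prod_insert hi, hM]
    · intro k
      rw [prod_insert hi, ← hg]
      show f i (e k).1 * g (e k).2 = _
      rw [map_intCast]
      rfl
    · rw [prod_insert hi, hsum fun z => f i z.1 * g z.2, ← hgs, sum_mul_sum]
    · intro ψ
      let ψ₁ : AddChar (ZMod (m i)) ℂ :=
        ψ.compAddMonoidHom (e.symm.toAddMonoidHom.comp (AddMonoidHom.inl _ _))
      let ψ₂ : AddChar (ZMod M) ℂ :=
        ψ.compAddMonoidHom (e.symm.toAddMonoidHom.comp (AddMonoidHom.inr _ _))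
      have h1 : ∑ x, f i (e x).1 * g (e x).2 * ψ x = (∑ u, f i u * ψ₁ u) * ∑ v, g v * ψ₂ v := by
        have h2 : ∀ x, ψ x = ψ₁ (e x).1 * ψ₂ (e x).2 := by
          intro x
          show ψ x = ψ (e.symm ((e x).1, 0)) * ψ (e.symm (0, (e x).2))
          rw [← AddChar.map_add_eq_mul, ← map_add]
          simp
        simp only [h2]
        rw [hsum fun z => f i z.1 * g z.2 * (ψ₁ z.1 * ψ₂ z.2), sum_mul_sum]
        refine sum_congr rfl fun u _ => sum_congr rfl fun v _ => by ring
      rw [h1, norm_mul, prod_insert hi]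
      have h3 := hB i (mem_insert_self i s) ψ₁
      exact mul_le_mul h3 (hgB ψ₂) (norm_nonneg _) ((norm_nonneg _).trans h3)

end

/-! ### Local sums and means at odd primes. -/

section

open Finset

theorem periodic_intCast_val {M : ℕ} [NeZero M] {F : ℤ → ℝ} (hF : Function.Periodic F (M : ℤ))
    (k : ℤ) : F ((k : ZMod M).val) = F k := by
  rw [ZMod.val_intCast]
  have h := hF.int_mul (k / M) (k % M)
  rw [← h]
  congr 1
  have := Int.emod_add_mul_ediv k M
  simp only [Int.cast_id]
  linarith

/-- Incomplete sums of products of periodic functions with coprime periods. -/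
theorem abs_sum_range_prod_sub_le {ι : Type*} [DecidableEq ι] (s : Finset ι) (m : ι → ℕ)
    [∀ i, NeZero (m i)] (hcop : ∀ i ∈ s, ∀ j ∈ s, i ≠ j → (m i).Coprime (m j))
    (F : ι → ℤ → ℝ) (hF : ∀ i ∈ s, Function.Periodic (F i) (m i : ℤ)) (B : ι → ℝ)
    (hB : ∀ i ∈ s, ∀ ψ : AddChar (ZMod (m i)) ℂ,
      ‖∑ x : ZMod (m i), (F i x.val : ℂ) * ψ x‖ ≤ B i) (μ : ι → ℝ)
    (hμ : ∀ i ∈ s, (∑ x : ZMod (m i), F i x.val) / m i = μ i) (a : ℤ) (n : ℕ) :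
    |∑ i ∈ range n, ∏ j ∈ s, F j (a + i) -
        n * ∏ j ∈ s, μ j| ≤
      (∏ j ∈ s, B j) * (1 + Real.log (∏ j ∈ s, m j : ℕ)) := by
  obtain ⟨M, _, g, hM, hg, hgs, hgB⟩ :=
    exists_crt_product s m hcop (fun i x => (F i x.val : ℂ)) B hB
  have h := norm_sum_range_sub_mean_le g hgB a n
  rw [← hM, ← prod_congr rfl hμ]
  refine le_trans (le_of_eq ?_) h
  rw [← Real.norm_eq_abs, ← Complex.norm_real, Complex.ofReal_sub]
  congr 2
  · push_cast
    refine sum_congr rfl fun i _ => ?_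
    have := hg (a + i)
    push_cast at this
    rw [this]
    refine prod_congr rfl fun j hj => ?_
    have := periodic_intCast_val (hF j hj) (a + i)
    push_cast at this
    rw [← this]
  · rw [hgs, hM]
    push_cast
    rw [prod_div_distrib]
    ring

theorem jacobiSym_eq_prod_primeFactors (x : ℤ) {n : ℕ} (hn : n ≠ 0) :
    jacobiSym x n = ∏ q ∈ n.primeFactors, jacobiSym x q ^ n.factorization q := by
  have hprod : ∀ (s : Finset ℕ) (e : ℕ → ℕ), (∀ q ∈ s, q ≠ 0) →
      jacobiSym x (∏ q ∈ s, q ^ e q) = ∏ q ∈ s, jacobiSym x q ^ e q := by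
    intro s e
    induction s using Finset.induction_on with
    | empty => intro _; simp
    | insert q s hq ih =>
      intro h
      have h1 : NeZero (q ^ e q) := ⟨pow_ne_zero _ (h q (mem_insert_self q s))⟩
      have h2 : NeZero (∏ q ∈ s, q ^ e q) :=
        ⟨prod_ne_zero_iff.2 fun j hj => pow_ne_zero _ (h j (mem_insert_of_mem hj))⟩
      rw [prod_insert hq, prod_insert hq, jacobiSym.mul_right, jacobiSym.pow_right,
        ih fun j hj => h j (mem_insert_of_mem hj)]
  have := hprod n.primeFactors (fun q => n.factorization q)
    fun q hq => (Nat.prime_of_mem_primeFactors hq).ne_zero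
  rw [← this]
  congr 1
  exact (Nat.prod_factorization_pow_eq_self hn).symm

/-- The mean over a prime modulus `q` of the `v`-th power of the quadratic character of a product
of two independent linear forms; `t` tells whether one of the forms is constant. -/
noncomputable def localMean (q v : ℕ) (t : Prop) [Decidable t] : ℝ :=
  if v = 0 then 1 else
    if Odd v then (if t then 0 else -(1 / q : ℝ)) else (if t then 1 - 1 / q else 1 - 2 / q)

section Local

variable {q : ℕ} [Fact q.Prime]

theorem jacobiSym_eq_quadC (x : ℤ) : ((jacobiSym x q : ℤ) : ℂ) = quadC q (x : ZMod q) := by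
  rw [← jacobiSym.legendreSym.to_jacobiSym, quadC_apply]
  rfl

theorem jacobi_linear_eq_quadC (α β γ δ : ℤ) (v : ℕ) (x : ZMod q) :
    (((jacobiSym (α * x.val + β) q * jacobiSym (γ * x.val + δ) q : ℤ) : ℝ) ^ v : ℂ) =
      quadC q (((α : ZMod q) * x + β) * (γ * x + δ)) ^ v := by
  push_cast
  rw [jacobiSym_eq_quadC, jacobiSym_eq_quadC, map_mul]
  push_cast
  rw [ZMod.natCast_zmod_val]

theorem quadC_pow_odd {v : ℕ} (hv : Odd v) (x : ZMod q) : quadC q x ^ v = quadC q x := by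
  rw [quadC_apply]
  by_cases hx : x = 0
  · simp [hx, hv.pos.ne']
  · rcases quadraticChar_dichotomy hx with h | h <;> simp [h, hv.neg_one_pow]

theorem quadC_pow_even {v : ℕ} (hv : Even v) (hv0 : v ≠ 0) (x : ZMod q) :
    quadC q x ^ v = if x = 0 then 0 else 1 := by
  rw [quadC_apply]
  by_cases hx : x = 0
  · simp [hx, hv0]
  · rw [if_neg hx]
    rcases quadraticChar_dichotomy hx with h | h <;> simp [h, hv.neg_one_pow]

/-- An odd power of the character is the character itself. For even `v` the trivial bound `q ≤
√(q^v)` is enough. Stated with `√(q^v)`, the bounds multiply to `√n`. -/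
theorem norm_sum_quadC_pow_mul_le (hq : 3 ≤ q) (α β γ δ : ZMod q) (hdet : α * δ - β * γ ≠ 0)
    {v : ℕ} (hv : v ≠ 0) (ψ : AddChar (ZMod q) ℂ) :
    ‖∑ k, quadC q ((α * k + β) * (γ * k + δ)) ^ v * ψ k‖ ≤ 2 * Real.sqrt (q ^ v : ℕ) := by
  have hq1 : 1 ≤ q := by omega
  rcases Nat.even_or_odd v with he | ho
  · have h1 : ‖∑ k, quadC q ((α * k + β) * (γ * k + δ)) ^ v * ψ k‖ ≤ q := by
      refine (norm_sum_le _ _).trans ((sum_le_sum fun k _ => (?_ : _ ≤ (1 : ℝ))).trans ?_)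
      · rw [norm_mul, norm_addChar_eq_one, mul_one, norm_pow]
        exact pow_le_one₀ (norm_nonneg _) (norm_quadC_le _)
      · simp [ZMod.card]
    have h2 : (q : ℝ) ≤ Real.sqrt (q ^ v : ℕ) := by
      refine Real.le_sqrt_of_sq_le ?_
      obtain ⟨w, hw⟩ := he
      exact_mod_cast Nat.pow_le_pow_right hq1 (by omega : 2 ≤ v)
    have := Real.sqrt_nonneg ((q ^ v : ℕ) : ℝ)
    linarith
  · simp only [quadC_pow_odd ho]
    refine (norm_sum_quadC_mul_le hq α β γ δ hdet ψ).trans ?_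
    gcongr
    exact_mod_cast Nat.le_self_pow hv q

theorem card_linear_mul_eq_zero (α β γ δ : ZMod q) (hdet : α * δ - β * γ ≠ 0) :
    #({k : ZMod q | (α * k + β) * (γ * k + δ) = 0} : Finset (ZMod q)) =
      if α = 0 ∨ γ = 0 then 1 else 2 := by
  have hroot : ∀ {u v k : ZMod q}, u ≠ 0 → (u * k + v = 0 ↔ k = -v / u) := by
    intro u v k hu
    rw [eq_div_iff hu]
    constructor
    · intro h; linear_combination h
    · intro h; linear_combination h
  by_cases hα : α = 0
  · have hγ : γ ≠ 0 := by rintro rfl; simp [hα] at hdet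
    have hβ : β ≠ 0 := by rintro rfl; simp [hα] at hdet
    simp [hα, hβ, hroot hγ, filter_eq']
  by_cases hγ : γ = 0
  · have hδ : δ ≠ 0 := by rintro rfl; simp [hγ] at hdet
    simp [hγ, hδ, hroot hα, filter_eq']
  rw [if_neg (by tauto)]
  have : ({k : ZMod q | (α * k + β) * (γ * k + δ) = 0} : Finset (ZMod q)) =
      {-β / α, -δ / γ} := by
    ext k
    simp [hroot hα, hroot hγ]
  rw [this, card_pair]
  intro h
  apply hdet
  field_simp at h
  linear_combination h

/-- For even `v` the sum counts non-roots of the product. For odd `v` it is zero when one form is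
constant and `-χ(αγ)` otherwise; `hsq` fixes that sign. -/
theorem mean_quadC_pow (hq : 3 ≤ q) (α β γ δ : ZMod q) (hdet : α * δ - β * γ ≠ 0)
    (hsq : α ≠ 0 → γ ≠ 0 → quadC q (α * γ) = 1) (v : ℕ) (t : Prop) [Decidable t]
    (ht : t ↔ (α = 0 ∨ γ = 0)) :
    (∑ k, quadC q ((α * k + β) * (γ * k + δ)) ^ v) / q = (localMean q v t : ℂ) := by
  have hq0 : (q : ℂ) ≠ 0 := by exact_mod_cast (by omega : q ≠ 0)
  rw [localMean]
  by_cases hv : v = 0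
  · simp [hv, ZMod.card, hq0]
  rw [if_neg hv]
  rcases Nat.even_or_odd v with he | ho
  · rw [if_neg (Nat.not_odd_iff_even.2 he)]
    simp only [quadC_pow_even he hv]
    have h1 := card_filter_add_card_filter_not (s := (univ : Finset (ZMod q)))
      (fun k => (α * k + β) * (γ * k + δ) = 0)
    rw [card_linear_mul_eq_zero α β γ δ hdet, card_univ, ZMod.card] at h1
    rw [sum_ite, sum_const_zero, zero_add, sum_const, nsmul_eq_mul, mul_one]
    generalize #({k : ZMod q | ¬(α * k + β) * (γ * k + δ) = 0} : Finset (ZMod q)) = c at h1 ⊢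
    by_cases htt : t
    · rw [if_pos htt]
      rw [if_pos (ht.1 htt)] at h1
      have h2 : (1 : ℂ) + (c : ℂ) = q := by
        exact_mod_cast h1
      push_cast
      field_simp
      linear_combination h2
    · rw [if_neg htt]
      rw [if_neg (fun h => htt (ht.2 h))] at h1
      have h2 : (2 : ℂ) + (c : ℂ) = q := by
        exact_mod_cast h1
      push_cast
      field_simp
      linear_combination h2
  · rw [if_pos ho]
    simp only [quadC_pow_odd ho]
    by_cases htt : t
    · rw [if_pos htt]
      have h0 : ∑ k, quadC q ((α * k + β) * (γ * k + δ)) = 0 := by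
        by_cases hα : α = 0
        · have hγ : γ ≠ 0 := by rintro rfl; simp [hα] at hdet
          simp only [hα, zero_mul, zero_add, map_mul]
          rw [← mul_sum, sum_quadC_linear hq hγ, mul_zero]
        · have hγ : γ = 0 := (ht.1 htt).resolve_left hα
          simp only [hγ, zero_mul, zero_add, map_mul]
          rw [← sum_mul, sum_quadC_linear hq hα, zero_mul]
      rw [h0]; simp
    · rw [if_neg htt]
      have hn : ¬(α = 0 ∨ γ = 0) := fun h => htt (ht.2 h)
      push Not at hn
      rw [sum_quadC_mul_of_ne_zero hq α β γ δ hn.1 hn.2 hdet, hsq hn.1 hn.2]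
      push_cast
      ring

end Local

end

/-! ### Incomplete Jacobi sums with a condition modulo 8. -/

section

open Finset

theorem jacobiSym_periodic (α β : ℤ) (q : ℕ) :
    Function.Periodic (fun k : ℤ => jacobiSym (α * k + β) q) (q : ℤ) := by
  intro k
  show jacobiSym _ q = jacobiSym _ q
  refine jacobiSym.mod_left' ?_
  rw [show α * (k + q) + β = α * k + β + α * q by ring, Int.add_mul_emod_self_right]

/-- Incomplete sums of the Jacobi symbol of a product of two linear forms, twisted by a function
modulo `8`. -/
theorem abs_sum_jacobi_linear_sub_le {n : ℕ} (hn : Odd n) (α β γ δ : ℤ)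
    (hdet : ∀ q ∈ n.primeFactors, ((α * δ - β * γ : ℤ) : ZMod q) ≠ 0)
    (hsq : ∀ q ∈ n.primeFactors, IsSquare ((α * γ : ℤ) : ZMod q)) (t : ℕ → Prop) [DecidablePred t]
    (ht : ∀ q ∈ n.primeFactors, t q ↔ ((α : ZMod q) = 0 ∨ (γ : ZMod q) = 0))
    (g : ℤ → ℝ) (hg : Function.Periodic g 8) (hg1 : ∀ k, |g k| ≤ 1) (a : ℤ) (L : ℕ) :
    |∑ i ∈ range L, g (a + i) *
        ((jacobiSym (α * (a + i) + β) n * jacobiSym (γ * (a + i) + δ) n : ℤ) : ℝ) -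
      L * ((∑ x : ZMod 8, g x.val) / 8 *
        ∏ q ∈ n.primeFactors, localMean q (n.factorization q) (t q))| ≤
      8 * (2 ^ n.primeFactors.card * Real.sqrt n) * (1 + Real.log (8 * n)) := by
  have hn0 : n ≠ 0 := hn.pos.ne'
  have h2 : 2 ∉ n.primeFactors := fun h =>
    (Nat.not_even_iff_odd.2 hn) (even_iff_two_dvd.2 (Nat.dvd_of_mem_primeFactors h))
  -- The index 2, absent from the primes of the odd `n`, carries the function modulo 8. An odd prime
  -- needs only the modulus `q`, not `q^v`. The value 1 at `i = 0` only makes every modulus nonzero.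
  set m : ℕ → ℕ := fun i => if i = 2 then 8 else if i = 0 then 1 else i with hm
  have hm2 : m 2 = 8 := by simp [hm]
  have hmq : ∀ q ∈ n.primeFactors, m q = q := by
    intro q hq
    have h1 : q ≠ 2 := fun h => h2 (h ▸ hq)
    have h3 := (Nat.prime_of_mem_primeFactors hq).ne_zero
    simp [hm, h1, h3]
  have : ∀ i, NeZero (m i) := by
    intro i
    constructor
    simp only [hm]
    split_ifs <;> simp_all
  set F : ℕ → ℤ → ℝ := fun i => if i = 2 then g else
    fun k => ((jacobiSym (α * k + β) i * jacobiSym (γ * k + δ) i : ℤ) : ℝ) ^ n.factorization i with hF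
  have hF2 : F 2 = g := by simp [hF]
  have hFq : ∀ q ∈ n.primeFactors, F q = fun k =>
      ((jacobiSym (α * k + β) q * jacobiSym (γ * k + δ) q : ℤ) : ℝ) ^ n.factorization q := by
    intro q hq
    have h1 : q ≠ 2 := fun h => h2 (h ▸ hq)
    simp [hF, h1]
  have hq3 : ∀ q ∈ n.primeFactors, 3 ≤ q := by
    intro q hq
    have h1 : q ≠ 2 := fun h => h2 (h ▸ hq)
    have h3 := (Nat.prime_of_mem_primeFactors hq).two_le
    omega
  have hv : ∀ q ∈ n.primeFactors, n.factorization q ≠ 0 := fun q hq =>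
    ((Nat.prime_of_mem_primeFactors hq).factorization_pos_of_dvd hn0
      (Nat.dvd_of_mem_primeFactors hq)).ne'
  set B : ℕ → ℝ := fun i => if i = 2 then 8 else 2 * Real.sqrt (i ^ n.factorization i : ℕ) with hB
  have hBq : ∀ q ∈ n.primeFactors, B q = 2 * Real.sqrt (q ^ n.factorization q : ℕ) := by
    intro q hq
    have h1 : q ≠ 2 := fun h => h2 (h ▸ hq)
    simp [hB, h1]
  set μ : ℕ → ℝ := fun i => if i = 2 then (∑ x : ZMod 8, g x.val) / 8 else
    localMean i (n.factorization i) (t i) with hμ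
  have hμq : ∀ q ∈ n.primeFactors, μ q = localMean q (n.factorization q) (t q) := by
    intro q hq
    have h1 : q ≠ 2 := fun h => h2 (h ▸ hq)
    simp [hμ, h1]
  have hμ2 : μ 2 = (∑ x : ZMod 8, g x.val) / 8 := by simp [hμ]
  have key := abs_sum_range_prod_sub_le (insert 2 n.primeFactors) m ?_ F ?_ B ?_ μ ?_ a L
  · rw [prod_insert h2, prod_insert h2, prod_insert h2, prod_congr rfl hmq, prod_congr rfl hBq,
      hm2, prod_congr rfl hμq, hμ2] at key
    have hlog : (((8 * ∏ q ∈ n.primeFactors, q : ℕ)) : ℝ) ≤ 8 * n := by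
      push_cast
      have : ∏ q ∈ n.primeFactors, q ≤ n := Nat.le_of_dvd hn.pos (Nat.prod_primeFactors_dvd n)
      have h' : ((∏ q ∈ n.primeFactors, q : ℕ) : ℝ) ≤ n := by exact_mod_cast this
      push_cast at h'
      linarith
    have hpos : 0 < ((8 * ∏ q ∈ n.primeFactors, q : ℕ) : ℝ) := by
      exact_mod_cast Nat.mul_pos (by norm_num) (prod_pos fun q hq =>
        (Nat.prime_of_mem_primeFactors hq).pos)
    have hBprod : (8 : ℝ) * ∏ q ∈ n.primeFactors, 2 * Real.sqrt (q ^ n.factorization q : ℕ) =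
        8 * (2 ^ n.primeFactors.card * Real.sqrt n) := by
      rw [prod_mul_distrib, prod_const]
      congr 2
      rw [← Real.sqrt_prod _ (fun _ _ => by positivity)]
      conv_rhs => rw [← Nat.prod_factorization_pow_eq_self hn0]
      rw [Nat.prod_factorization_eq_prod_primeFactors]
      push_cast
      rfl
    have hB2 : B 2 = 8 := by simp [hB]
    rw [hB2, hBprod] at key
    refine le_trans (le_of_eq ?_) (key.trans ?_)
    · congr 2
      refine sum_congr rfl fun i _ => ?_
      rw [prod_insert h2, hF2, jacobiSym_eq_prod_primeFactors _ hn0,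
        jacobiSym_eq_prod_primeFactors _ hn0, ← prod_mul_distrib]
      push_cast
      congr 1
      refine prod_congr rfl fun q hq => ?_
      rw [hFq q hq]
      push_cast
      rw [mul_pow]
    · refine mul_le_mul_of_nonneg_left ?_ (by positivity)
      have := Real.log_le_log hpos hlog
      linarith
  · intro i hi j hj hij
    rcases mem_insert.1 hi with rfl | hi' <;> rcases mem_insert.1 hj with rfl | hj'
    · exact absurd rfl hij
    · rw [hm2, hmq j hj']
      exact Nat.Coprime.pow_left 3 ((Nat.coprime_primes Nat.prime_two
        (Nat.prime_of_mem_primeFactors hj')).2 hij)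
    · rw [hm2, hmq i hi']
      exact Nat.Coprime.pow_right 3 ((Nat.coprime_primes
        (Nat.prime_of_mem_primeFactors hi') Nat.prime_two).2 hij)
    · rw [hmq i hi', hmq j hj']
      exact (Nat.coprime_primes (Nat.prime_of_mem_primeFactors hi')
        (Nat.prime_of_mem_primeFactors hj')).2 hij
  · intro i hi
    rcases mem_insert.1 hi with rfl | hi'
    · rw [hF2, hm2]; exact hg
    · rw [hFq i hi', hmq i hi']
      intro k
      have h1 := jacobiSym_periodic α β i k
      have h3 := jacobiSym_periodic γ δ i k
      simp only at h1 h3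
      simp only [h1, h3]
  · intro i hi
    rcases mem_insert.1 hi with rfl | hi'
    · intro ψ
      refine (norm_sum_le _ _).trans ((sum_le_sum fun x _ => (?_ : _ ≤ (1 : ℝ))).trans ?_)
      · rw [norm_mul, norm_addChar_eq_one, mul_one, Complex.norm_real, hF2]
        exact hg1 _
      · simp [ZMod.card, hm2, hB]
    · have hqp : Fact i.Prime := ⟨Nat.prime_of_mem_primeFactors hi'⟩
      rw [hBq i hi']
      -- `m i = i` is only a propositional equality; generalising the modulus lets it be substituted
      -- inside `ZMod`.
      have : ∀ M : ℕ, ∀ [NeZero M], M = i → ∀ ψ : AddChar (ZMod M) ℂ,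
          ‖∑ x : ZMod M, (F i x.val : ℂ) * ψ x‖ ≤ 2 * Real.sqrt (i ^ n.factorization i : ℕ) := by
        intro M hM0 hM ψ
        subst hM
        refine le_trans (le_of_eq ?_) (norm_sum_quadC_pow_mul_le (hq3 M hi') (α : ZMod M) β γ δ
          (by have := hdet M hi'; push_cast at this; exact this) (hv M hi') ψ)
        congr 1
        refine Fintype.sum_congr _ _ fun x => ?_
        rw [← jacobi_linear_eq_quadC, hFq M hi']
        push_cast
        rfl
      exact this (m i) (hmq i hi')
  · intro i hi
    rcases mem_insert.1 hi with rfl | hi'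
    · have : ∀ M : ℕ, ∀ [NeZero M], M = 8 →
          (∑ x : ZMod M, F 2 x.val) / (M : ℝ) = (∑ x : ZMod 8, g x.val) / 8 := by
        intro M _ hM
        subst hM
        rw [hF2]
        congr 1
      rw [hμ2]
      exact this (m 2) hm2
    · have hqp : Fact i.Prime := ⟨Nat.prime_of_mem_primeFactors hi'⟩
      rw [hμq i hi']
      have : ∀ M : ℕ, ∀ [NeZero M], M = i →
          (∑ x : ZMod M, F i x.val) / (M : ℝ) = localMean i (n.factorization i) (t i) := by
        intro M hM0 hM
        subst hM
        apply Complex.ofReal_injective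
        rw [← mean_quadC_pow (hq3 M hi') (α : ZMod M) β γ δ
          (by have := hdet M hi'; push_cast at this; exact this) ?_ _ _ (ht M hi')]
        · push_cast
          congr 1
          refine Fintype.sum_congr _ _ fun x => ?_
          rw [← jacobi_linear_eq_quadC, hFq M hi']
          push_cast
          rfl
        · intro h3 h4
          have h5 := hsq M hi'
          push_cast at h5
          rw [quadC_apply, (quadraticChar_one_iff_isSquare (mul_ne_zero h3 h4)).2 h5]
          simp
      exact this (m i) (hmq i hi')

end

/-! ### Restriction to an arithmetic progression. -/

section

open Finset

theorem exists_sum_arithProg_eq (q : ℕ) (hq : 0 < q) (N₀ : ℤ) (X Y : ℝ) (hY : 0 ≤ Y) :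
    ∃ (k₀ : ℤ) (L : ℕ), |(L : ℝ) - Y / q| ≤ 1 ∧ ∀ h : ℤ → ℝ,
      ∑ N ∈ (Icc ⌈X⌉ ⌊X + Y⌋).filter (fun N => (q : ℤ) ∣ N - N₀), h N =
        ∑ i ∈ range L, h (N₀ + q * (k₀ + i)) := by
  have hq' : (0 : ℝ) < q := by exact_mod_cast hq
  set k₀ := ⌈(X - N₀) / q⌉ with hk₀
  set k₁ := ⌊(X + Y - N₀) / q⌋ with hk₁
  have h1 := Int.le_ceil ((X - N₀) / q)
  have h2 := Int.ceil_lt_add_one ((X - N₀) / q)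
  have h3 := Int.floor_le ((X + Y - N₀) / q)
  have h4 := Int.lt_floor_add_one ((X + Y - N₀) / q)
  have hd : (X + Y - N₀) / q = (X - N₀) / q + Y / q := by ring
  have hYq : 0 ≤ Y / q := by positivity
  have hL0 : 0 ≤ k₁ - k₀ + 1 := by
    have : ((-1 : ℤ) : ℝ) < ((k₁ - k₀ + 1 : ℤ) : ℝ) := by push_cast; linarith
    have := Int.cast_lt.1 this
    omega
  refine ⟨k₀, (k₁ - k₀ + 1).toNat, ?_, ?_⟩
  · have : (((k₁ - k₀ + 1).toNat : ℤ) : ℝ) = ((k₁ - k₀ + 1 : ℤ) : ℝ) := by rw [Int.toNat_of_nonneg hL0]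
    rw [Int.cast_natCast] at this
    rw [this, abs_le]
    push_cast
    constructor <;> linarith
  · intro h
    symm
    refine sum_bij (fun i _ => N₀ + q * (k₀ + i)) ?_ ?_ ?_ ?_
    · intro i hi
      have hi' : (i : ℤ) < k₁ - k₀ + 1 := by
        have := mem_range.1 hi
        omega
      have hi1 : k₀ + (i : ℤ) ≤ k₁ := by omega
      have hi2 : ((k₀ + (i : ℤ) : ℤ) : ℝ) ≤ (X + Y - N₀) / q := le_trans (by exact_mod_cast hi1) h3
      have hi3 : (X - N₀) / q ≤ ((k₀ + (i : ℤ) : ℤ) : ℝ) := le_trans h1 (by push_cast; linarith [(Nat.cast_nonneg i : (0 : ℝ) ≤ i)])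
      rw [le_div_iff₀ hq'] at hi2
      rw [div_le_iff₀ hq'] at hi3
      push_cast at hi2 hi3
      refine mem_filter.2 ⟨mem_Icc.2 ⟨Int.ceil_le.2 ?_, Int.le_floor.2 ?_⟩, ⟨k₀ + i, by ring⟩⟩
      · push_cast; linarith
      · push_cast; linarith
    · intro i _ j _ hij
      have hq0 : (q : ℤ) ≠ 0 := by exact_mod_cast hq.ne'
      have := mul_left_cancel₀ hq0 (add_left_cancel hij)
      omega
    · intro N hN
      obtain ⟨hN, k, hk⟩ := mem_filter.1 hN
      have hN1 := Int.ceil_le.1 (mem_Icc.1 hN).1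
      have hN2 := Int.le_floor.1 (mem_Icc.1 hN).2
      have hNk : (N : ℝ) - N₀ = q * k := by exact_mod_cast hk
      have hk1 : k₀ ≤ k := Int.ceil_le.2 (by rw [div_le_iff₀ hq']; linarith)
      have hk2 : k ≤ k₁ := Int.le_floor.2 (by rw [le_div_iff₀ hq']; linarith)
      refine ⟨(k - k₀).toNat, mem_range.2 (by omega), ?_⟩
      rw [Int.toNat_of_nonneg (by omega)]
      rw [add_sub_cancel]
      linarith
    · intro i _; rfl

/-- The contribution of the prime `2` to the twisted sum, as a function of the residues modulo `8`
of the level and of the cofactor. -/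
def twoAdicWeight (e : ℕ) (x y : ZMod 8) : ℤ :=
  if x.val % 4 ≠ 0 ∧ ((x * y).val % 4 = 0 ∨ (x * y).val % 4 = 1) then
    (ZMod.χ₈ x * ZMod.χ₈ y) ^ e else 0

theorem abs_twoAdicWeight_le (e : ℕ) (x y : ZMod 8) : |(twoAdicWeight e x y : ℝ)| ≤ 1 := by
  have h : ∀ x : ZMod 8, |ZMod.χ₈ x| ≤ 1 := by decide
  have : |twoAdicWeight e x y| ≤ 1 := by
    rw [twoAdicWeight]
    split_ifs
    · rw [abs_pow, abs_mul]
      exact pow_le_one₀ (by positivity) (mul_le_one₀ (h x) (abs_nonneg _) (h y))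
    · simp
  exact_mod_cast this

theorem abs_localMean_le {q : ℕ} (hq : 2 ≤ q) (v : ℕ) (t : Prop) [Decidable t] :
    |localMean q v t| ≤ 1 := by
  have hq' : (2 : ℝ) ≤ q := by exact_mod_cast hq
  have h1 : 1 / (q : ℝ) ≤ 1 / 2 := one_div_le_one_div_of_le (by norm_num) hq'
  have h0 : 0 < 1 / (q : ℝ) := by positivity
  have h2 : 2 / (q : ℝ) = 2 * (1 / q) := by ring
  rw [localMean]
  split_ifs <;> rw [abs_le] <;> constructor <;> linarith

/-- The sum over an interval of the twisted weight on the arithmetic progression cut out by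
`a ^ 2 ∣ N` and `D ^ 2 ∣ ρ ^ 2 * N - π ^ 2`. -/
theorem abs_sum_progression_sub_le (ρ π D a n e : ℕ) (hn : Odd n) (hD : 0 < D)
    (ha : 0 < a) (hDρ : D.Coprime ρ) (haD : a.Coprime D) (hna : n.Coprime a)
    (hnπ : n.Coprime π) (m₂ : ℝ)
    (hm₂ : ∀ N₀ : ℤ, (a : ℤ) ^ 2 ∣ N₀ → (D : ℤ) ^ 2 ∣ (ρ : ℤ) ^ 2 * N₀ - (π : ℤ) ^ 2 →
      (∑ x : ZMod 8, (twoAdicWeight e ((N₀ : ZMod 8) + a ^ 2 * D ^ 2 * x)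
        (((((ρ : ℤ) ^ 2 * N₀ - (π : ℤ) ^ 2) / (D : ℤ) ^ 2 : ℤ) : ZMod 8) + ρ ^ 2 * a ^ 2 * x) : ℝ)) / 8 = m₂)
    (X Y : ℝ) (hY : 0 ≤ Y) :
    |∑ N ∈ (Icc ⌈X⌉ ⌊X + Y⌋).filter
        (fun N => (a : ℤ) ^ 2 ∣ N ∧ (D : ℤ) ^ 2 ∣ (ρ : ℤ) ^ 2 * N - (π : ℤ) ^ 2),
        (twoAdicWeight e (N : ZMod 8)
          (((((ρ : ℤ) ^ 2 * N - (π : ℤ) ^ 2) / (D : ℤ) ^ 2 : ℤ) : ZMod 8)) : ℝ) *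
        ((jacobiSym N n * jacobiSym (((ρ : ℤ) ^ 2 * N - (π : ℤ) ^ 2) / (D : ℤ) ^ 2) n : ℤ) : ℝ) -
      Y * (1 / ((a : ℝ) ^ 2 * (D : ℝ) ^ 2) * (m₂ *
        ∏ q ∈ n.primeFactors, localMean q (n.factorization q) (q ∣ ρ * D)))| ≤
      8 * (2 ^ n.primeFactors.card * Real.sqrt n) * (1 + Real.log (8 * n)) + 1 := by
  have hD2 : ((D : ℤ) ^ 2) ≠ 0 := pow_ne_zero 2 (by exact_mod_cast hD.ne')
  have hcop : IsCoprime (((ρ : ℤ) ^ 2) * (a : ℤ) ^ 2) ((D : ℤ) ^ 2) := by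
    refine IsCoprime.mul_left ?_ ?_
    · exact (Nat.isCoprime_iff_coprime.2 hDρ.symm).pow
    · exact (Nat.isCoprime_iff_coprime.2 haD).pow
  obtain ⟨u, v, huv⟩ := hcop
  -- The Bézout relation `u ρ² a² + v D² = 1` gives `ρ² N₀ = (1 - v D²) π²`, so `N₀` meets both
  -- divisibility conditions; they amount to one class modulo `a² D²`.
  set N₀ : ℤ := a ^ 2 * (u * π ^ 2) with hN₀
  have hN₀a : (a : ℤ) ^ 2 ∣ N₀ := dvd_mul_right _ _
  have hN₀D : (D : ℤ) ^ 2 ∣ (ρ : ℤ) ^ 2 * N₀ - (π : ℤ) ^ 2 :=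
    ⟨-v * π ^ 2, by rw [hN₀]; linear_combination (π : ℤ) ^ 2 * huv⟩
  obtain ⟨M₀, hM₀⟩ := id hN₀D
  set q₀ : ℕ := a ^ 2 * D ^ 2 with hq₀
  have hq₀pos : 0 < q₀ := by positivity
  obtain ⟨k₀, L, hL, hsum⟩ := exists_sum_arithProg_eq q₀ hq₀pos N₀ X Y hY
  have hfilter : (Icc ⌈X⌉ ⌊X + Y⌋).filter
      (fun N => (a : ℤ) ^ 2 ∣ N ∧ (D : ℤ) ^ 2 ∣ (ρ : ℤ) ^ 2 * N - (π : ℤ) ^ 2) =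
      (Icc ⌈X⌉ ⌊X + Y⌋).filter (fun N => (q₀ : ℤ) ∣ N - N₀) := by
    refine filter_congr fun N _ => ?_
    constructor
    · rintro ⟨h1, h2⟩
      rw [hq₀]
      push_cast
      refine IsCoprime.mul_dvd (Nat.isCoprime_iff_coprime.2 haD).pow (dvd_sub h1 hN₀a) ?_
      have h3 : (D : ℤ) ^ 2 ∣ (ρ : ℤ) ^ 2 * (N - N₀) := by
        have := dvd_sub h2 hN₀D
        rwa [show (ρ : ℤ) ^ 2 * N - (π : ℤ) ^ 2 - ((ρ : ℤ) ^ 2 * N₀ - (π : ℤ) ^ 2) =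
          (ρ : ℤ) ^ 2 * (N - N₀) by ring] at this
      exact IsCoprime.dvd_of_dvd_mul_left (Nat.isCoprime_iff_coprime.2 hDρ).pow h3
    · rintro ⟨k, hk⟩
      rw [hq₀] at hk
      push_cast at hk
      have hN : N = N₀ + a ^ 2 * D ^ 2 * k := by linarith
      subst hN
      refine ⟨dvd_add hN₀a ⟨D ^ 2 * k, by ring⟩, ?_⟩
      rw [show (ρ : ℤ) ^ 2 * (N₀ + a ^ 2 * D ^ 2 * k) - (π : ℤ) ^ 2 =
        ((ρ : ℤ) ^ 2 * N₀ - (π : ℤ) ^ 2) + D ^ 2 * (ρ ^ 2 * a ^ 2 * k) by ring]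
      exact dvd_add hN₀D (dvd_mul_right _ _)
  have hM : ∀ k : ℤ, ((ρ : ℤ) ^ 2 * (N₀ + q₀ * k) - (π : ℤ) ^ 2) / (D : ℤ) ^ 2 =
      ρ ^ 2 * a ^ 2 * k + M₀ := by
    intro k
    rw [hq₀]
    push_cast
    rw [show (ρ : ℤ) ^ 2 * (N₀ + a ^ 2 * D ^ 2 * k) - (π : ℤ) ^ 2 =
        D ^ 2 * (ρ ^ 2 * a ^ 2 * k + M₀) by linear_combination hM₀]
    exact Int.mul_ediv_cancel_left _ hD2
  set g : ℤ → ℝ := fun k => (twoAdicWeight e ((N₀ + q₀ * k : ℤ) : ZMod 8)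
    ((ρ ^ 2 * a ^ 2 * k + M₀ : ℤ) : ZMod 8) : ℝ) with hg
  have hg8 : Function.Periodic g 8 := by
    intro k
    simp only [hg]
    have h8 : ((8 : ℤ) : ZMod 8) = 0 := by decide
    have h8' : (8 : ZMod 8) = 0 := by decide
    congr 2
    · push_cast; linear_combination (q₀ : ZMod 8) * h8'
    · push_cast; linear_combination ((ρ : ZMod 8) ^ 2 * a ^ 2) * h8'
  have hm : (∑ x : ZMod 8, g x.val) / 8 = m₂ := by
    rw [← hm₂ N₀ hN₀a hN₀D, hM₀, Int.mul_ediv_cancel_left _ hD2]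
    congr 1
    refine Fintype.sum_congr _ _ fun x => ?_
    simp only [hg, hq₀]
    push_cast
    rw [ZMod.natCast_zmod_val, add_comm (M₀ : ZMod 8)]
  have hn0 : n ≠ 0 := hn.pos.ne'
  have hndvd : ∀ q ∈ n.primeFactors, ∀ b : ℕ, n.Coprime b → ((b : ℕ) : ZMod q) ≠ 0 := by
    intro q hq b hb h
    rw [ZMod.natCast_eq_zero_iff] at h
    exact (Nat.prime_of_mem_primeFactors hq).one_lt.ne'
      (Nat.eq_one_of_dvd_coprimes hb (Nat.dvd_of_mem_primeFactors hq) h)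
  -- On `N = N₀ + a² D² k` the cofactor is `ρ² a² k + M₀`. The determinant of the two forms is `-(a
  -- π)²`, a unit at primes of `n`, and the leading coefficients multiply to `(a² D ρ)²`.
  have key := abs_sum_jacobi_linear_sub_le hn (q₀ : ℤ) N₀ (ρ ^ 2 * a ^ 2 : ℤ) M₀ (by
      intro q hq
      have : Fact q.Prime := ⟨Nat.prime_of_mem_primeFactors hq⟩
      have h1 := hndvd q hq a hna
      have h2 := hndvd q hq π hnπ
      rw [hq₀]
      push_cast
      have h3 : ((ρ : ZMod q)) ^ 2 * N₀ - (π : ZMod q) ^ 2 = D ^ 2 * M₀ := by exact_mod_cast congrArg (Int.cast : ℤ → ZMod q) hM₀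
      rw [show (a : ZMod q) ^ 2 * D ^ 2 * M₀ - N₀ * (ρ ^ 2 * a ^ 2) = -((a : ZMod q) ^ 2 * π ^ 2) by
        linear_combination -(a : ZMod q) ^ 2 * h3]
      exact neg_ne_zero.2 (mul_ne_zero (pow_ne_zero 2 h1) (pow_ne_zero 2 h2))) (by
      intro q hq
      refine ⟨(a : ZMod q) ^ 2 * D * ρ, ?_⟩
      rw [hq₀]
      push_cast
      ring) (fun q => q ∣ ρ * D) (by
      intro q hq
      have hqp : Fact q.Prime := ⟨Nat.prime_of_mem_primeFactors hq⟩
      have h1 := hndvd q hq a hna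
      rw [hq₀]
      push_cast
      rw [mul_eq_zero, mul_eq_zero, pow_eq_zero_iff two_ne_zero, pow_eq_zero_iff two_ne_zero,
        pow_eq_zero_iff two_ne_zero, hqp.out.dvd_mul, ← ZMod.natCast_eq_zero_iff,
        ← ZMod.natCast_eq_zero_iff]
      tauto) g hg8 (fun k => abs_twoAdicWeight_le _ _ _) k₀ L
  rw [hm] at key
  rw [hfilter, hsum]
  set E := ∏ q ∈ n.primeFactors, localMean q (n.factorization q) (q ∣ ρ * D) with hE
  have hE1 : |E| ≤ 1 := by
    rw [hE, abs_prod]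
    exact prod_le_one (fun _ _ => abs_nonneg _) fun q hq =>
      abs_localMean_le (Nat.prime_of_mem_primeFactors hq).two_le _ _
  have hm1 : |m₂| ≤ 1 := by
    rw [← hm, abs_div, abs_of_pos (by norm_num : (0 : ℝ) < 8), div_le_one (by norm_num)]
    refine (abs_sum_le_sum_abs _ _).trans ((sum_le_sum fun x _ => abs_twoAdicWeight_le _ _ _).trans ?_)
    simp [ZMod.card]
  have hmE : |m₂ * E| ≤ 1 := by
    rw [abs_mul]; exact mul_le_one₀ hm1 (abs_nonneg _) hE1
  have hsumeq : ∑ i ∈ range L, (twoAdicWeight e ((N₀ + q₀ * (k₀ + i) : ℤ) : ZMod 8)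
          (((((ρ : ℤ) ^ 2 * (N₀ + q₀ * (k₀ + i)) - (π : ℤ) ^ 2) / (D : ℤ) ^ 2 : ℤ) : ZMod 8)) : ℝ) *
        ((jacobiSym (N₀ + q₀ * (k₀ + i)) n *
          jacobiSym (((ρ : ℤ) ^ 2 * (N₀ + q₀ * (k₀ + i)) - (π : ℤ) ^ 2) / (D : ℤ) ^ 2) n : ℤ) : ℝ) =
      ∑ i ∈ range L, g (k₀ + i) * ((jacobiSym (q₀ * (k₀ + i) + N₀) n *
        jacobiSym (ρ ^ 2 * a ^ 2 * (k₀ + i) + M₀) n : ℤ) : ℝ) := by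
    refine sum_congr rfl fun i _ => ?_
    simp only [hM, hg]
    rw [add_comm N₀]
  rw [hsumeq]
  -- The progression has `L` terms, within 1 of `Y / q₀`; this is the final `+ 1` in the error.
  have hmain : |(L : ℝ) * (m₂ * E) - Y * (1 / ((a : ℝ) ^ 2 * (D : ℝ) ^ 2) * (m₂ * E))| ≤ 1 := by
    have : (L : ℝ) * (m₂ * E) - Y * (1 / ((a : ℝ) ^ 2 * (D : ℝ) ^ 2) * (m₂ * E)) =
        (L - Y / q₀) * (m₂ * E) := by
      rw [hq₀]; push_cast; ring
    rw [this, abs_mul]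
    exact mul_le_one₀ hL (abs_nonneg _) hmE
  exact (abs_sub_le _ _ _).trans (add_le_add key hmain)

end

/-! ### Densities at the prime 2. -/

section

open Finset

theorem natCast_sq_zmod_eight (u : ℕ) :
    ((u : ZMod 8)) ^ 2 = if u % 2 = 1 then 1 else if u % 4 = 2 then 4 else 0 := by
  have h : ∀ x : ZMod 8, x ^ 2 = if x.val % 2 = 1 then 1 else if x.val % 4 = 2 then 4 else 0 := by
    decide
  have h2 : u % 8 % 2 = u % 2 := by omega
  have h4 : u % 8 % 4 = u % 4 := by omega
  rw [h, ZMod.val_natCast, h2, h4]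

theorem twoAdicWeight_of_ne_zero {e : ℕ} (he : e ≠ 0) (x y : ZMod 8) :
    twoAdicWeight e x y = twoAdicWeight (if Odd e then 1 else 2) x y := by
  have h : ∀ x : ZMod 8, ZMod.χ₈ x = 0 ∨ ZMod.χ₈ x = 1 ∨ ZMod.χ₈ x = -1 := by decide
  rw [twoAdicWeight, twoAdicWeight]
  congr 1
  rcases Nat.even_or_odd e with h1 | h1
  · rw [if_neg (Nat.not_odd_iff_even.2 h1)]
    rcases h x with hx | hx | hx <;> rcases h y with hy | hy | hy <;>
      simp [hx, hy, he, h1.neg_one_pow]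
  · rw [if_pos h1]
    rcases h x with hx | hx | hx <;> rcases h y with hy | hy | hy <;>
      simp [hx, hy, he, h1.neg_one_pow]

/-- The value at even conductors of a function of `e` depending only on `e = 0` and its parity. -/
noncomputable def parityValue (x y z : ℝ) (e : ℕ) : ℝ :=
  if e = 0 then x else if Odd e then y else z

theorem sum_twoAdicWeight_eq_parityValue (f h : ZMod 8 → ZMod 8) (u v w : ℤ)
    (h0 : ∑ x, twoAdicWeight 0 (f x) (h x) = u) (h1 : ∑ x, twoAdicWeight 1 (f x) (h x) = v)
    (h2 : ∑ x, twoAdicWeight 2 (f x) (h x) = w) (e : ℕ) :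
    (∑ x, (twoAdicWeight e (f x) (h x) : ℝ)) / 8 = parityValue (u / 8) (v / 8) (w / 8) e := by
  rw [← Int.cast_sum, parityValue]
  split_ifs with he ho
  · rw [he, h0]
  · simp only [twoAdicWeight_of_ne_zero he, if_pos ho, h1]
  · simp only [twoAdicWeight_of_ne_zero he, if_neg ho, h2]

/-- The density of the twisted weight at the prime `2`, for the exponents `b` of `d` and `e` of
`n`. -/
noncomputable def twoAdicDensity (r b e : ℕ) : ℝ :=
  if r % 2 = 1 then (if b = 0 then parityValue (3 / 4) (-1 / 2) (1 / 2) e else 0)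
  else if r % 4 = 2 then
    (if b = 0 then parityValue (3 / 4) 0 0 e else if b = 1 then parityValue (1 / 4) 0 0 e
      else parityValue (1 / 2) 0 (1 / 4) e)
  else
    (if b = 0 then parityValue (3 / 4) 0 0 e else if b = 1 then parityValue (1 / 4) 0 (1 / 4) e
      else 0)

/-- With unit step, `N` runs over all classes modulo 8 while the cofactor is `c N - k`. Only the
finite tables for `e = 0, 1, 2` remain, since later exponents depend on parity alone. -/
theorem sum_twoAdicWeight_of_unit (c k : ZMod 8) (u v w : ℤ)
    (h0 : ∑ x, twoAdicWeight 0 x (c * x - k) = u) (h1 : ∑ x, twoAdicWeight 1 x (c * x - k) = v)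
    (h2 : ∑ x, twoAdicWeight 2 x (c * x - k) = w) (N₀ M₀ s : ZMod 8)
    (hs : s = 1) (hM : c * N₀ - k = M₀) (e : ℕ) :
    (∑ x : ZMod 8, (twoAdicWeight e (N₀ + s * x) (M₀ + c * x) : ℝ)) / 8 =
      parityValue (u / 8) (v / 8) (w / 8) e := by
  rw [← sum_twoAdicWeight_eq_parityValue (fun x => x) (fun x => c * x - k) u v w h0 h1 h2]
  congr 1
  refine Fintype.sum_equiv (Equiv.addLeft N₀) _ _ fun x => ?_
  simp only [Equiv.coe_addLeft, hs, one_mul]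
  rw [← hM]
  ring_nf

/-- When the step `s` is an even square, it is the cofactor that runs over all classes, and `N = 1 +
s M` is recovered from it. -/
theorem sum_twoAdicWeight_of_odd_odd (s : ZMod 8) (hs : s = 0 ∨ s = 4) (N₀ M₀ c : ZMod 8)
    (hc : c = 1) (hM : N₀ - 1 = s * M₀) (e : ℕ) :
    (∑ x : ZMod 8, (twoAdicWeight e (N₀ + s * x) (M₀ + c * x) : ℝ)) / 8 =
      parityValue (1 / 2) 0 (1 / 4) e := by
  have h : (∑ x : ZMod 8, (twoAdicWeight e (1 + s * x) x : ℝ)) / 8 =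
      parityValue ((4 : ℤ) / 8) ((0 : ℤ) / 8) ((2 : ℤ) / 8) e := by
    rcases hs with rfl | rfl
    · exact sum_twoAdicWeight_eq_parityValue (fun x => 1 + 0 * x) (fun x => x) 4 0 2 (by decide)
        (by decide) (by decide) e
    · exact sum_twoAdicWeight_eq_parityValue (fun x => 1 + 4 * x) (fun x => x) 4 0 2 (by decide)
        (by decide) (by decide) e
  have h' : parityValue ((4 : ℤ) / 8) ((0 : ℤ) / 8) ((2 : ℤ) / 8) e = parityValue (1 / 2) 0 (1 / 4) e := by
    norm_num
  rw [← h', ← h]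
  congr 1
  refine Fintype.sum_equiv (Equiv.addLeft M₀) _ _ fun x => ?_
  simp only [Equiv.coe_addLeft, hc, one_mul]
  rw [show N₀ = 1 + s * M₀ by linear_combination hM]
  ring_nf

/-- For odd `d` the relation modulo 8 reads `M = r² N - 4`, so only the class of `r²`, one of 1, 4
and 0, matters. -/
theorem twoAdic_mean_of_odd {r P d a : ℕ} (hP : Odd P) (hd : Odd d) (ha : Odd a) (e : ℕ)
    (N₀ : ℤ) (h : (d : ℤ) ^ 2 ∣ (r : ℤ) ^ 2 * N₀ - ((2 * P : ℕ) : ℤ) ^ 2) :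
    (∑ x : ZMod 8, (twoAdicWeight e ((N₀ : ZMod 8) + a ^ 2 * d ^ 2 * x)
        (((((r : ℤ) ^ 2 * N₀ - ((2 * P : ℕ) : ℤ) ^ 2) / (d : ℤ) ^ 2 : ℤ) : ZMod 8)
          + r ^ 2 * a ^ 2 * x) : ℝ)) / 8 = twoAdicDensity r 0 e := by
  obtain ⟨M₀, hM₀⟩ := h
  have hd0 : (d : ℤ) ^ 2 ≠ 0 := pow_ne_zero 2 (by exact_mod_cast hd.pos.ne')
  rw [hM₀, Int.mul_ediv_cancel_left _ hd0]
  have hc := congrArg (Int.cast : ℤ → ZMod 8) hM₀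
  push_cast at hc
  have ha2 : (a : ZMod 8) ^ 2 = 1 := by rw [natCast_sq_zmod_eight, if_pos (Nat.odd_iff.1 ha)]
  have hd2 : (d : ZMod 8) ^ 2 = 1 := by rw [natCast_sq_zmod_eight, if_pos (Nat.odd_iff.1 hd)]
  have hP2 : (P : ZMod 8) ^ 2 = 1 := by rw [natCast_sq_zmod_eight, if_pos (Nat.odd_iff.1 hP)]
  rw [mul_pow, hP2, hd2] at hc
  rw [ha2, hd2]
  simp only [mul_one]
  have h4 : (2 : ZMod 8) ^ 2 = 4 := by decide
  rw [h4, mul_one, one_mul] at hc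
  rw [natCast_sq_zmod_eight] at hc ⊢
  rw [twoAdicDensity]
  by_cases h1 : r % 2 = 1
  · rw [if_pos h1] at hc ⊢
    rw [sum_twoAdicWeight_of_unit 1 4 6 (-4) 4 (by decide) (by decide) (by decide) _ _ 1 rfl hc,
      if_pos h1, if_pos rfl]
    norm_num
  by_cases h2 : r % 4 = 2
  · rw [if_neg h1, if_pos h2] at hc ⊢
    rw [sum_twoAdicWeight_of_unit 4 4 6 0 0 (by decide) (by decide) (by decide) _ _ 1 rfl hc,
      if_neg h1, if_pos h2, if_pos rfl]
    norm_num
  · rw [if_neg h1, if_neg h2] at hc ⊢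
    rw [sum_twoAdicWeight_of_unit 0 4 6 0 0 (by decide) (by decide) (by decide) _ _ 1 rfl hc,
      if_neg h1, if_neg h2, if_pos rfl]
    norm_num

/-- For even `d` a factor 4 cancels and leaves `D = d / 2`, `r / 2` and `P`. If `D` is odd, then `M
= (r/2)² N - 1` modulo 8. If `D` is even, coprimality forces `r / 2` odd and the roles of `N` and
`M` are exchanged. -/
theorem twoAdic_mean_of_even {r P D a b : ℕ} (hP : Odd P) (ha : Odd a) (hr : r % 2 = 0)
    (hD : 0 < D) (hDr : D.Coprime (r / 2)) (hb : b = 0 ↔ Odd D) (e : ℕ) (N₀ : ℤ)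
    (h : (D : ℤ) ^ 2 ∣ ((r / 2 : ℕ) : ℤ) ^ 2 * N₀ - (P : ℤ) ^ 2) :
    (∑ x : ZMod 8, (twoAdicWeight e ((N₀ : ZMod 8) + a ^ 2 * D ^ 2 * x)
        ((((((r / 2 : ℕ) : ℤ) ^ 2 * N₀ - (P : ℤ) ^ 2) / (D : ℤ) ^ 2 : ℤ) : ZMod 8)
          + ((r / 2 : ℕ) : ZMod 8) ^ 2 * a ^ 2 * x) : ℝ)) / 8 = twoAdicDensity r (b + 1) e := by
  obtain ⟨M₀, hM₀⟩ := h
  have hd0 : (D : ℤ) ^ 2 ≠ 0 := pow_ne_zero 2 (by exact_mod_cast hD.ne')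
  rw [hM₀, Int.mul_ediv_cancel_left _ hd0]
  have hc := congrArg (Int.cast : ℤ → ZMod 8) hM₀
  rw [Int.cast_sub, Int.cast_mul, Int.cast_pow, Int.cast_pow, Int.cast_mul, Int.cast_pow,
    Int.cast_natCast, Int.cast_natCast, Int.cast_natCast] at hc
  have ha2 : (a : ZMod 8) ^ 2 = 1 := by rw [natCast_sq_zmod_eight, if_pos (Nat.odd_iff.1 ha)]
  have hP2 : (P : ZMod 8) ^ 2 = 1 := by rw [natCast_sq_zmod_eight, if_pos (Nat.odd_iff.1 hP)]
  rw [hP2] at hc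
  rw [ha2]
  simp only [mul_one, one_mul]
  by_cases hDo : Odd D
  · have hD2 : (D : ZMod 8) ^ 2 = 1 := by rw [natCast_sq_zmod_eight, if_pos (Nat.odd_iff.1 hDo)]
    rw [hD2, one_mul] at hc
    rw [hD2, hb.2 hDo]
    rw [natCast_sq_zmod_eight] at hc ⊢
    rw [twoAdicDensity, if_neg (show ¬r % 2 = 1 by rw [hr]; norm_num)]
    by_cases h1 : r / 2 % 2 = 1
    · rw [if_pos h1] at hc ⊢
      have h2 : r % 4 = 2 := by clear hM₀; omega
      rw [sum_twoAdicWeight_of_unit 1 1 2 0 0 (by decide) (by decide) (by decide) _ _ 1 rfl hc,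
        if_pos h2, if_neg (show ¬(0 + 1 = 0) by norm_num), if_pos rfl]
      norm_num
    have h3 : ¬r % 4 = 2 := by clear hM₀; omega
    rw [if_neg h3, if_neg (show ¬(0 + 1 = 0) by norm_num), if_pos (show 0 + 1 = 1 from rfl)]
    by_cases h2 : r / 2 % 4 = 2
    · rw [if_neg h1, if_pos h2] at hc ⊢
      rw [sum_twoAdicWeight_of_unit 4 1 2 0 2 (by decide) (by decide) (by decide) _ _ 1 rfl hc]
      norm_num
    · rw [if_neg h1, if_neg h2] at hc ⊢
      rw [sum_twoAdicWeight_of_unit 0 1 2 0 2 (by decide) (by decide) (by decide) _ _ 1 rfl hc]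
      norm_num
  · have hb0 : b ≠ 0 := fun h => hDo (hb.1 h)
    have hr2 : r / 2 % 2 = 1 := by
      by_contra hne
      have h1 : 2 ∣ r / 2 := by omega
      have h2 : 2 ∣ D := even_iff_two_dvd.1 (Nat.not_odd_iff_even.1 hDo)
      exact absurd (Nat.eq_one_of_dvd_coprimes hDr h2 h1) (by norm_num)
    have hs : (D : ZMod 8) ^ 2 = 0 ∨ (D : ZMod 8) ^ 2 = 4 := by
      rw [natCast_sq_zmod_eight, if_neg (fun h => hDo (Nat.odd_iff.2 h))]
      split_ifs <;> simp
    have hc1 : ((r / 2 : ℕ) : ZMod 8) ^ 2 = 1 := by rw [natCast_sq_zmod_eight, if_pos hr2]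
    rw [hc1, one_mul] at hc
    have h4 : r % 4 = 2 := by clear hM₀; omega
    rw [hc1, sum_twoAdicWeight_of_odd_odd _ hs _ _ 1 rfl hc, twoAdicDensity,
      if_neg (show ¬r % 2 = 1 by rw [hr]; norm_num), if_pos h4, if_neg (by omega), if_neg (by omega)]

end

/-! ### The sieve term and its density on multiples of a square. -/

section

open Finset

theorem val_intCast_zmod_eight_mod_four (k : ℤ) : (((k : ZMod 8).val % 4 : ℕ) : ℤ) = k % 4 := by
  have := ZMod.val_intCast (n := 8) k
  push_cast at this ⊢
  omega

/-- The summand of the twisted sum with the coprimality to `P` dropped and the square-free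
condition weakened to its part at the prime `2`. -/
def sieveTerm (P r d n : ℕ) (N : ℤ) : ℤ :=
  if ¬ (4 : ℤ) ∣ N ∧ (d : ℤ) ^ 2 ∣ (r : ℤ) ^ 2 * N - 4 * (P : ℤ) ^ 2 ∧
    (((r : ℤ) ^ 2 * N ^ 2 - 4 * (P : ℤ) ^ 2 * N) / (d : ℤ) ^ 2 ≡ 0 [ZMOD 4] ∨
      ((r : ℤ) ^ 2 * N ^ 2 - 4 * (P : ℤ) ^ 2 * N) / (d : ℤ) ^ 2 ≡ 1 [ZMOD 4]) then
    kroneckerSymbol N n * kroneckerSymbol (((r : ℤ) ^ 2 * N - 4 * (P : ℤ) ^ 2) / (d : ℤ) ^ 2) n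
  else 0

theorem sieveTerm_eq {P r d n : ℕ} (hd : 0 < d) {N : ℤ}
    (h : (d : ℤ) ^ 2 ∣ (r : ℤ) ^ 2 * N - 4 * (P : ℤ) ^ 2) :
    sieveTerm P r d n N = twoAdicWeight (n.factorization 2) (N : ZMod 8)
      (((((r : ℤ) ^ 2 * N - 4 * (P : ℤ) ^ 2) / (d : ℤ) ^ 2 : ℤ)) : ZMod 8) *
      (jacobiSym N (n / 2 ^ n.factorization 2) *
        jacobiSym (((r : ℤ) ^ 2 * N - 4 * (P : ℤ) ^ 2) / (d : ℤ) ^ 2)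
          (n / 2 ^ n.factorization 2)) := by
  have hd2 : (d : ℤ) ^ 2 ≠ 0 := pow_ne_zero 2 (by exact_mod_cast hd.ne')
  obtain ⟨M, hM⟩ := id h
  have h1 : ((r : ℤ) ^ 2 * N ^ 2 - 4 * (P : ℤ) ^ 2 * N) / (d : ℤ) ^ 2 = N * M := by
    rw [show (r : ℤ) ^ 2 * N ^ 2 - 4 * (P : ℤ) ^ 2 * N = (d : ℤ) ^ 2 * (N * M) by
      linear_combination N * hM]
    exact Int.mul_ediv_cancel_left _ hd2
  rw [sieveTerm, h1, twoAdicWeight]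
  simp only [h, true_and]
  rw [hM, Int.mul_ediv_cancel_left _ hd2]
  have h2 := val_intCast_zmod_eight_mod_four N
  have h3 := val_intCast_zmod_eight_mod_four (N * M)
  push_cast at h3
  have hcond : (¬ (4 : ℤ) ∣ N ∧ (N * M ≡ 0 [ZMOD 4] ∨ N * M ≡ 1 [ZMOD 4])) ↔
      ((N : ZMod 8).val % 4 ≠ 0 ∧ (((N : ZMod 8) * (M : ZMod 8)).val % 4 = 0 ∨
        ((N : ZMod 8) * (M : ZMod 8)).val % 4 = 1)) := by
    rw [Int.ModEq, Int.ModEq, Int.dvd_iff_emod_eq_zero]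
    generalize N * M = K at h3 ⊢
    generalize ((N : ZMod 8) * (M : ZMod 8)).val = k at h3 ⊢
    generalize (N : ZMod 8).val = k' at h2 ⊢
    omega
  by_cases hc : ¬ (4 : ℤ) ∣ N ∧ (N * M ≡ 0 [ZMOD 4] ∨ N * M ≡ 1 [ZMOD 4])
  · rw [if_pos hc, if_pos (hcond.1 hc), kroneckerSymbol, kroneckerSymbol, mul_pow]
    ring
  · rw [if_neg hc, if_neg (fun h => hc (hcond.2 h)), zero_mul]

theorem sieveTerm_of_not_dvd {P r d n : ℕ} {N : ℤ}
    (h : ¬ (d : ℤ) ^ 2 ∣ (r : ℤ) ^ 2 * N - 4 * (P : ℤ) ^ 2) : sieveTerm P r d n N = 0 := by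
  rw [sieveTerm, if_neg (fun h' => h h'.2.1)]

theorem sieveTerm_of_four_dvd {P r d n : ℕ} {N : ℤ} (h : (4 : ℤ) ∣ N) :
    sieveTerm P r d n N = 0 := by
  rw [sieveTerm, if_neg (fun h' => h'.1 h)]

/-- The density of `sieveTerm` on the multiples of `a ^ 2`. -/
noncomputable def sieveDensity (r a d n : ℕ) : ℝ :=
  if Odd a ∧ a.Coprime d ∧ a.Coprime (n / 2 ^ n.factorization 2) ∧
      (d / 2 ^ d.factorization 2).Coprime r then
    1 / ((a : ℝ) ^ 2 * ((if Odd d then d else d / 2 : ℕ) : ℝ) ^ 2) *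
      (twoAdicDensity r (d.factorization 2) (n.factorization 2) *
        ∏ q ∈ (n / 2 ^ n.factorization 2).primeFactors,
          localMean q ((n / 2 ^ n.factorization 2).factorization q) (q ∣ r * d))
  else 0

theorem odd_div_two_pow_factorization {n : ℕ} (hn : n ≠ 0) : Odd (n / 2 ^ n.factorization 2) := by
  rw [← Nat.not_even_iff_odd, even_iff_two_dvd]
  exact Nat.not_dvd_ordCompl Nat.prime_two hn

/-- Otherwise `q²` would divide `π²`, against the coprimality of `D` and `π`. This disposes of every
incompatible choice of `a`, `D`, `ρ`. -/
theorem not_dvd_of_prime_dvd {ρ π D q : ℕ} {N : ℤ} (hq : q.Prime) (hDπ : D.Coprime π) (hqD : q ∣ D)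
    (h1 : (q : ℤ) ^ 2 ∣ (ρ : ℤ) ^ 2 * N) : ¬ (D : ℤ) ^ 2 ∣ (ρ : ℤ) ^ 2 * N - (π : ℤ) ^ 2 := by
  intro h
  have h2 : (q : ℤ) ^ 2 ∣ (D : ℤ) ^ 2 := pow_dvd_pow_of_dvd (by exact_mod_cast hqD) 2
  have h3 : (q : ℤ) ^ 2 ∣ (π : ℤ) ^ 2 := by
    have := dvd_sub h1 (h2.trans h)
    rwa [sub_sub_cancel] at this
  have h4 : q ^ 2 ∣ π ^ 2 := by exact_mod_cast h3
  have h5 : q ∣ π := (Nat.pow_dvd_pow_iff two_ne_zero).1 h4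
  exact hq.one_lt.ne' (Nat.eq_one_of_dvd_coprimes hDπ hqD h5)

theorem exists_prime_dvd_of_not_coprime {a b : ℕ} (h : ¬ a.Coprime b) :
    ∃ q, q.Prime ∧ q ∣ a ∧ q ∣ b := by
  obtain ⟨q, hq, h1, h2⟩ := Nat.Prime.not_coprime_iff_dvd.1 h
  exact ⟨q, hq, h1, h2⟩

/-- The bound for the error term in the sums of `sieveTerm`. -/
noncomputable def completionError (n : ℕ) : ℝ :=
  8 * (2 ^ n.primeFactors.card * Real.sqrt n) * (1 + Real.log (8 * n)) + 1

theorem completionError_div_le {n : ℕ} (hn : n ≠ 0) :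
    completionError (n / 2 ^ n.factorization 2) ≤ completionError n := by
  have h0 : 0 < n / 2 ^ n.factorization 2 := Nat.ordCompl_pos 2 hn
  have h1 : n / 2 ^ n.factorization 2 ≤ n := Nat.div_le_self _ _
  have h2 : (((n / 2 ^ n.factorization 2 : ℕ)) : ℝ) ≤ n := by exact_mod_cast h1
  have h3 : #(n / 2 ^ n.factorization 2).primeFactors ≤ #n.primeFactors :=
    card_le_card (Nat.primeFactors_mono (Nat.ordCompl_dvd n 2) hn)
  have h0' : (1 : ℝ) ≤ ((n / 2 ^ n.factorization 2 : ℕ) : ℝ) := by exact_mod_cast h0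
  have hlog : 0 ≤ Real.log (8 * ((n / 2 ^ n.factorization 2 : ℕ) : ℝ)) :=
    Real.log_nonneg (by linarith)
  unfold completionError
  gcongr
  norm_num

theorem completionError_pos (n : ℕ) (hn : n ≠ 0) : 0 < completionError n := by
  have : (1 : ℝ) ≤ n := by exact_mod_cast Nat.one_le_iff_ne_zero.2 hn
  have hlog : 0 ≤ Real.log (8 * (n : ℝ)) := Real.log_nonneg (by linarith)
  unfold completionError
  positivity

/-- Handles both parities of `d`: `(ρ, π, D)` is `(r, 2P, d)` or `(r/2, P, d/2)`. For incompatible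
parameters each term is zero: `a` even gives `4 ∣ N`, a prime common to `D` and `a` or `ρ`
contradicts the divisibility by `D²`, and one common to `a` and `n` kills the Jacobi symbol. -/
theorem abs_sum_sieveTerm_sub_le_aux {P r d n a ρ π D : ℕ} (hd : 0 < d) (hn : n ≠ 0) (ha : 0 < a)
    (hD : 0 < D)
    (hdvd : ∀ N : ℤ, (d : ℤ) ^ 2 ∣ (r : ℤ) ^ 2 * N - 4 * (P : ℤ) ^ 2 ↔
      (D : ℤ) ^ 2 ∣ (ρ : ℤ) ^ 2 * N - (π : ℤ) ^ 2)
    (hdiv : ∀ N : ℤ, ((r : ℤ) ^ 2 * N - 4 * (P : ℤ) ^ 2) / (d : ℤ) ^ 2 =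
      ((ρ : ℤ) ^ 2 * N - (π : ℤ) ^ 2) / (D : ℤ) ^ 2)
    (hDπ : D.Coprime π) (hnπ : (n / 2 ^ n.factorization 2).Coprime π)
    (hmean : Odd a → D.Coprime ρ → ∀ N₀ : ℤ, (D : ℤ) ^ 2 ∣ (ρ : ℤ) ^ 2 * N₀ - (π : ℤ) ^ 2 →
      (∑ x : ZMod 8, (twoAdicWeight (n.factorization 2) ((N₀ : ZMod 8) + a ^ 2 * D ^ 2 * x)
        (((((ρ : ℤ) ^ 2 * N₀ - (π : ℤ) ^ 2) / (D : ℤ) ^ 2 : ℤ) : ZMod 8) + ρ ^ 2 * a ^ 2 * x) : ℝ)) / 8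
        = twoAdicDensity r (d.factorization 2) (n.factorization 2))
    (hpos : Odd a → a.Coprime D → a.Coprime (n / 2 ^ n.factorization 2) → D.Coprime ρ →
      sieveDensity r a d n = 1 / ((a : ℝ) ^ 2 * (D : ℝ) ^ 2) *
      (twoAdicDensity r (d.factorization 2) (n.factorization 2) *
        ∏ q ∈ (n / 2 ^ n.factorization 2).primeFactors,
          localMean q ((n / 2 ^ n.factorization 2).factorization q) (q ∣ ρ * D)))
    (hneg : ¬ (Odd a ∧ a.Coprime D ∧ a.Coprime (n / 2 ^ n.factorization 2) ∧ D.Coprime ρ) →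
      sieveDensity r a d n = 0) (X Y : ℝ) (hY : 0 ≤ Y) :
    |∑ N ∈ (Icc ⌈X⌉ ⌊X + Y⌋).filter (fun N => (a : ℤ) ^ 2 ∣ N), (sieveTerm P r d n N : ℝ) -
      Y * sieveDensity r a d n| ≤ completionError n := by
  set n' := n / 2 ^ n.factorization 2 with hn'
  have hn'odd : Odd n' := odd_div_two_pow_factorization hn
  by_cases hgood : Odd a ∧ a.Coprime D ∧ a.Coprime n' ∧ D.Coprime ρ
  · obtain ⟨h1, h2, h3, h4⟩ := hgood
    rw [hpos h1 h2 h3 h4]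
    have key := abs_sum_progression_sub_le ρ π D a n' (n.factorization 2) hn'odd hD ha h4 h2 h3.symm
      hnπ _ (fun N₀ _ h => hmean h1 h4 N₀ h) X Y hY
    refine le_trans (le_of_eq ?_) (key.trans (completionError_div_le hn))
    congr 2
    rw [← filter_filter, ← sum_filter_add_sum_filter_not _ (fun N : ℤ =>
      (D : ℤ) ^ 2 ∣ (ρ : ℤ) ^ 2 * N - (π : ℤ) ^ 2)]
    rw [sum_eq_zero (s := filter (fun N : ℤ => ¬ (D : ℤ) ^ 2 ∣ (ρ : ℤ) ^ 2 * N - (π : ℤ) ^ 2) _),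
      add_zero]
    · refine sum_congr rfl fun N hN => ?_
      rw [sieveTerm_eq hd ((hdvd N).2 (mem_filter.1 hN).2), hdiv]
      push_cast
      ring
    · intro N hN
      rw [sieveTerm_of_not_dvd (fun h => (mem_filter.1 hN).2 ((hdvd N).1 h)), Int.cast_zero]
  · rw [hneg hgood, mul_zero, sub_zero, sum_eq_zero, abs_zero]
    · exact (completionError_pos n hn).le
    intro N hN
    have haN := (mem_filter.1 hN).2
    by_cases hN' : (D : ℤ) ^ 2 ∣ (ρ : ℤ) ^ 2 * N - (π : ℤ) ^ 2
    swap
    · rw [sieveTerm_of_not_dvd (fun h => hN' ((hdvd N).1 h)), Int.cast_zero]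
    by_cases h1 : Odd a
    swap
    · rw [sieveTerm_of_four_dvd, Int.cast_zero]
      refine dvd_trans ?_ haN
      obtain ⟨c, hc⟩ := even_iff_two_dvd.1 (Nat.not_odd_iff_even.1 h1)
      exact ⟨c ^ 2, by rw [hc]; push_cast; ring⟩
    by_cases h2 : a.Coprime D
    swap
    · obtain ⟨q, hq, h3, h4⟩ := exists_prime_dvd_of_not_coprime h2
      refine absurd hN' (not_dvd_of_prime_dvd hq hDπ h4 (Dvd.dvd.mul_left (dvd_trans ?_ haN) _))
      exact pow_dvd_pow_of_dvd (by exact_mod_cast h3) 2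
    by_cases h3 : D.Coprime ρ
    swap
    · obtain ⟨q, hq, h4, h5⟩ := exists_prime_dvd_of_not_coprime h3
      refine absurd hN' (not_dvd_of_prime_dvd hq hDπ h4 (Dvd.dvd.mul_right ?_ _))
      exact pow_dvd_pow_of_dvd (by exact_mod_cast h5) 2
    have h4 : ¬ a.Coprime n' := fun h => hgood ⟨h1, h2, h, h3⟩
    obtain ⟨q, hq, h5, h6⟩ := exists_prime_dvd_of_not_coprime h4
    rw [sieveTerm_eq hd ((hdvd N).2 hN')]
    have : jacobiSym N n' = 0 := by
      have hNe : NeZero n' := ⟨hn'odd.pos.ne'⟩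
      rw [jacobiSym.eq_zero_iff_not_coprime]
      intro h
      have h7 : (q : ℤ) ∣ N := dvd_trans (by exact_mod_cast h5) (dvd_trans (dvd_pow_self _ two_ne_zero) haN)
      have h8 : q ∣ N.gcd n' := Int.dvd_gcd h7 (by exact_mod_cast h6)
      rw [h] at h8
      exact hq.one_lt.ne' (Nat.dvd_one.1 h8)
    rw [this]
    simp

theorem odd_primeFactors {n q : ℕ} (hn : Odd n) (hq : q ∈ n.primeFactors) : q.Coprime 2 := by
  rw [Nat.coprime_comm, Nat.coprime_two_left]
  exact hn.of_dvd_nat (Nat.dvd_of_mem_primeFactors hq)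

theorem abs_sum_sieveTerm_sub_le {P r d n a : ℕ} (hP : P.Prime) (hP2 : Odd P) (hd : 0 < d)
    (hn : n ≠ 0) (ha : 0 < a) (hPd : ¬ P ∣ d) (hPn : ¬ P ∣ n) (X Y : ℝ) (hY : 0 ≤ Y) :
    |∑ N ∈ (Icc ⌈X⌉ ⌊X + Y⌋).filter (fun N => (a : ℤ) ^ 2 ∣ N), (sieveTerm P r d n N : ℝ) -
      Y * sieveDensity r a d n| ≤ completionError n := by
  set n' := n / 2 ^ n.factorization 2 with hn'
  have hn'odd : Odd n' := odd_div_two_pow_factorization hn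
  have hn'P : n'.Coprime P := by
    rw [Nat.coprime_comm, hP.coprime_iff_not_dvd]
    exact fun h => hPn (h.trans (Nat.ordCompl_dvd n 2))
  by_cases hdo : Odd d
  · have hv : d.factorization 2 = 0 :=
      Nat.factorization_eq_zero_of_not_dvd (fun h => (Nat.not_even_iff_odd.2 hdo) (even_iff_two_dvd.2 h))
    have hd2 : d.Coprime 2 := Nat.coprime_two_right.2 hdo
    have hdP : d.Coprime P := by rw [Nat.coprime_comm, hP.coprime_iff_not_dvd]; exact hPd
    refine abs_sum_sieveTerm_sub_le_aux (ρ := r) (π := 2 * P) (D := d) hd hn ha hd ?_ ?_ ?_ ?_ ?_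
      ?_ ?_ X Y hY
    · intro N; push_cast; rw [show ((2 : ℤ) * P) ^ 2 = 4 * P ^ 2 by ring]
    · intro N; push_cast; rw [show ((2 : ℤ) * P) ^ 2 = 4 * P ^ 2 by ring]
    · exact hd2.mul_right hdP
    · exact (Nat.coprime_two_right.2 hn'odd).mul_right hn'P
    · intro h1 _ N₀ h2
      rw [hv]
      exact twoAdic_mean_of_odd hP2 hdo h1 _ N₀ h2
    · intro h1 h2 h3 h4
      rw [sieveDensity, if_pos ⟨h1, h2, h3, by rw [hv]; simpa using h4⟩, if_pos hdo]
    · intro h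
      rw [sieveDensity, if_neg]
      rintro ⟨h1, h2, h3, h4⟩
      rw [hv] at h4
      exact h ⟨h1, h2, h3, by simpa using h4⟩
  have hde := Nat.not_odd_iff_even.1 hdo
  obtain ⟨D, hD⟩ := even_iff_two_dvd.1 hde
  have hD0 : 0 < D := by omega
  have hb : d.factorization 2 = D.factorization 2 + 1 := by
    rw [hD, Nat.factorization_mul two_ne_zero hD0.ne']
    simp [Nat.prime_two.factorization, add_comm]
  by_cases hr : r % 2 = 1
  -- For `d` even and `r` odd, `4 ∣ r² N` forces `4 ∣ N`, so the terms vanish together with the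
  -- density.
  · have hz : sieveDensity r a d n = 0 := by
      rw [sieveDensity, twoAdicDensity, if_pos hr, if_neg (show ¬ d.factorization 2 = 0 by omega)]
      simp
    rw [hz, mul_zero, sub_zero, sum_eq_zero, abs_zero]
    · exact (completionError_pos n hn).le
    intro N _
    by_cases hN : (d : ℤ) ^ 2 ∣ (r : ℤ) ^ 2 * N - 4 * (P : ℤ) ^ 2
    swap
    · rw [sieveTerm_of_not_dvd hN, Int.cast_zero]
    rw [sieveTerm_of_four_dvd, Int.cast_zero]
    have h1 : (4 : ℤ) ∣ (r : ℤ) ^ 2 * N := by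
      have h2 : (4 : ℤ) ∣ (d : ℤ) ^ 2 := ⟨(D : ℤ) ^ 2, by rw [hD]; push_cast; ring⟩
      have := dvd_add (h2.trans hN) (dvd_mul_right (4 : ℤ) ((P : ℤ) ^ 2))
      rwa [sub_add_cancel] at this
    refine IsCoprime.dvd_of_dvd_mul_left ?_ h1
    have : IsCoprime ((2 : ℕ) : ℤ) ((r : ℕ) : ℤ) :=
      Nat.isCoprime_iff_coprime.2 (Nat.coprime_two_left.2 (Nat.odd_iff.2 hr))
    have h3 := this.pow (m := 2) (n := 2)
    simpa using h3
  have hr0 : r % 2 = 0 := by omega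
  have hrr : r = 2 * (r / 2) := by omega
  have hDP : D.Coprime P := by
    rw [Nat.coprime_comm, hP.coprime_iff_not_dvd]
    exact fun h => hPd (hD ▸ h.mul_left 2)
  have hfact : ∀ N : ℤ, (r : ℤ) ^ 2 * N - 4 * (P : ℤ) ^ 2 =
      4 * (((r / 2 : ℕ) : ℤ) ^ 2 * N - (P : ℤ) ^ 2) := by
    intro N
    conv_lhs => rw [hrr]
    push_cast
    ring
  have hd2 : (d : ℤ) ^ 2 = 4 * (D : ℤ) ^ 2 := by rw [hD]; push_cast; ring
  have hbo : D.factorization 2 = 0 ↔ Odd D := by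
    rw [Nat.factorization_eq_zero_iff, ← Nat.not_even_iff_odd, even_iff_two_dvd]
    simp [Nat.prime_two, hD0.ne']
  have hoddpart : d / 2 ^ d.factorization 2 = D / 2 ^ D.factorization 2 := by
    rw [hb, hD, pow_succ', Nat.mul_div_mul_left _ _ (by norm_num)]
  have hcopr : r % 4 = 2 ∨ Odd D → ((d / 2 ^ d.factorization 2).Coprime r ↔ D.Coprime (r / 2)) := by
    intro hor
    have hodd := odd_div_two_pow_factorization hD0.ne'
    have h1 : (d / 2 ^ d.factorization 2).Coprime r ↔
        (D / 2 ^ D.factorization 2).Coprime (r / 2) := by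
      rw [hoddpart]
      conv_lhs => rw [hrr]
      rw [Nat.coprime_mul_iff_right]
      exact and_iff_right (Nat.coprime_two_right.2 hodd)
    rw [h1]
    have hD' := Nat.ordProj_mul_ordCompl_eq_self D 2
    constructor
    · intro h
      rw [← hD']
      refine Nat.Coprime.mul_left ?_ h
      rcases hor with h2 | h2
      · exact Nat.Coprime.pow_left _ (Nat.coprime_two_left.2 (Nat.odd_iff.2 (by omega)))
      · rw [hbo.2 h2, pow_zero]; exact Nat.coprime_one_left _
    · exact fun h => h.coprime_dvd_left (Nat.ordCompl_dvd D 2)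
  have haD : Odd a → (a.Coprime d ↔ a.Coprime D) := by
    intro h
    rw [hD, Nat.coprime_mul_iff_right]
    exact and_iff_right (Nat.coprime_two_right.2 h)
  refine abs_sum_sieveTerm_sub_le_aux (ρ := r / 2) (π := P) (D := D) hd hn ha hD0 ?_ ?_ hDP hn'P ?_
      ?_ ?_ X Y hY
  · intro N
    rw [hfact, hd2]
    exact mul_dvd_mul_iff_left (by norm_num)
  · intro N
    rw [hfact, hd2]
    exact Int.mul_ediv_mul_of_pos _ _ (by norm_num)
  · intro h1 h2 N₀ h3
    rw [hb]
    exact twoAdic_mean_of_even hP2 h1 hr0 hD0 h2 hbo _ N₀ h3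
  · intro h1 h2 h3 h4
    have hor : r % 4 = 2 ∨ Odd D := by
      by_contra hno
      push Not at hno
      have h5 : 2 ∣ D := even_iff_two_dvd.1 (Nat.not_odd_iff_even.1 hno.2)
      have h6 : 2 ∣ r / 2 := by omega
      exact absurd (Nat.eq_one_of_dvd_coprimes h4 h5 h6) (by norm_num)
    rw [sieveDensity, if_pos ⟨h1, (haD h1).2 h2, h3, (hcopr hor).2 h4⟩, if_neg hdo,
      show d / 2 = D by omega]
    congr 2
    refine prod_congr rfl fun q hq => ?_
    have hq2 : q.Coprime 2 := odd_primeFactors hn'odd hq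
    congr 1
    rw [show r * d = (2 * 2) * (r / 2 * D) by rw [hD]; conv_lhs => rw [hrr]
                                              ring]
    exact propext (Nat.Coprime.dvd_mul_left (hq2.mul_right hq2))
  · intro h
    by_cases hor : r % 4 = 2 ∨ Odd D
    · rw [sieveDensity, if_neg]
      rintro ⟨h1, h2, h3, h4⟩
      exact h ⟨h1, (haD h1).1 h2, h3, (hcopr hor).1 h4⟩
    -- Here `4 ∣ r` and `4 ∣ d`, so 2 divides both `D` and `r / 2`. The odd-part conditions in
    -- `sieveDensity` do not see this; its factor at 2 is what vanishes.
    · push Not at hor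
      have hb0 : D.factorization 2 ≠ 0 := fun h => hor.2 (hbo.1 h)
      rw [sieveDensity, hb, twoAdicDensity, if_neg hr, if_neg hor.1,
        if_neg (show ¬ D.factorization 2 + 1 = 0 by omega),
        if_neg (show ¬ D.factorization 2 + 1 = 1 by omega)]
      simp

end

/-! ### The square-free sieve. -/

section

open Finset

theorem dvd_of_sq_dvd_sq_mul_of_squarefree {a b s : ℕ} (hb : b ≠ 0) (hs : Squarefree s)
    (h : a ^ 2 ∣ b ^ 2 * s) : a ∣ b := by
  have hs0 : s ≠ 0 := hs.ne_zero
  have hbs : b ^ 2 * s ≠ 0 := by positivity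
  have ha : a ≠ 0 := by
    rintro rfl
    rw [zero_pow two_ne_zero, zero_dvd_iff] at h
    exact hbs h
  rw [← Nat.factorization_le_iff_dvd ha hb]
  intro p
  have h1 := (Nat.factorization_le_iff_dvd (pow_ne_zero 2 ha) hbs).2 h p
  have h2 := hs.natFactorization_le_one p
  rw [Nat.factorization_mul (pow_ne_zero 2 hb) hs0] at h1
  simp only [Nat.factorization_pow, Finsupp.add_apply, Finsupp.smul_apply, smul_eq_mul] at h1
  omega

/-- Writing `N = b² s` with `s` square-free, `a² ∣ N` means `a ∣ b`, so the sum is that of `μ` over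
the divisors of `b`; `hL` ensures that none is cut off. -/
theorem sum_moebius_sq_dvd {N L : ℕ} (hN : N ≠ 0) (hL : N < (L + 1) ^ 2) :
    ∑ a ∈ (Icc 1 L).filter (fun a => a ^ 2 ∣ N), ArithmeticFunction.moebius a =
      if Squarefree N then 1 else 0 := by
  obtain ⟨s, b, rfl, hs⟩ := Nat.sq_mul_squarefree N
  have hb : b ≠ 0 := by rintro rfl; simp at hN
  have hset : (Icc 1 L).filter (fun a => a ^ 2 ∣ b ^ 2 * s) = b.divisors := by
    ext a
    rw [mem_filter, mem_Icc, Nat.mem_divisors]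
    constructor
    · rintro ⟨-, h⟩
      exact ⟨dvd_of_sq_dvd_sq_mul_of_squarefree hb hs h, hb⟩
    · rintro ⟨h, -⟩
      have h1 : a ^ 2 ∣ b ^ 2 * s := (pow_dvd_pow_of_dvd h 2).mul_right s
      refine ⟨⟨Nat.pos_of_dvd_of_pos h (Nat.pos_of_ne_zero hb), ?_⟩, h1⟩
      have h2 : a ^ 2 < (L + 1) ^ 2 := (Nat.le_of_dvd (Nat.pos_of_ne_zero hN) h1).trans_lt hL
      have := lt_of_pow_lt_pow_left₀ 2 (by positivity) h2
      omega
  rw [hset, ← ArithmeticFunction.coe_mul_zeta_apply, ArithmeticFunction.moebius_mul_coe_zeta,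
    ArithmeticFunction.one_apply]
  refine if_congr ⟨?_, ?_⟩ rfl rfl
  · rintro rfl
    simpa using hs
  · intro h
    have := h b ⟨s, by ring⟩
    simpa using this

theorem card_multiples_le {m : ℕ} (hm : 0 < m) (X Y : ℝ) (hY : 0 ≤ Y) :
    (#((Icc ⌈X⌉ ⌊X + Y⌋).filter (fun N : ℤ => (m : ℤ) ∣ N)) : ℝ) ≤ Y / m + 1 := by
  have hm0 : (0 : ℝ) < m := by exact_mod_cast hm
  have h1 : #((Icc ⌈X⌉ ⌊X + Y⌋).filter (fun N : ℤ => (m : ℤ) ∣ N)) ≤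
      #(Icc ⌈X / m⌉ ⌊(X + Y) / m⌋) := by
    refine card_le_card_of_injOn (fun N => N / (m : ℤ)) ?_ ?_
    · intro N hN
      simp only [coe_filter, mem_Icc, Set.mem_ofPred_eq] at hN
      obtain ⟨⟨h1, h2⟩, k, rfl⟩ := hN
      simp only [coe_Icc, Set.mem_Icc]
      rw [Int.mul_ediv_cancel_left _ (by exact_mod_cast hm.ne')]
      rw [Int.ceil_le] at h1 ⊢
      rw [Int.le_floor] at h2 ⊢
      push_cast at h1 h2
      exact ⟨by rw [div_le_iff₀ hm0]; linarith, by rw [le_div_iff₀ hm0]; linarith⟩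
    · intro N hN N' hN' h
      simp only [coe_filter, Set.mem_ofPred_eq] at hN hN'
      exact (Int.ediv_left_inj hN.2 hN'.2).1 h
  have h2 : (#(Icc ⌈X / m⌉ ⌊(X + Y) / m⌋) : ℝ) ≤ Y / m + 1 := by
    rw [Int.card_Icc]
    have h3 : ((⌊(X + Y) / m⌋ + 1 - ⌈X / m⌉ : ℤ) : ℝ) ≤ Y / m + 1 := by
      push_cast
      have := Int.floor_le ((X + Y) / m)
      have := Int.le_ceil (X / m)
      rw [add_div] at *
      linarith
    have h4 : (0 : ℝ) ≤ Y / m + 1 := by positivity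
    rcases le_total 0 (⌊(X + Y) / m⌋ + 1 - ⌈X / m⌉) with h | h
    · have : (((⌊(X + Y) / m⌋ + 1 - ⌈X / m⌉).toNat : ℤ) : ℝ) ≤ Y / m + 1 := by
        rw [Int.toNat_of_nonneg h]; exact h3
      exact_mod_cast this
    · rw [Int.toNat_eq_zero.2 h]; simpa using h4
  exact (by exact_mod_cast h1 : (_ : ℝ) ≤ _).trans h2

theorem abs_kroneckerSymbol_le (a : ℤ) (n : ℕ) : |kroneckerSymbol a n| ≤ 1 := by
  have h1 : |ZMod.χ₈ (a : ZMod 8)| ≤ 1 := by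
    generalize (a : ZMod 8) = x
    revert x; decide
  have h2 : |jacobiSym a (n / 2 ^ n.factorization 2)| ≤ 1 := by
    rcases jacobiSym.trichotomy a (n / 2 ^ n.factorization 2) with h | h | h <;> rw [h] <;> simp
  rw [kroneckerSymbol, abs_mul, abs_pow]
  exact mul_le_one₀ (pow_le_one₀ (abs_nonneg _) h1) (abs_nonneg _) h2

theorem abs_sieveTerm_le (P r d n : ℕ) (N : ℤ) : |sieveTerm P r d n N| ≤ 1 := by
  rw [sieveTerm]
  split_ifs
  · rw [abs_mul]
    exact mul_le_one₀ (abs_kroneckerSymbol_le _ _) (abs_nonneg _) (abs_kroneckerSymbol_le _ _)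
  · simp

theorem abs_sum_sieveTerm_filter_le (P r d n : ℕ) {m : ℕ} (hm : 0 < m) (X Y : ℝ) (hY : 0 ≤ Y) :
    |((∑ N ∈ (Icc ⌈X⌉ ⌊X + Y⌋).filter (fun N : ℤ => (m : ℤ) ∣ N), sieveTerm P r d n N : ℤ) : ℝ)| ≤
      Y / m + 1 := by
  refine le_trans ?_ (card_multiples_le hm X Y hY)
  rw [← Int.cast_abs]
  have : |∑ N ∈ (Icc ⌈X⌉ ⌊X + Y⌋).filter (fun N : ℤ => (m : ℤ) ∣ N), sieveTerm P r d n N| ≤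
      (#((Icc ⌈X⌉ ⌊X + Y⌋).filter (fun N : ℤ => (m : ℤ) ∣ N)) : ℤ) := by
    refine (abs_sum_le_sum_abs _ _).trans ((sum_le_card_nsmul _ _ 1 fun N _ =>
      abs_sieveTerm_le P r d n N).trans ?_)
    simp
  exact_mod_cast this

theorem twistedSum_eq_sum_sieveTerm (P : ℕ) (hP : P.Prime) (X Y : ℝ) (n d r : ℕ) :
    twistedSum P X Y n d r = ∑ N ∈ (Icc ⌈X⌉ ⌊X + Y⌋).filter (fun N : ℤ => ¬ (P : ℤ) ∣ N),
      (if Squarefree N.natAbs then 1 else 0) * sieveTerm P r d n N := by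
  classical
  have hgcd : ∀ N : ℤ, Int.gcd (P : ℤ) N = 1 ↔ ¬ (P : ℤ) ∣ N := by
    intro N
    rw [← Int.isCoprime_iff_gcd_eq_one,
      (Nat.prime_iff_prime_int.1 hP).coprime_iff_not_dvd]
  rw [twistedSum, sum_filter, sum_filter]
  refine sum_congr rfl fun N _ => ?_
  rw [admissibleLevels, Set.mem_ofPred_eq, hgcd, sieveTerm, ← Int.squarefree_natAbs]
  by_cases h1 : Squarefree N.natAbs
  · have h4 : ¬ (4 : ℤ) ∣ N := by
      intro h4
      have h5 : 2 * 2 ∣ N.natAbs := by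
        simpa using Int.natAbs_dvd_natAbs.2 h4
      simpa using h1 2 h5
    by_cases h2 : (P : ℤ) ∣ N
    · simp [h2]
    · simp [h1, h2, h4]
  · simp [h1]

theorem abs_twistedSum_le (P : ℕ) (X Y : ℝ) (hY : 0 ≤ Y) (n d r : ℕ) :
    |(twistedSum P X Y n d r : ℝ)| ≤ Y + 1 := by
  classical
  have h1 : |twistedSum P X Y n d r| ≤ (#(Icc ⌈X⌉ ⌊X + Y⌋) : ℤ) := by
    rw [twistedSum]
    refine (abs_sum_le_sum_abs _ _).trans ((sum_le_card_nsmul _ _ 1 fun N _ => ?_).trans ?_)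
    · rw [abs_mul]
      exact mul_le_one₀ (abs_kroneckerSymbol_le _ _) (abs_nonneg _) (abs_kroneckerSymbol_le _ _)
    · rw [nsmul_one]
      exact_mod_cast card_le_card (filter_subset _ _)
  have h2 := card_multiples_le one_pos X Y hY
  simp only [Nat.cast_one, one_dvd, filter_true, div_one] at h2
  refine le_trans ?_ h2
  rw [← Int.cast_abs]
  exact_mod_cast h1

/-- `P ∣ d` gives `P ∣ r² N`, contrary to `P ∤ r` and `P ∤ N`. -/
theorem twistedSum_eq_zero {P : ℕ} (hP : P.Prime) (X Y : ℝ) {n d r : ℕ} (hPd : P ∣ d)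
    (hPr : ¬ P ∣ r) : twistedSum P X Y n d r = 0 := by
  classical
  rw [twistedSum]
  refine sum_eq_zero fun N hN => absurd (mem_filter.1 hN).2 ?_
  rintro ⟨-, h1, h2, -⟩
  have hPp := Nat.prime_iff_prime_int.1 hP
  rw [← Int.isCoprime_iff_gcd_eq_one, hPp.coprime_iff_not_dvd] at h1
  have h3 : (P : ℤ) ∣ (r : ℤ) ^ 2 * N := by
    have h4 : (P : ℤ) ∣ (d : ℤ) ^ 2 := dvd_pow (by exact_mod_cast hPd) two_ne_zero
    have h5 : (P : ℤ) ∣ 4 * (P : ℤ) ^ 2 := (dvd_pow_self _ two_ne_zero).mul_left _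
    have := dvd_add (h4.trans h2) h5
    rwa [sub_add_cancel] at this
  rcases hPp.dvd_or_dvd h3 with h | h
  · exact hPr (by exact_mod_cast hPp.dvd_of_dvd_pow h)
  · exact h1 h

theorem sum_Ioc_one_div_sq_le {A L : ℕ} (hA : 0 < A) (h : A ≤ L) :
    ∑ a ∈ Ioc A L, 1 / (a : ℝ) ^ 2 ≤ 1 / (A : ℝ) - 1 / (L : ℝ) := by
  induction L, h using Nat.le_induction with
  | base => simp
  | succ L h ih =>
    have hL : (0 : ℝ) < L := by exact_mod_cast (hA.trans_le h)
    rw [sum_Ioc_succ_top (by omega)]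
    have : 1 / ((L + 1 : ℕ) : ℝ) ^ 2 ≤ 1 / L - 1 / ((L + 1 : ℕ) : ℝ) := by
      push_cast
      rw [div_sub_div _ _ hL.ne' (by positivity), div_le_div_iff₀ (by positivity) (by positivity)]
      nlinarith
    linarith

/-- The twisted sum is its expected main term, the square-free sieve being cut at `A`. -/
theorem abs_twistedSum_sub_le {P r d n : ℕ} (hP : P.Prime) (hP2 : Odd P) (hd : 0 < d) (hn : n ≠ 0)
    (hPd : ¬ P ∣ d) (hPn : ¬ P ∣ n) {X Y : ℝ} (hX : 0 < X) (hY : 0 ≤ Y) {A : ℕ} (hA : 0 < A) :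
    |(twistedSum P X Y n d r : ℝ) -
        Y * ∑ a ∈ Icc 1 A, (ArithmeticFunction.moebius a : ℝ) * sieveDensity r a d n| ≤
      A * completionError n + Y / A + √(X + Y) + (Y / P + 1) := by
  set I := Icc ⌈X⌉ ⌊X + Y⌋ with hI
  -- At level `L` the sieve identity is exact for every `N` in the interval; taking the maximum with
  -- `A` lets the sum be split at `A`.
  set L := max A (Nat.sqrt ⌊X + Y⌋₊) with hL
  have hAL : A ≤ L := le_max_left _ _
  have hsq : ∀ N ∈ I, (if Squarefree N.natAbs then (1 : ℤ) else 0) =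
      ∑ a ∈ Icc 1 L, if ((a ^ 2 : ℕ) : ℤ) ∣ N then ArithmeticFunction.moebius a else 0 := by
    intro N hN
    rw [hI, mem_Icc, Int.ceil_le, Int.le_floor] at hN
    have hN0 : 0 < N := by
      have : (0 : ℝ) < N := hX.trans_le hN.1
      exact_mod_cast this
    obtain ⟨k, rfl⟩ := Int.eq_ofNat_of_zero_le hN0.le
    simp only [Int.natAbs_natCast, Int.cast_natCast] at hN ⊢
    have hk : k ≠ 0 := by rintro rfl; simp at hN0
    rw [← sum_moebius_sq_dvd (L := L) hk, sum_filter]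
    · simp only [Int.natCast_dvd_natCast]
    · have h1 : k ≤ ⌊X + Y⌋₊ := Nat.le_floor hN.2
      have h2 := Nat.lt_succ_sqrt ⌊X + Y⌋₊
      have h3 : Nat.sqrt ⌊X + Y⌋₊ ≤ L := le_max_right _ _
      calc k ≤ ⌊X + Y⌋₊ := h1
        _ < (Nat.sqrt ⌊X + Y⌋₊ + 1) * (Nat.sqrt ⌊X + Y⌋₊ + 1) := h2
        _ ≤ (L + 1) * (L + 1) := Nat.mul_le_mul (by omega) (by omega)
        _ = (L + 1) ^ 2 := by ring
  have hmain : twistedSum P X Y n d r =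
      ∑ a ∈ Icc 1 L, ArithmeticFunction.moebius a *
        ∑ N ∈ I.filter (fun N : ℤ => ((a ^ 2 : ℕ) : ℤ) ∣ N), sieveTerm P r d n N -
      ∑ N ∈ I.filter (fun N : ℤ => (P : ℤ) ∣ N),
        (if Squarefree N.natAbs then 1 else 0) * sieveTerm P r d n N := by
    rw [twistedSum_eq_sum_sieveTerm P hP, eq_sub_iff_add_eq, add_comm,
      sum_filter_add_sum_filter_not]
    rw [sum_congr rfl fun N hN => by rw [hsq N hN, sum_mul], sum_comm]
    refine sum_congr rfl fun a _ => ?_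
    rw [sum_filter, mul_sum]
    refine sum_congr rfl fun N _ => ?_
    split_ifs <;> simp
  have hPbound : |((∑ N ∈ I.filter (fun N : ℤ => (P : ℤ) ∣ N),
        (if Squarefree N.natAbs then 1 else 0) * sieveTerm P r d n N : ℤ) : ℝ)| ≤ Y / P + 1 := by
    refine le_trans ?_ (card_multiples_le hP.pos X Y hY)
    rw [← Int.cast_abs]
    have : |∑ N ∈ I.filter (fun N : ℤ => (P : ℤ) ∣ N),
        (if Squarefree N.natAbs then 1 else 0) * sieveTerm P r d n N| ≤
        (#(I.filter (fun N : ℤ => (P : ℤ) ∣ N)) : ℤ) := by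
      refine (abs_sum_le_sum_abs _ _).trans ((sum_le_card_nsmul _ _ 1 fun N _ => ?_).trans ?_)
      · have := abs_sieveTerm_le P r d n N
        split_ifs <;> simp [this]
      · simp
    exact_mod_cast this
  have hmu : ∀ a : ℕ, |(ArithmeticFunction.moebius a : ℝ)| ≤ 1 := fun a => by
    rw [← Int.cast_abs]
    exact_mod_cast ArithmeticFunction.abs_moebius_le_one
  have hsplit : Icc 1 L = Icc 1 A ∪ Ioc A L := by
    ext x; simp only [mem_union, mem_Icc, mem_Ioc]; omega
  have hdisj : Disjoint (Icc 1 A) (Ioc A L) := by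
    rw [disjoint_left]; intro x; simp only [mem_Icc, mem_Ioc]; omega
  rw [hmain, hsplit, sum_union hdisj]
  set S : ℕ → ℤ := fun a =>
    ∑ N ∈ I.filter (fun N : ℤ => ((a ^ 2 : ℕ) : ℤ) ∣ N), sieveTerm P r d n N with hS
  have h1 : |((∑ a ∈ Icc 1 A, ArithmeticFunction.moebius a * S a : ℤ) : ℝ) -
      Y * ∑ a ∈ Icc 1 A, (ArithmeticFunction.moebius a : ℝ) * sieveDensity r a d n| ≤
      A * completionError n := by
    push_cast
    rw [mul_sum, ← sum_sub_distrib]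
    refine (abs_sum_le_sum_abs _ _).trans ((sum_le_card_nsmul _ _ (completionError n)
      fun a ha => ?_).trans ?_)
    · rw [show (ArithmeticFunction.moebius a : ℝ) * (S a : ℝ) -
        Y * ((ArithmeticFunction.moebius a : ℝ) * sieveDensity r a d n) =
        (ArithmeticFunction.moebius a : ℝ) * ((S a : ℝ) - Y * sieveDensity r a d n) by ring,
        abs_mul]
      have h2 : |(S a : ℝ) - Y * sieveDensity r a d n| ≤ completionError n := by
        have := abs_sum_sieveTerm_sub_le (r := r) hP hP2 hd hn (mem_Icc.1 ha).1 hPd hPn X Y hY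
        simpa [hS, hI] using this
      calc _ ≤ 1 * completionError n := by
            gcongr
            exact hmu a
        _ = _ := one_mul _
    · simp
  -- Beyond the cut only the trivial count `Y / a² + 1` of multiples is used. The ones add up to at
  -- most `√(X + Y)`, as there are at most that many such `a`.
  have h2 : |((∑ a ∈ Ioc A L, ArithmeticFunction.moebius a * S a : ℤ) : ℝ)| ≤
      Y / A + √(X + Y) := by
    push_cast
    have h3 : ∀ a ∈ Ioc A L, |(ArithmeticFunction.moebius a : ℝ) * (S a : ℝ)| ≤
        Y * (1 / (a : ℝ) ^ 2) + 1 := by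
      intro a ha
      have ha0 : 0 < a := by rw [mem_Ioc] at ha; omega
      have := abs_sum_sieveTerm_filter_le P r d n (m := a ^ 2) (by positivity) X Y hY
      rw [abs_mul]
      calc _ ≤ 1 * (Y / ((a ^ 2 : ℕ) : ℝ) + 1) := by
            gcongr
            exact hmu a
        _ = _ := by push_cast; ring
    refine (abs_sum_le_sum_abs _ _).trans ((sum_le_sum h3).trans ?_)
    rw [sum_add_distrib, ← mul_sum]
    have h4 := sum_Ioc_one_div_sq_le hA hAL
    have h5 : ((1 : ℝ) / L) ≥ 0 := by positivity
    have h6 : Y * ∑ a ∈ Ioc A L, 1 / (a : ℝ) ^ 2 ≤ Y / A := by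
      rw [div_eq_mul_one_div Y]
      exact mul_le_mul_of_nonneg_left (by linarith) hY
    have h7 : ∑ a ∈ Ioc A L, (1 : ℝ) ≤ √(X + Y) := by
      rw [sum_const, Nat.card_Ioc, nsmul_eq_mul, mul_one]
      have h8 : L - A ≤ Nat.sqrt ⌊X + Y⌋₊ := by omega
      calc ((L - A : ℕ) : ℝ) ≤ (Nat.sqrt ⌊X + Y⌋₊ : ℝ) := by exact_mod_cast h8
        _ ≤ √(⌊X + Y⌋₊ : ℝ) := Real.nat_sqrt_le_real_sqrt
        _ ≤ √(X + Y) := Real.sqrt_le_sqrt (Nat.floor_le (by linarith))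
    linarith
  rw [Int.cast_sub, Int.cast_add]
  rw [abs_le] at h1 h2 hPbound ⊢
  constructor <;> linarith [h1.1, h1.2, h2.1, h2.2, hPbound.1, hPbound.2]

end

/-! ### Euler products in three variables. -/

section

open Finset

/-- The multiplicative function of three positive integers with local values `c p i j l`,
extended by zero. -/
noncomputable def tripleWeight (c : ℕ → ℕ → ℕ → ℕ → ℝ) (x : ℕ × ℕ × ℕ) : ℝ :=
  if x.1 * x.2.1 * x.2.2 = 0 then 0 else
    ∏ p ∈ (x.1 * x.2.1 * x.2.2).primeFactors,
      c p (x.1.factorization p) (x.2.1.factorization p) (x.2.2.factorization p)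

section TripleEuler

variable {c : ℕ → ℕ → ℕ → ℕ → ℝ}

theorem tripleWeight_eq_prod (hc : ∀ p, c p 0 0 0 = 1) {s : Finset ℕ} {a d n : ℕ}
    (ha : a ∈ Nat.factoredNumbers s) (hd : d ∈ Nat.factoredNumbers s)
    (hn : n ∈ Nat.factoredNumbers s) :
    tripleWeight c (a, d, n) =
      ∏ p ∈ s, c p (a.factorization p) (d.factorization p) (n.factorization p) := by
  have hm := Nat.mul_mem_factoredNumbers (Nat.mul_mem_factoredNumbers ha hd) hn
  rw [tripleWeight, if_neg hm.1]
  refine prod_subset (Nat.primeFactors_subset_of_mem_factoredNumbers hm) fun p _ hp => ?_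
  have key : ∀ m : ℕ, m ∣ a * d * n → m.factorization p = 0 := by
    intro m h
    rw [Nat.factorization_eq_zero_iff]
    by_contra! hno
    exact hp (Nat.mem_primeFactors.2 ⟨hno.1, hno.2.1.trans h, hm.1⟩)
  rw [key a ⟨d * n, by ring⟩, key d ⟨a * n, by ring⟩, key n ⟨a * d, by ring⟩, hc]

theorem factorization_pow_mul_self {s : Finset ℕ} {p : ℕ} (hp : p.Prime) (hps : p ∉ s) (e : ℕ)
    {m : ℕ} (hm : m ∈ Nat.factoredNumbers s) : (p ^ e * m).factorization p = e := by
  have hpm : ¬ p ∣ m := fun h => hps (Nat.mem_factoredNumbers'.1 hm p hp h)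
  rw [Nat.factorization_mul (pow_ne_zero e hp.ne_zero) hm.1, Finsupp.add_apply,
    Nat.factorization_pow_self hp, Nat.factorization_eq_zero_of_not_dvd hpm, add_zero]

theorem factorization_pow_mul_of_ne {p q : ℕ} (hp : p.Prime) (hq : q ≠ p) (e : ℕ)
    {m : ℕ} (hm : m ≠ 0) : (p ^ e * m).factorization q = m.factorization q := by
  rw [Nat.factorization_mul (pow_ne_zero e hp.ne_zero) hm, Finsupp.add_apply, hp.factorization_pow,
    Finsupp.single_eq_of_ne hq, zero_add]

theorem tripleWeight_pow_mul (hc : ∀ p, c p 0 0 0 = 1) {s : Finset ℕ} {p : ℕ} (hp : p.Prime)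
    (hps : p ∉ s) (i j l : ℕ) {a d n : ℕ} (ha : a ∈ Nat.factoredNumbers s)
    (hd : d ∈ Nat.factoredNumbers s) (hn : n ∈ Nat.factoredNumbers s) :
    tripleWeight c (p ^ i * a, p ^ j * d, p ^ l * n) = c p i j l * tripleWeight c (a, d, n) := by
  rw [tripleWeight_eq_prod hc (Nat.pow_mul_mem_factoredNumbers hp i ha)
    (Nat.pow_mul_mem_factoredNumbers hp j hd) (Nat.pow_mul_mem_factoredNumbers hp l hn),
    tripleWeight_eq_prod hc ha hd hn, prod_insert hps, factorization_pow_mul_self hp hps i ha,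
    factorization_pow_mul_self hp hps j hd, factorization_pow_mul_self hp hps l hn]
  congr 1
  refine prod_congr rfl fun q hq => ?_
  have hne : q ≠ p := fun h => hps (h ▸ hq)
  rw [factorization_pow_mul_of_ne hp hne i ha.1, factorization_pow_mul_of_ne hp hne j hd.1,
    factorization_pow_mul_of_ne hp hne l hn.1]

theorem tripleWeight_one (hc : ∀ p, c p 0 0 0 = 1) : tripleWeight c (1, 1, 1) = 1 := by
  have h1 : 1 ∈ Nat.factoredNumbers ∅ := by simp [Nat.factoredNumbers_empty]
  rw [tripleWeight_eq_prod hc h1 h1 h1, prod_empty]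

theorem summable_local (hc : ∀ p, c p 0 0 0 = 1) (hs : Summable (tripleWeight c)) {p : ℕ}
    (hp : p.Prime) : Summable fun x : ℕ × ℕ × ℕ => c p x.1 x.2.1 x.2.2 := by
  have hinj : Function.Injective
      (fun x : ℕ × ℕ × ℕ => ((p ^ x.1, p ^ x.2.1, p ^ x.2.2) : ℕ × ℕ × ℕ)) := by
    have h := Nat.pow_right_injective hp.two_le
    rintro ⟨i, j, l⟩ ⟨i', j', l'⟩ hx
    simp only [Prod.mk.injEq] at hx ⊢
    exact ⟨h hx.1, h hx.2.1, h hx.2.2⟩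
  refine (hs.comp_injective hinj).congr fun x => ?_
  have h1 : 1 ∈ Nat.factoredNumbers ∅ := by simp [Nat.factoredNumbers_empty]
  have := tripleWeight_pow_mul hc hp (notMem_empty p) x.1 x.2.1 x.2.2 h1 h1 h1
  simp only [mul_one, tripleWeight_one hc] at this
  exact this

/-- The triples of `insert p s`-factored numbers, split into their exponents at `p` and their
`s`-factored parts. -/
noncomputable def tripleEquiv {s : Finset ℕ} {p : ℕ} (hp : p.Prime) (hps : p ∉ s) :
    (ℕ × ℕ × ℕ) × (Nat.factoredNumbers s × Nat.factoredNumbers s × Nat.factoredNumbers s) ≃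
      Nat.factoredNumbers (insert p s) × Nat.factoredNumbers (insert p s) ×
        Nat.factoredNumbers (insert p s) :=
  Equiv.trans
    { toFun := fun x => ((x.1.1, x.2.1), (x.1.2.1, x.2.2.1), (x.1.2.2, x.2.2.2))
      invFun := fun y => ((y.1.1, y.2.1.1, y.2.2.1), (y.1.2, y.2.1.2, y.2.2.2))
      left_inv := fun _ => rfl
      right_inv := fun _ => rfl }
    ((Nat.equivProdNatFactoredNumbers hp hps).prodCongr
      ((Nat.equivProdNatFactoredNumbers hp hps).prodCongr
        (Nat.equivProdNatFactoredNumbers hp hps)))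

theorem hasSum_mul_prod {ι κ : Type*} {f : ι → ℝ} {g : κ → ℝ} {a b : ℝ} (hf : HasSum f a)
    (hg : HasSum g b) : HasSum (fun x : ι × κ => f x.1 * g x.2) (a * b) :=
  hf.mul hg (summable_mul_of_summable_norm (f := f) (g := g) hf.summable.norm hg.summable.norm)

/-- Adjoining a prime `p` splits each triple uniquely into its exponents at `p` and a triple free of
`p`, and the weight factors accordingly. -/
theorem hasSum_tripleWeight_factoredNumbers (hc : ∀ p, c p 0 0 0 = 1)
    (hs : Summable (tripleWeight c)) (s : Finset ℕ) (hsp : ∀ p ∈ s, p.Prime) :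
    HasSum (fun x : Nat.factoredNumbers s × Nat.factoredNumbers s × Nat.factoredNumbers s =>
      tripleWeight c (x.1, x.2.1, x.2.2)) (∏ p ∈ s, ∑' x : ℕ × ℕ × ℕ, c p x.1 x.2.1 x.2.2) := by
  induction s using Finset.induction with
  | empty =>
    have huniq : ∀ x : Nat.factoredNumbers ∅, (x : ℕ) = 1 := fun x => by
      obtain ⟨y, hy⟩ := x
      rwa [Nat.factoredNumbers_empty, Set.mem_singleton_iff] at hy
    have h1 : 1 ∈ Nat.factoredNumbers ∅ := by simp [Nat.factoredNumbers_empty]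
    rw [prod_empty]
    convert hasSum_single (f := fun x : Nat.factoredNumbers ∅ × Nat.factoredNumbers ∅ ×
      Nat.factoredNumbers ∅ => tripleWeight c (x.1, x.2.1, x.2.2)) (⟨1, h1⟩, ⟨1, h1⟩, ⟨1, h1⟩) ?_
    · exact (tripleWeight_one hc).symm
    · rintro ⟨x, y, z⟩ h
      exact absurd (by simp only [Prod.mk.injEq, Subtype.ext_iff, huniq, and_self]) h
  | insert p s hps ih =>
    have hp := hsp p (mem_insert_self p s)
    have ih := ih fun q hq => hsp q (mem_insert_of_mem hq)
    have hl := summable_local hc hs hp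
    rw [prod_insert hps, ← (tripleEquiv hp hps).hasSum_iff]
    have hmul := hasSum_mul_prod hl.hasSum ih
    convert hmul using 1
    funext x
    obtain ⟨⟨i, j, l⟩, a, d, n⟩ := x
    exact tripleWeight_pow_mul hc hp hps i j l a.2 d.2 n.2

/-- The Euler product of an absolutely summable multiplicative function of three variables. -/
theorem tendsto_prod_tsum_local (hc : ∀ p, c p 0 0 0 = 1) (hs : Summable (tripleWeight c)) :
    Filter.Tendsto (fun N : ℕ => ∏ p ∈ N.primesBelow, ∑' x : ℕ × ℕ × ℕ, c p x.1 x.2.1 x.2.2)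
      Filter.atTop (nhds (∑' x, tripleWeight c x)) := by
  classical
  set S : ℕ → Set (ℕ × ℕ × ℕ) := fun N => {x | x.1 ∈ Nat.factoredNumbers N.primesBelow ∧
    x.2.1 ∈ Nat.factoredNumbers N.primesBelow ∧ x.2.2 ∈ Nat.factoredNumbers N.primesBelow} with hS
  have h1 : ∀ N : ℕ, ∏ p ∈ N.primesBelow, ∑' x : ℕ × ℕ × ℕ, c p x.1 x.2.1 x.2.2 =
      ∑' x, (S N).indicator (tripleWeight c) x := by
    intro N
    rw [← _root_.tsum_subtype, ← (hasSum_tripleWeight_factoredNumbers hc hs N.primesBelow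
      fun p hp => Nat.prime_of_mem_primesBelow hp).tsum_eq]
    let e : (Nat.factoredNumbers N.primesBelow × Nat.factoredNumbers N.primesBelow ×
        Nat.factoredNumbers N.primesBelow) ≃ S N :=
      { toFun := fun x => ⟨(x.1, x.2.1, x.2.2), x.1.2, x.2.1.2, x.2.2.2⟩
        invFun := fun y => (⟨y.1.1, y.2.1⟩, ⟨y.1.2.1, y.2.2.1⟩, ⟨y.1.2.2, y.2.2.2⟩)
        left_inv := fun _ => rfl
        right_inv := fun _ => rfl }
    exact e.tsum_eq (fun y : S N => tripleWeight c y)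
  simp only [h1]
  -- A triple with nonzero product is eventually factored over the primes below `N`; the other
  -- triples have weight zero.
  refine tendsto_tsum_of_dominated_convergence hs.norm (fun x => ?_)
    (Filter.Eventually.of_forall fun N x => ?_)
  · by_cases hx : x.1 * x.2.1 * x.2.2 = 0
    · have h0 : tripleWeight c x = 0 := by rw [tripleWeight, if_pos hx]
      have : ∀ N, (S N).indicator (tripleWeight c) x = 0 := fun N => by
        rw [Set.indicator_apply, h0, ite_self]
      simp only [this, h0]
      exact tendsto_const_nhds
    · refine tendsto_const_nhds.congr' ?_
      filter_upwards [Filter.eventually_gt_atTop (x.1 * x.2.1 * x.2.2)] with N hN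
      have key : ∀ m : ℕ, m ∣ x.1 * x.2.1 * x.2.2 → m ∈ Nat.factoredNumbers N.primesBelow := by
        intro m h
        rw [Nat.mem_factoredNumbers']
        intro p hp hpm
        exact Nat.mem_primesBelow.2
          ⟨(Nat.le_of_dvd (Nat.pos_of_ne_zero hx) (hpm.trans h)).trans_lt hN, hp⟩
      rw [Set.indicator_of_mem]
      exact ⟨key _ ⟨x.2.1 * x.2.2, by ring⟩, key _ ⟨x.1 * x.2.2, by ring⟩,
        key _ ⟨x.1 * x.2.1, by ring⟩⟩
  · exact norm_indicator_le_norm_self _ _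

end TripleEuler

end

/-! ### The main term as a multiplicative function. -/

section

open Finset

/-- The local factors, normalised to be `1` at the origin, of the expected main term: `i`, `j` and
`l` are the exponents of `p` in the sieving variable, in `d` and in `n`. -/
noncomputable def localWeight (r p i j l : ℕ) : ℝ :=
  if i = 0 then
    if p = 2 then 4 / 3 * ((if j = 0 then 1 else 4 * (1 / 8) ^ j) *
      (twoAdicDensity r j l * (1 / 2) ^ l))
    else if j ≠ 0 ∧ p ∣ r then 0
    else (1 / (p : ℝ) ^ 3) ^ j * (localMean p l (p ∣ r ∨ j ≠ 0) * (1 / (p : ℝ)) ^ l)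
  else if i = 1 ∧ j = 0 ∧ l = 0 ∧ p ≠ 2 then -(1 / (p : ℝ) ^ 2) else 0

theorem localWeight_zero (r p : ℕ) : localWeight r p 0 0 0 = 1 := by
  by_cases hp : p = 2
  · have : twoAdicDensity r 0 0 = 3 / 4 := by
      rw [twoAdicDensity]
      split_ifs <;> simp_all [parityValue]
    rw [localWeight, if_pos rfl, if_pos hp, this]
    norm_num
  · rw [localWeight, if_pos rfl, if_neg hp, if_neg (by simp)]
    simp [localMean]

theorem tripleWeight_eq_zero {c : ℕ → ℕ → ℕ → ℕ → ℝ} {a d n p : ℕ} (hp : p.Prime)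
    (hdvd : p ∣ a * d * n)
    (h : c p (a.factorization p) (d.factorization p) (n.factorization p) = 0) :
    tripleWeight c (a, d, n) = 0 := by
  rw [tripleWeight]
  split_ifs with h0
  · rfl
  · exact prod_eq_zero (Nat.mem_primeFactors.2 ⟨hp, hdvd, h0⟩) h

theorem factorization_ordCompl_two {n q : ℕ} (hq : q ≠ 2) :
    (n / 2 ^ n.factorization 2).factorization q = n.factorization q := by
  rw [Nat.factorization_ordCompl, Finsupp.erase_ne hq]

theorem prod_pow_factorization_eq_ordCompl {s : Finset ℕ} {n : ℕ} (hn : n ≠ 0)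
    (hs : n.primeFactors.erase 2 ⊆ s) (h2 : 2 ∉ s) :
    ∏ p ∈ s, (p : ℝ) ^ n.factorization p = ((n / 2 ^ n.factorization 2 : ℕ) : ℝ) := by
  have hn' : n / 2 ^ n.factorization 2 ≠ 0 := (Nat.ordCompl_pos 2 hn).ne'
  conv_rhs => rw [← Nat.prod_factorization_pow_eq_self hn']
  rw [Finsupp.prod, Nat.cast_prod, Nat.support_factorization]
  symm
  have hsub : (n / 2 ^ n.factorization 2).primeFactors ⊆ s := by
    refine Subset.trans (fun q hq => ?_) hs
    rw [Nat.mem_primeFactors] at hq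
    refine mem_erase.2 ⟨?_, Nat.mem_primeFactors.2 ⟨hq.1, hq.2.1.trans (Nat.ordCompl_dvd n 2), hn⟩⟩
    rintro rfl
    exact Nat.not_dvd_ordCompl Nat.prime_two hn hq.2.1
  rw [prod_congr rfl fun q hq => by
    rw [factorization_ordCompl_two (fun h => h2 (h ▸ hsub hq)), Nat.cast_pow]]
  refine prod_subset hsub fun q hq hqn => ?_
  have hq2 : q ≠ 2 := fun h => h2 (h ▸ hq)
  have : n.factorization q = 0 := by
    rw [← factorization_ordCompl_two hq2, ← Finsupp.notMem_support_iff, Nat.support_factorization]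
    exact hqn
  rw [this, pow_zero]

theorem localWeight_of_coprime {r a d n p : ℕ} (ha : a ≠ 0) (hd : d ≠ 0) (hn : n ≠ 0)
    (hsq : Squarefree a)
    (hp : p.Prime) (hp2 : p ≠ 2) (had : a.Coprime d)
    (han : a.Coprime (n / 2 ^ n.factorization 2)) (hdr : (d / 2 ^ d.factorization 2).Coprime r) :
    localWeight r p (a.factorization p) (d.factorization p) (n.factorization p) =
      (if p ∣ a then -(1 / (p : ℝ) ^ 2) else 1) * ((1 / ((p : ℝ) ^ d.factorization p)) ^ 3 *
        ((1 / (p : ℝ) ^ n.factorization p) *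
          localMean p (n.factorization p) (p ∣ r * d))) := by
  have hz : ∀ {m : ℕ}, m ≠ 0 → (m.factorization p = 0 ↔ ¬ p ∣ m) := fun hm => by
    rw [Nat.factorization_eq_zero_iff]; simp [hp, hm]
  by_cases hpa : p ∣ a
  · have h1 : a.factorization p = 1 := by
      have := hsq.natFactorization_le_one p
      have h0 := mt (hz ha).1 (not_not.2 hpa)
      omega
    have h2 : d.factorization p = 0 :=
      (hz hd).2 fun h => hp.one_lt.ne' (Nat.eq_one_of_dvd_coprimes had hpa h)
    have h3 : n.factorization p = 0 := by
      rw [← factorization_ordCompl_two hp2, hz (Nat.ordCompl_pos 2 hn).ne']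
      exact fun h => hp.one_lt.ne' (Nat.eq_one_of_dvd_coprimes han hpa h)
    rw [localWeight, h1, h2, h3, if_neg one_ne_zero, if_pos ⟨rfl, rfl, rfl, hp2⟩, if_pos hpa]
    simp [localMean]
  · have h1 := (hz ha).2 hpa
    rw [localWeight, h1, if_pos rfl, if_neg hp2, if_neg hpa, if_neg]
    · have h4 : (p ∣ r ∨ d.factorization p ≠ 0) = (p ∣ r * d) := by
        rw [hp.dvd_mul, Ne, hz hd, not_not]
      simp only [h4, one_div, inv_pow]
      ring
    · rintro ⟨h2, h3⟩
      rw [← factorization_ordCompl_two hp2, Ne, hz (Nat.ordCompl_pos 2 hd).ne', not_not] at h2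
      exact hp.one_lt.ne' (Nat.eq_one_of_dvd_coprimes hdr h2 h3)

theorem prod_ite_dvd_eq_moebius {s : Finset ℕ} {a : ℕ} (ha : Squarefree a)
    (hs : ∀ p ∈ s, p.Prime) (has : a.primeFactors ⊆ s) :
    ∏ p ∈ s, (if p ∣ a then -(1 / (p : ℝ) ^ 2) else 1) =
      (ArithmeticFunction.moebius a : ℝ) / (a : ℝ) ^ 2 := by
  have h1 : s.filter (fun p => p ∣ a) = a.primeFactors := by
    ext p
    rw [mem_filter]
    exact ⟨fun h => Nat.mem_primeFactors.2 ⟨hs p h.1, h.2, ha.ne_zero⟩,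
      fun h => ⟨has h, Nat.dvd_of_mem_primeFactors h⟩⟩
  rw [← prod_filter, h1]
  have h2 : (a : ℝ) = ∏ p ∈ a.primeFactors, (p : ℝ) := by
    conv_lhs => rw [← Nat.prod_primeFactors_of_squarefree ha]
    push_cast; rfl
  have h3 : (ArithmeticFunction.moebius a : ℝ) = ∏ p ∈ a.primeFactors, (-1 : ℝ) := by
    rw [ArithmeticFunction.moebius_apply_of_squarefree ha, prod_const,
      ← (ArithmeticFunction.cardDistinctFactors_eq_cardFactors_iff_squarefree ha.ne_zero).2 ha,
      ArithmeticFunction.cardDistinctFactors_apply, Nat.primeFactors, List.card_toFinset]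
    push_cast; rfl
  rw [h3, h2, ← prod_pow, ← prod_div_distrib]
  exact prod_congr rfl fun p _ => by ring

/-- The expected main term is, up to the density at `2`, a multiplicative function of three
variables. -/
theorem moebius_mul_sieveDensity_div (r : ℕ) {a d n : ℕ} (ha : a ≠ 0) (hd : d ≠ 0) (hn : n ≠ 0) :
    (ArithmeticFunction.moebius a : ℝ) * sieveDensity r a d n / ((n : ℝ) * d) =
      3 / 4 * tripleWeight (localWeight r) (a, d, n) := by
  have hz : ∀ {m p : ℕ}, p.Prime → m ≠ 0 → p ∣ m → m.factorization p ≠ 0 := fun hp hm h => by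
    rw [Ne, Nat.factorization_eq_zero_iff]; simp [hp, hm, h]
  have hd'0 := (Nat.ordCompl_pos 2 hd).ne'
  have hn'0 := (Nat.ordCompl_pos 2 hn).ne'
  by_cases hsq : Squarefree a
  swap
  · rw [ArithmeticFunction.moebius_eq_zero_of_not_squarefree hsq]
    rw [Nat.squarefree_iff_prime_squarefree] at hsq
    push Not at hsq
    obtain ⟨p, hp, hpa⟩ := hsq
    have h2 : 2 ≤ a.factorization p :=
      (hp.pow_dvd_iff_le_factorization ha).1 (by rwa [pow_two])
    rw [tripleWeight_eq_zero hp
      (((Dvd.intro _ rfl).trans hpa).mul_right d |>.mul_right n)]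
    · simp
    · rw [localWeight, if_neg (by omega), if_neg (by omega)]
  by_cases hcond : Odd a ∧ a.Coprime d ∧ a.Coprime (n / 2 ^ n.factorization 2) ∧
      (d / 2 ^ d.factorization 2).Coprime r
  swap
  · rw [sieveDensity, if_neg hcond, mul_zero, zero_div]
    symm
    refine mul_eq_zero_of_right _ ?_
    by_cases h1 : Odd a
    swap
    · have h2 : 2 ∣ a := even_iff_two_dvd.1 (Nat.not_odd_iff_even.1 h1)
      refine tripleWeight_eq_zero Nat.prime_two ((h2.mul_right d).mul_right n) ?_
      rw [localWeight, if_neg (hz Nat.prime_two ha h2), if_neg (by simp)]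
    by_cases h2 : a.Coprime d
    swap
    · obtain ⟨p, hp, hpa, hpd⟩ := exists_prime_dvd_of_not_coprime h2
      refine tripleWeight_eq_zero hp ((hpa.mul_right d).mul_right n) ?_
      rw [localWeight, if_neg (hz hp ha hpa), if_neg fun h => hz hp hd hpd h.2.1]
    by_cases h3 : a.Coprime (n / 2 ^ n.factorization 2)
    swap
    · obtain ⟨p, hp, hpa, hpn⟩ := exists_prime_dvd_of_not_coprime h3
      refine tripleWeight_eq_zero hp ((hpa.mul_right d).mul_right n) ?_
      rw [localWeight, if_neg (hz hp ha hpa),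
        if_neg fun h => hz hp hn (hpn.trans (Nat.ordCompl_dvd n 2)) h.2.2.1]
    have h4 : ¬ (d / 2 ^ d.factorization 2).Coprime r := fun h => hcond ⟨h1, h2, h3, h⟩
    obtain ⟨p, hp, hpd', hpr⟩ := exists_prime_dvd_of_not_coprime h4
    have hpd := hpd'.trans (Nat.ordCompl_dvd d 2)
    have hp2 : p ≠ 2 := by
      rintro rfl
      exact Nat.not_dvd_ordCompl Nat.prime_two hd hpd'
    refine tripleWeight_eq_zero hp ((hpd.mul_left a).mul_right n) ?_
    have hj := hz hp hd hpd
    rw [localWeight]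
    by_cases hi : a.factorization p = 0
    · rw [if_pos hi, if_neg hp2, if_pos ⟨hj, hpr⟩]
    · rw [if_neg hi, if_neg fun h => hj h.2.1]
  rw [sieveDensity, if_pos hcond]
  obtain ⟨hao, had, han, hdr⟩ := hcond
  set s := (insert 2 (a * d * n).primeFactors) with hs
  have hadn : a * d * n ≠ 0 := by positivity
  have hmem : ∀ m : ℕ, m ∣ a * d * n → m ∈ Nat.factoredNumbers s := fun m hm =>
    Nat.mem_factoredNumbers'.2 fun p hp hpm =>
      mem_insert_of_mem (Nat.mem_primeFactors.2 ⟨hp, hpm.trans hm, hadn⟩)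
  have h2s : 2 ∈ s := mem_insert_self _ _
  have hpf : ∀ m : ℕ, m ∣ a * d * n → m.primeFactors.erase 2 ⊆ s.erase 2 := fun m hm =>
    erase_subset_erase _ fun q hq => mem_insert_of_mem (Nat.primeFactors_mono hm hadn hq)
  have hprime : ∀ p ∈ s.erase 2, p.Prime := fun p hp => by
    rw [hs, mem_erase, mem_insert] at hp
    exact Nat.prime_of_mem_primeFactors (hp.2.resolve_left hp.1)
  have hda : a ∣ a * d * n := ⟨d * n, by ring⟩
  have hdd : d ∣ a * d * n := ⟨a * n, by ring⟩
  have hdn : n ∣ a * d * n := ⟨a * d, by ring⟩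
  have ha2 : a.factorization 2 = 0 :=
    Nat.factorization_eq_zero_of_not_dvd fun h =>
      Nat.not_even_iff_odd.2 hao (even_iff_two_dvd.2 h)
  rw [tripleWeight_eq_prod (localWeight_zero r) (hmem a hda) (hmem d hdd) (hmem n hdn),
    ← mul_prod_erase s _ h2s, prod_congr rfl fun p hp =>
      localWeight_of_coprime ha hd hn hsq (hprime p hp) (ne_of_mem_erase hp) had han hdr]
  simp only [prod_mul_distrib, prod_pow, one_div, prod_inv_distrib]
  rw [prod_pow_factorization_eq_ordCompl hd (hpf d hdd) (notMem_erase _ _),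
    prod_pow_factorization_eq_ordCompl hn (hpf n hdn) (notMem_erase _ _)]
  have hmu := prod_ite_dvd_eq_moebius hsq hprime
    (by
      rw [← erase_eq_of_notMem (s := a.primeFactors) (a := 2)]
      · exact hpf a hda
      · exact fun h => Nat.not_even_iff_odd.2 hao
          (even_iff_two_dvd.2 (Nat.dvd_of_mem_primeFactors h)))
  simp only [one_div] at hmu
  rw [hmu, ha2]
  have hsub : (n / 2 ^ n.factorization 2).primeFactors ⊆ s.erase 2 := fun q hq => by
    refine hpf n hdn (mem_erase.2 ⟨?_, Nat.primeFactors_mono (Nat.ordCompl_dvd n 2) hn hq⟩)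
    rintro rfl
    exact Nat.not_dvd_ordCompl Nat.prime_two hn (Nat.dvd_of_mem_primeFactors hq)
  have hmean : ∏ q ∈ (n / 2 ^ n.factorization 2).primeFactors,
      localMean q ((n / 2 ^ n.factorization 2).factorization q) (q ∣ r * d) =
      ∏ q ∈ s.erase 2, localMean q (n.factorization q) (q ∣ r * d) := by
    rw [prod_congr rfl fun q hq => by
      rw [factorization_ordCompl_two (ne_of_mem_erase (hsub hq))]]
    refine prod_subset hsub fun q hq hqn => ?_
    have : n.factorization q = 0 := by
      rw [← factorization_ordCompl_two (ne_of_mem_erase hq), ← Finsupp.notMem_support_iff,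
        Nat.support_factorization]
      exact hqn
    rw [localMean, if_pos this]
  rw [hmean, localWeight, if_pos rfl, if_pos rfl]
  generalize ∏ q ∈ s.erase 2, localMean q (n.factorization q) (q ∣ r * d) = M
  have hdeq : (d : ℝ) = 2 ^ d.factorization 2 * ((d / 2 ^ d.factorization 2 : ℕ) : ℝ) := by
    exact_mod_cast (Nat.ordProj_mul_ordCompl_eq_self d 2).symm
  have hneq : (n : ℝ) = 2 ^ n.factorization 2 * ((n / 2 ^ n.factorization 2 : ℕ) : ℝ) := by
    exact_mod_cast (Nat.ordProj_mul_ordCompl_eq_self n 2).symm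
  have hd'' : ((d / 2 ^ d.factorization 2 : ℕ) : ℝ) ≠ 0 := by exact_mod_cast hd'0
  have hn'' : ((n / 2 ^ n.factorization 2 : ℕ) : ℝ) ≠ 0 := by exact_mod_cast hn'0
  have ha'' : (a : ℝ) ≠ 0 := by exact_mod_cast ha
  -- The density has `1 / d²` for odd `d` but `4 / d²` for even `d`. With the weight `1 / d`, the
  -- prime 2 contributes `4 (1/8)^j` for `j > 0` and 1 for `j = 0`.
  have hDeq : (((if Odd d then d else d / 2 : ℕ) : ℝ)) ^ 2 * d =
      ((d / 2 ^ d.factorization 2 : ℕ) : ℝ) ^ 3 *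
        (if d.factorization 2 = 0 then 1 else 4 * (1 / 8) ^ d.factorization 2 : ℝ)⁻¹ := by
    have hiff : d.factorization 2 = 0 ↔ Odd d := by
      rw [Nat.factorization_eq_zero_iff, ← Nat.not_even_iff_odd, even_iff_two_dvd]
      simp [Nat.prime_two, hd]
    by_cases hdo : Odd d
    · rw [if_pos hdo, if_pos (hiff.2 hdo), hiff.2 hdo]
      simp; ring
    · rw [if_neg hdo, if_neg (mt hiff.1 hdo)]
      have h2 : 2 ∣ d := even_iff_two_dvd.1 (Nat.not_odd_iff_even.1 hdo)
      rw [Nat.cast_div h2 (by norm_num)]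
      generalize ((d / 2 ^ d.factorization 2 : ℕ) : ℝ) = u at hdeq
      rw [hdeq, mul_inv, one_div, inv_pow, inv_inv,
        show (8 : ℝ) = 2 ^ 3 by norm_num, ← pow_mul, mul_comm 3, pow_mul]
      push_cast
      ring
  have hif : (if d.factorization 2 = 0 then 1 else 4 * (1 / 8) ^ d.factorization 2 : ℝ) ≠ 0 := by
    split_ifs <;> positivity
  calc _ = (ArithmeticFunction.moebius a : ℝ) / (a : ℝ) ^ 2 *
        (twoAdicDensity r (d.factorization 2) (n.factorization 2) * M) /
        (((((if Odd d then d else d / 2 : ℕ) : ℝ)) ^ 2 * d) * n) := by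
        simp only [div_eq_mul_inv, mul_inv]; ring
    _ = _ := by
        rw [hDeq, hneq]
        generalize ((n / 2 ^ n.factorization 2 : ℕ) : ℝ) = v at *
        generalize ((d / 2 ^ d.factorization 2 : ℕ) : ℝ) = u at *
        simp only [one_div] at hif ⊢
        generalize (if d.factorization 2 = 0 then 1 else 4 * (8⁻¹) ^ d.factorization 2 : ℝ) = w
          at *
        simp only [div_eq_mul_inv, mul_inv, inv_inv, inv_pow]
        ring

end

/-! ### Absolute convergence of the main term. -/

section

open Finset

theorem abs_twoAdicDensity_le (r b e : ℕ) : |twoAdicDensity r b e| ≤ 1 := by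
  rw [twoAdicDensity]
  split_ifs <;> (try rw [parityValue]) <;> (try split_ifs) <;> rw [abs_le] <;> norm_num

/-- A bound for the product of the local means over the odd primes dividing `n`. -/
noncomputable def oddExponentWeight (n : ℕ) : ℝ :=
  ∏ q ∈ (n / 2 ^ n.factorization 2).primeFactors,
    if Odd ((n / 2 ^ n.factorization 2).factorization q) then 1 / (q : ℝ) else 1

theorem oddExponentWeight_nonneg (n : ℕ) : 0 ≤ oddExponentWeight n :=
  prod_nonneg fun q _ => by split_ifs <;> positivity

theorem abs_localMean_le_ite {q : ℕ} (hq : 2 ≤ q) (v : ℕ) (t : Prop) [Decidable t] :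
    |localMean q v t| ≤ if Odd v then 1 / (q : ℝ) else 1 := by
  split_ifs with hv
  · have hv0 : v ≠ 0 := by rintro rfl; simp at hv
    rw [localMean, if_neg hv0, if_pos hv]
    split_ifs
    · rw [abs_zero]; positivity
    · rw [abs_neg, abs_of_nonneg (by positivity)]
  · have h2 : (2 : ℝ) ≤ q := by exact_mod_cast hq
    have h3 : 1 / (q : ℝ) ≤ 1 / 2 := one_div_le_one_div_of_le (by norm_num) h2
    have h4 : 0 < 1 / (q : ℝ) := by positivity
    have h5 : 2 / (q : ℝ) = 2 * (1 / q) := by ring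
    rw [localMean]
    split_ifs
    · simp
    · rw [abs_le]; constructor <;> linarith
    · rw [h5, abs_le]; constructor <;> linarith

theorem abs_sieveDensity_le (r : ℕ) {a d n : ℕ} (hd : d ≠ 0) :
    |sieveDensity r a d n| ≤ 4 / ((a : ℝ) ^ 2 * (d : ℝ) ^ 2) * oddExponentWeight n := by
  rw [sieveDensity]
  by_cases h : Odd a ∧ a.Coprime d ∧ a.Coprime (n / 2 ^ n.factorization 2) ∧
      (d / 2 ^ d.factorization 2).Coprime r
  swap
  · rw [if_neg h, abs_zero]
    exact mul_nonneg (by positivity) (oddExponentWeight_nonneg n)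
  rw [if_pos h]
  have h1 : |∏ q ∈ (n / 2 ^ n.factorization 2).primeFactors,
      localMean q ((n / 2 ^ n.factorization 2).factorization q) (q ∣ r * d)| ≤
      oddExponentWeight n := by
    rw [abs_prod, oddExponentWeight]
    exact prod_le_prod (fun _ _ => abs_nonneg _) fun q hq =>
      abs_localMean_le_ite (Nat.prime_of_mem_primeFactors hq).two_le _ _
  have h2 : (d : ℝ) ^ 2 ≤ 4 * ((if Odd d then d else d / 2 : ℕ) : ℝ) ^ 2 := by
    split_ifs with hdo
    · nlinarith [sq_nonneg (d : ℝ)]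
    · have h2 : 2 ∣ d := even_iff_two_dvd.1 (Nat.not_odd_iff_even.1 hdo)
      rw [Nat.cast_div h2 (by norm_num)]
      push_cast
      nlinarith
  have hd0 : (0 : ℝ) < (d : ℝ) ^ 2 := by positivity
  rw [abs_mul, abs_mul, abs_of_nonneg (by positivity)]
  have h3 : 1 / ((a : ℝ) ^ 2 * ((if Odd d then d else d / 2 : ℕ) : ℝ) ^ 2) ≤
      4 / ((a : ℝ) ^ 2 * (d : ℝ) ^ 2) := by
    generalize ((if Odd d then d else d / 2 : ℕ) : ℝ) ^ 2 = u at h2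
    have hu : 0 < u := by linarith
    rw [one_div, mul_inv, div_eq_mul_inv, mul_inv, mul_left_comm]
    refine mul_le_mul_of_nonneg_left ?_ (by positivity)
    rw [← div_eq_mul_inv, ← one_div, div_le_div_iff₀ hu hd0]
    linarith
  calc _ ≤ 4 / ((a : ℝ) ^ 2 * (d : ℝ) ^ 2) * (1 * oddExponentWeight n) := by
        refine mul_le_mul h3 (mul_le_mul (abs_twoAdicDensity_le _ _ _) h1 (abs_nonneg _)
          zero_le_one) (by positivity) (by positivity)
    _ = _ := by rw [one_mul]

/-- For `n = b² s` with `s` square-free, an odd prime has odd exponent in `n` exactly when it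
divides `s`. The 2 in the numerator allows for an even `s`. -/
theorem oddExponentWeight_le {n : ℕ} (hn : n ≠ 0) :
    ∃ x : ℕ × ℕ, n = x.1 ^ 2 * x.2 ∧ oddExponentWeight n ≤ 2 / x.2 := by
  obtain ⟨s, b, hbs, hs⟩ := Nat.sq_mul_squarefree n
  refine ⟨(b, s), hbs.symm, ?_⟩
  have hs0 : s ≠ 0 := hs.ne_zero
  have hb0 : b ≠ 0 := by rintro rfl; simp at hbs; exact hn hbs.symm
  have hodd : ∀ q ∈ (n / 2 ^ n.factorization 2).primeFactors, q ≠ 2 := by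
    rintro q hq rfl
    exact Nat.not_dvd_ordCompl Nat.prime_two hn (Nat.dvd_of_mem_primeFactors hq)
  have h1 : oddExponentWeight n =
      ∏ q ∈ (n / 2 ^ n.factorization 2).primeFactors, if q ∣ s then 1 / (q : ℝ) else 1 := by
    refine prod_congr rfl fun q hq => if_congr ?_ rfl rfl
    have hqp := Nat.prime_of_mem_primeFactors hq
    rw [factorization_ordCompl_two (hodd q hq), ← hbs,
      Nat.factorization_mul (pow_ne_zero 2 hb0) hs0]
    simp only [Nat.factorization_pow, Finsupp.add_apply, Finsupp.smul_apply, smul_eq_mul]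
    have h2 := hs.natFactorization_le_one q
    have h3 : s.factorization q = 0 ↔ ¬ q ∣ s := by
      rw [Nat.factorization_eq_zero_iff]; simp [hqp, hs0]
    rw [Nat.odd_iff]
    constructor
    · intro h
      by_contra h4
      rw [h3.2 h4] at h
      omega
    · intro h
      have := mt h3.1 (not_not.2 h)
      omega
  rw [h1, ← prod_filter, le_div_iff₀ (by positivity)]
  set t := (n / 2 ^ n.factorization 2).primeFactors.filter (fun q => q ∣ s) with ht
  have h2 : (s : ℝ) ≤ 2 * ∏ q ∈ t, (q : ℝ) := by
    have h2t : 2 ∉ t := fun h => hodd 2 (mem_of_mem_filter 2 h) rfl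
    have hsub : s.primeFactors ⊆ insert 2 t := by
      intro q hq
      rw [mem_insert, or_iff_not_imp_left]
      intro hq2
      rw [Nat.mem_primeFactors] at hq
      refine mem_filter.2 ⟨?_, hq.2.1⟩
      rw [← Nat.support_factorization, Finsupp.mem_support_iff, factorization_ordCompl_two hq2, Ne,
        Nat.factorization_eq_zero_iff]
      simp only [hq.1, hn, not_true_eq_false, or_false, false_or, not_not]
      exact hbs ▸ hq.2.1.mul_left _
    have h3 : (s : ℝ) = ∏ q ∈ s.primeFactors, (q : ℝ) := by
      conv_lhs => rw [← Nat.prod_primeFactors_of_squarefree hs]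
      push_cast; rfl
    calc (s : ℝ) = ∏ q ∈ s.primeFactors, (q : ℝ) := h3
      _ ≤ ∏ q ∈ insert 2 t, (q : ℝ) := by
        refine prod_le_prod_of_subset_of_one_le hsub (fun _ _ => Nat.cast_nonneg _)
          fun q hq _ => ?_
        rw [mem_insert] at hq
        rcases hq with rfl | hq
        · norm_num
        · exact_mod_cast (Nat.prime_of_mem_primeFactors (mem_of_mem_filter q hq)).one_le
      _ = _ := by rw [prod_insert h2t]; norm_num
  have h4 : (0 : ℝ) < ∏ q ∈ t, (q : ℝ) := prod_pos fun q hq => by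
    exact_mod_cast (Nat.prime_of_mem_primeFactors (mem_of_mem_filter q hq)).pos
  simp only [one_div, prod_inv_distrib]
  rw [inv_mul_le_iff₀ h4]
  linarith

/-- The map `n ↦ (b, s)` with `n = b² s` is injective, so the series is dominated by `2 ∑ b^(-3/2) ∑
s^(-7/4)`. The exponent `3/4` in place of 1 saves `n^(-1/4)` for the tails. -/
theorem summable_rpow_mul_oddExponentWeight :
    Summable fun n : ℕ => (n : ℝ) ^ (-(3 / 4) : ℝ) * oddExponentWeight n := by
  have hex : ∀ n : ℕ, ∃ x : ℕ × ℕ, n = x.1 ^ 2 * x.2 ∧ (n ≠ 0 → oddExponentWeight n ≤ 2 / x.2) := by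
    intro n
    by_cases hn : n = 0
    · exact ⟨(0, 0), by simp [hn], fun h => absurd hn h⟩
    · obtain ⟨x, h1, h2⟩ := oddExponentWeight_le hn
      exact ⟨x, h1, fun _ => h2⟩
  choose φ h1 h2 using hex
  have hinj : Function.Injective φ := fun m n h => by rw [h1 m, h1 n, h]
  have h3 : Summable fun b : ℕ => (b : ℝ) ^ (-(3 / 2) : ℝ) :=
    Real.summable_nat_rpow.2 (by norm_num)
  have h4 : Summable fun s : ℕ => (s : ℝ) ^ (-(7 / 4) : ℝ) :=
    Real.summable_nat_rpow.2 (by norm_num)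
  have h5 := ((h3.mul_of_nonneg h4 (fun b => by positivity) (fun s => by positivity)).mul_left
    2).comp_injective hinj
  refine h5.of_nonneg_of_le (fun n => mul_nonneg (by positivity) (oddExponentWeight_nonneg n))
    fun n => ?_
  by_cases hn : n = 0
  · subst hn
    rw [Nat.cast_zero, Real.zero_rpow (by norm_num), zero_mul]
    simp only [Function.comp_apply]
    positivity
  · have h6 := h2 n hn
    have h7 := h1 n
    simp only [Function.comp_apply]
    generalize φ n = x at *
    have hb : x.1 ≠ 0 := by rintro h; rw [h] at h7; simp at h7; exact hn h7
    have hs : x.2 ≠ 0 := by rintro h; rw [h] at h7; simp at h7; exact hn h7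
    have hb' : (0 : ℝ) < x.1 := by positivity
    have hs' : (0 : ℝ) < x.2 := by positivity
    calc (n : ℝ) ^ (-(3 / 4) : ℝ) * oddExponentWeight n
        ≤ (n : ℝ) ^ (-(3 / 4) : ℝ) * (2 / x.2) := by gcongr
      _ = _ := by
        conv_lhs => rw [h7]
        push_cast
        rw [Real.mul_rpow (by positivity) hs'.le, ← Real.rpow_natCast, ← Real.rpow_mul hb'.le,
          show (-(7 / 4) : ℝ) = -(3 / 4) + -1 by norm_num, Real.rpow_add hs', Real.rpow_neg_one]
        norm_num
        ring

theorem abs_tripleWeight_localWeight_le (r a d n : ℕ) :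
    |3 / 4 * tripleWeight (localWeight r) (a, d, n)| ≤
      4 * (1 / (a : ℝ) ^ 2 * (1 / (d : ℝ) ^ 3 * (1 / (n : ℝ) * oddExponentWeight n))) := by
  have hR : 0 ≤ 4 * (1 / (a : ℝ) ^ 2 * (1 / (d : ℝ) ^ 3 * (1 / (n : ℝ) * oddExponentWeight n))) := by
    have := oddExponentWeight_nonneg n
    positivity
  by_cases h : a * d * n = 0
  · rw [tripleWeight, if_pos h, mul_zero, abs_zero]
    exact hR
  have ha : a ≠ 0 := by rintro rfl; simp at h
  have hd : d ≠ 0 := by rintro rfl; simp at h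
  have hn : n ≠ 0 := by rintro rfl; simp at h
  rw [← moebius_mul_sieveDensity_div r ha hd hn, abs_div, abs_mul,
    abs_of_pos (show (0 : ℝ) < (n : ℝ) * d by positivity), div_le_iff₀ (by positivity)]
  have hmu : |(ArithmeticFunction.moebius a : ℝ)| ≤ 1 := by
    rw [← Int.cast_abs]
    exact_mod_cast ArithmeticFunction.abs_moebius_le_one
  calc _ ≤ 1 * (4 / ((a : ℝ) ^ 2 * (d : ℝ) ^ 2) * oddExponentWeight n) := by
        gcongr
        exact abs_sieveDensity_le r hd
    _ = _ := by
        have : (a : ℝ) ≠ 0 := by positivity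
        have : (d : ℝ) ≠ 0 := by positivity
        have : (n : ℝ) ≠ 0 := by positivity
        field_simp

/-- The dominating function of the variables `d` and `n`. -/
noncomputable def pairWeight (x : ℕ × ℕ) : ℝ :=
  (x.1 : ℝ) ^ (-(11 / 4) : ℝ) * ((x.2 : ℝ) ^ (-(3 / 4) : ℝ) * oddExponentWeight x.2)

theorem pairWeight_nonneg (x : ℕ × ℕ) : 0 ≤ pairWeight x := by
  have := oddExponentWeight_nonneg x.2
  rw [pairWeight]; positivity

theorem summable_pairWeight : Summable pairWeight :=
  (Real.summable_nat_rpow.2 (by norm_num)).mul_of_nonneg summable_rpow_mul_oddExponentWeight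
    (fun d => by positivity) fun n => mul_nonneg (by positivity) (oddExponentWeight_nonneg n)

theorem one_div_mul_eq_pairWeight (d n : ℕ) :
    1 / (d : ℝ) ^ 3 * (1 / (n : ℝ) * oddExponentWeight n) =
      ((d : ℝ) * n) ^ (-(1 / 4) : ℝ) * pairWeight (d, n) := by
  by_cases hd : d = 0
  · subst hd; simp [pairWeight]
  by_cases hn : n = 0
  · subst hn; simp [pairWeight]
  have hd0 : (0 : ℝ) < d := by positivity
  have hn0 : (0 : ℝ) < n := by positivity
  have h1 : 1 / (d : ℝ) ^ 3 = (d : ℝ) ^ (-(1 / 4) : ℝ) * (d : ℝ) ^ (-(11 / 4) : ℝ) := by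
    rw [← Real.rpow_add hd0, show (-(1 / 4) + -(11 / 4) : ℝ) = -(3 : ℕ) by norm_num,
      Real.rpow_neg hd0.le, Real.rpow_natCast, one_div]
  have h2 : 1 / (n : ℝ) = (n : ℝ) ^ (-(1 / 4) : ℝ) * (n : ℝ) ^ (-(3 / 4) : ℝ) := by
    rw [← Real.rpow_add hn0, show (-(1 / 4) + -(3 / 4) : ℝ) = -1 by norm_num,
      Real.rpow_neg_one, one_div]
  rw [h1, h2, Real.mul_rpow hd0.le hn0.le, pairWeight]
  ring

theorem one_div_mul_le_pairWeight (d n : ℕ) :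
    1 / (d : ℝ) ^ 3 * (1 / (n : ℝ) * oddExponentWeight n) ≤ pairWeight (d, n) := by
  rw [one_div_mul_eq_pairWeight]
  by_cases h : d * n = 0
  · have h' : (d : ℝ) * n = 0 := by exact_mod_cast h
    rw [h', Real.zero_rpow (by norm_num), zero_mul]
    exact pairWeight_nonneg _
  · have h1 : (1 : ℝ) ≤ (d : ℝ) * n := by exact_mod_cast Nat.one_le_iff_ne_zero.2 h
    refine mul_le_of_le_one_left (pairWeight_nonneg _) ?_
    exact Real.rpow_le_one_of_one_le_of_nonpos h1 (by norm_num)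

theorem summable_tripleWeight_localWeight (r : ℕ) : Summable (tripleWeight (localWeight r)) := by
  have h1 : Summable fun a : ℕ => 1 / (a : ℝ) ^ 2 := Real.summable_one_div_nat_pow.2 (by norm_num)
  have h2 := (h1.mul_of_nonneg summable_pairWeight (fun a => by positivity)
    pairWeight_nonneg).mul_left 4
  have h3 : Summable fun x : ℕ × ℕ × ℕ => 3 / 4 * tripleWeight (localWeight r) x := by
    refine h2.of_norm_bounded fun x => ?_
    refine (abs_tripleWeight_localWeight_le r x.1 x.2.1 x.2.2).trans ?_
    have := one_div_mul_le_pairWeight x.2.1 x.2.2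
    gcongr
  exact (summable_mul_left_iff (by norm_num)).1 h3

end

/-! ### Evaluation of the local factors. -/

section

open Finset

theorem hasSum_of_even_of_odd {f : ℕ → ℝ} {x y z q : ℝ} (h0 : 0 ≤ q) (h1 : q < 1)
    (hx : f 0 = x) (hy : ∀ k, f (2 * k + 1) = y * q * (q ^ 2) ^ k)
    (hz : ∀ k, k ≠ 0 → f (2 * k) = z * (q ^ 2) ^ k) :
    HasSum f (x + (y * q + z * q ^ 2) / (1 - q ^ 2)) := by
  have hq : q ^ 2 < 1 := by nlinarith
  have hg : HasSum (fun k : ℕ => (q ^ 2) ^ k) (1 - q ^ 2)⁻¹ :=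
    hasSum_geometric_of_lt_one (sq_nonneg q) hq
  have hne : 1 - q ^ 2 ≠ 0 := by linarith
  have heven : HasSum (fun k => f (2 * k)) (z * (1 - q ^ 2)⁻¹ + (x - z)) := by
    refine ((hg.mul_left z).add (hasSum_ite_eq 0 (x - z))).congr_fun fun k => ?_
    by_cases hk : k = 0
    · subst hk; simp [hx]
    · rw [if_neg hk, hz k hk, add_zero]
  have hodd : HasSum (fun k => f (2 * k + 1)) (y * q * (1 - q ^ 2)⁻¹) :=
    (hg.mul_left (y * q)).congr_fun hy
  have h := HasSum.even_add_odd heven hodd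
  rwa [show z * (1 - q ^ 2)⁻¹ + (x - z) + y * q * (1 - q ^ 2)⁻¹ =
    x + (y * q + z * q ^ 2) / (1 - q ^ 2) by field_simp; ring] at h

theorem hasSum_parityValue (x y z : ℝ) {q : ℝ} (h0 : 0 ≤ q) (h1 : q < 1) :
    HasSum (fun l => parityValue x y z l * q ^ l)
      (x + (y * q + z * q ^ 2) / (1 - q ^ 2)) := by
  refine hasSum_of_even_of_odd h0 h1 (by simp [parityValue]) (fun k => ?_) fun k hk => ?_
  · rw [parityValue, if_neg (Nat.succ_ne_zero _), if_pos (odd_two_mul_add_one k), pow_succ, pow_mul]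
    ring
  · rw [parityValue, if_neg (by omega), if_neg (Nat.not_odd_iff_even.2 (even_two_mul k)), pow_mul]

theorem hasSum_ite_geometric (x y z : ℝ) {t : ℝ} (h0 : 0 ≤ t) (h1 : t < 1) :
    HasSum (fun j => if j = 0 then x else if j = 1 then y else z * t ^ j)
      (x + y + z * t ^ 2 / (1 - t)) := by
  have hne : 1 - t ≠ 0 := by linarith
  have hg : HasSum (fun k : ℕ => t ^ k) (1 - t)⁻¹ := hasSum_geometric_of_lt_one h0 h1
  have h : HasSum (fun j => if j = 0 then x else if j = 1 then y else z * t ^ j)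
      (z * (1 - t)⁻¹ + (x - z) + (y - z * t)) := by
    refine (((hg.mul_left z).add (hasSum_ite_eq 0 (x - z))).add
      (hasSum_ite_eq 1 (y - z * t))).congr_fun fun j => ?_
    by_cases hj : j = 0
    · subst hj; simp
    · by_cases hj1 : j = 1
      · subst hj1; simp
      · simp [hj, hj1]
  rwa [show z * (1 - t)⁻¹ + (x - z) + (y - z * t) = x + y + z * t ^ 2 / (1 - t) by
    field_simp; ring] at h

/-- In a square-free sieve the exponent `i` of the sieving variable is at most 1, and `i = 1`
excludes the prime from the other two variables; what remains is a double sum over `(j, l)`. -/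
theorem tsum_triple_eq {f : ℕ → ℕ → ℕ → ℝ} (hs : Summable fun x : ℕ × ℕ × ℕ => f x.1 x.2.1 x.2.2)
    {u S : ℝ} {g : ℕ → ℝ} (hf : ∀ i j l, 2 ≤ i → f i j l = 0)
    (hu : ∀ j l, f 1 j l = if j = 0 ∧ l = 0 then u else 0)
    (hg : ∀ j, HasSum (fun l => f 0 j l) (g j)) (hS : HasSum g S) :
    ∑' x : ℕ × ℕ × ℕ, f x.1 x.2.1 x.2.2 = S + u := by
  have h0 : HasSum (fun y : ℕ × ℕ => f 0 y.1 y.2) S := by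
    have h : Summable fun y : ℕ × ℕ => f 0 y.1 y.2 := hs.prod_factor 0
    have := h.hasSum.prod_fiberwise hg
    rw [hS.unique this]
    exact h.hasSum
  have h1 : HasSum (fun y : ℕ × ℕ => f 1 y.1 y.2) u := by
    convert hasSum_ite_eq ((0, 0) : ℕ × ℕ) u using 2 with y
    rw [hu]
    simp [Prod.ext_iff]
  have h2 : ∀ i, HasSum (fun y : ℕ × ℕ => f i y.1 y.2)
      ((if i = 0 then S else 0) + (if i = 1 then u else 0)) := by
    intro i
    match i with
    | 0 => simpa using h0
    | 1 => simpa using h1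
    | i + 2 => simp [hf (i + 2) _ _ (by omega), hasSum_zero]
  exact (hs.hasSum.prod_fiberwise h2).unique
    ((hasSum_ite_eq 0 S).add (hasSum_ite_eq 1 u))

/-- The local factors of the main term. -/
noncomputable def mainLocalFactor (r p : ℕ) : ℝ :=
  (1 - 1 / (p : ℝ) ^ 2) *
    ((((p : ℝ) ^ 4 - 2 * (p : ℝ) ^ 2 - (p : ℝ) + 1) / ((p : ℝ) ^ 2 - 1) ^ 2) *
      if p ∣ r then (1 + (p : ℝ) ^ 2 / ((p : ℝ) ^ 4 - 2 * (p : ℝ) ^ 2 - (p : ℝ) + 1)) else 1)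

/-- The sums over `l` are `E = 1 + 1/(p(p+1))`, when `p` divides `r` or `d`, and `E' = 1 -
2/(p(p²-1))` otherwise. The terms with `j > 0`, present only for `p ∤ r`, add `1/(p(p²-1))`, and
sieving subtracts `1/p²`. Hence `1 - 1/p² - 1/(p(p²-1))` if `p ∤ r`, and `E - 1/p²` if `p ∣ r`. -/
theorem tsum_localWeight_odd (r : ℕ) {p : ℕ} (hp : p.Prime) (hp2 : p ≠ 2) :
    ∑' x : ℕ × ℕ × ℕ, localWeight r p x.1 x.2.1 x.2.2 = mainLocalFactor r p := by
  have hs := summable_local (localWeight_zero r) (summable_tripleWeight_localWeight r) hp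
  have h2 : (2 : ℝ) ≤ p := by exact_mod_cast hp.two_le
  have hp0 : (0 : ℝ) < p := by linarith
  have hq0 : 0 ≤ 1 / (p : ℝ) := by positivity
  have hq1 : 1 / (p : ℝ) < 1 := by rw [div_lt_one hp0]; linarith
  have ht0 : 0 ≤ 1 / (p : ℝ) ^ 3 := by positivity
  have ht1 : 1 / (p : ℝ) ^ 3 < 1 := by
    rw [div_lt_one (by positivity)]
    exact one_lt_pow₀ (by linarith) (by norm_num)
  have hl : ∀ t : Prop, ∀ _ : Decidable t, HasSum (fun l => localMean p l t * (1 / (p : ℝ)) ^ l)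
      (1 + ((if t then 0 else -(1 / p : ℝ)) * (1 / p) +
        (if t then 1 - 1 / p else 1 - 2 / p : ℝ) * (1 / p) ^ 2) / (1 - (1 / (p : ℝ)) ^ 2)) :=
    fun t _ => hasSum_parityValue _ _ _ hq0 hq1
  have hT := hl True inferInstance
  have hF := hl False inferInstance
  simp only [if_true, if_false] at hT hF
  have hpp : (p : ℝ) ^ 2 - 1 ≠ 0 := by nlinarith
  have hp1 : (p : ℝ) - 1 ≠ 0 := by linarith
  have hp1' : (p : ℝ) + 1 ≠ 0 := by linarith
  have hq : (p : ℝ) ^ 4 - 2 * (p : ℝ) ^ 2 - (p : ℝ) + 1 ≠ 0 := by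
    nlinarith [mul_nonneg hp0.le (sub_nonneg.2 h2), sq_nonneg ((p : ℝ) ^ 2 - 4)]
  set E := 1 + (0 * (1 / (p : ℝ)) + (1 - 1 / (p : ℝ)) * (1 / p) ^ 2) / (1 - (1 / (p : ℝ)) ^ 2)
    with hE
  set E' := 1 + (-(1 / (p : ℝ)) * (1 / (p : ℝ)) + (1 - 2 / (p : ℝ)) * (1 / p) ^ 2) /
    (1 - (1 / (p : ℝ)) ^ 2) with hE'
  have hEv : E = ((p : ℝ) ^ 2 + p + 1) / (p * (p + 1)) := by
    rw [hE]
    have : 1 - (1 / (p : ℝ)) ^ 2 ≠ 0 := by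
      rw [one_div, inv_pow, ← one_div, one_sub_div (by positivity)]
      exact div_ne_zero hpp (by positivity)
    field_simp
    ring
  have hEv' : E' = 1 - 2 / (p * ((p : ℝ) ^ 2 - 1)) := by
    rw [hE']
    have : 1 - (1 / (p : ℝ)) ^ 2 ≠ 0 := by
      rw [one_div, inv_pow, ← one_div, one_sub_div (by positivity)]
      exact div_ne_zero hpp (by positivity)
    field_simp
    ring
  have hsum : ∑' x : ℕ × ℕ × ℕ, localWeight r p x.1 x.2.1 x.2.2 =
      (if p ∣ r then E else E' + 1 / (p : ℝ) ^ 3 * E + E * (1 / (p : ℝ) ^ 3) ^ 2 /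
        (1 - 1 / (p : ℝ) ^ 3)) + -(1 / (p : ℝ) ^ 2) := by
    by_cases hpr : p ∣ r
    · rw [if_pos hpr]
      refine tsum_triple_eq hs (g := fun j => if j = 0 then E else 0) ?_ ?_ ?_ (hasSum_ite_eq 0 E)
      · intro i j l hi
        rw [localWeight, if_neg (by omega), if_neg (by omega)]
      · intro j l
        rw [localWeight, if_neg one_ne_zero]
        simp [hp2]
      · intro j
        by_cases hj : j = 0
        · subst hj
          simpa [localWeight, hp2, hpr] using hT
        · simp [localWeight, hp2, hpr, hj, hasSum_zero]
    · rw [if_neg hpr]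
      refine tsum_triple_eq hs (g := fun j => if j = 0 then E' else if j = 1 then
        1 / (p : ℝ) ^ 3 * E else E * (1 / (p : ℝ) ^ 3) ^ j) ?_ ?_ ?_
        (hasSum_ite_geometric _ _ _ ht0 ht1)
      · intro i j l hi
        rw [localWeight, if_neg (by omega), if_neg (by omega)]
      · intro j l
        rw [localWeight, if_neg one_ne_zero]
        simp [hp2]
      · intro j
        by_cases hj : j = 0
        · subst hj
          simpa [localWeight, hp2, hpr] using hF
        · have h3 : HasSum (fun l => localWeight r p 0 j l) ((1 / (p : ℝ) ^ 3) ^ j * E) := by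
            refine (hT.mul_left ((1 / (p : ℝ) ^ 3) ^ j)).congr_fun fun l => ?_
            rw [localWeight, if_pos rfl, if_neg hp2, if_neg (by simp [hpr])]
            simp [hj]
          by_cases hj1 : j = 1
          · subst hj1
            simpa using h3
          · simp only [if_neg hj, if_neg hj1]
            rwa [mul_comm E]
  rw [hsum, mainLocalFactor, hEv, hEv']
  have ht : 1 - 1 / (p : ℝ) ^ 3 = (p - 1) * (p ^ 2 + p + 1) / p ^ 3 := by
    field_simp
    ring
  have hf2 : (p : ℝ) ^ 2 - 1 = (p - 1) * (p + 1) := by ring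
  have hsq : (p : ℝ) ^ 2 + p + 1 ≠ 0 := by positivity
  split_ifs with hpr
  · have hmul : ∀ u v w : ℝ, u ≠ 0 → u / w * (1 + v / u) = (u + v) / w := fun u v w hu => by
      rw [div_mul_eq_mul_div, mul_add, mul_one, mul_div_cancel₀ _ hu]
    rw [hmul _ _ _ hq, hf2]
    field_simp
    ring
  · rw [ht, hf2]
    field_simp
    ring

/-- The three tables for `r` odd, `2 mod 4` and `0 mod 4` total, before normalisation, `7/12`,
`11/12` and `11/12`: the two even cases agree although their distributions over `d` differ. The
factor `4/3` is the normalisation by the density `3/4` at the origin. -/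
theorem tsum_localWeight_two (r : ℕ) :
    ∑' x : ℕ × ℕ × ℕ, localWeight r 2 x.1 x.2.1 x.2.2 = 4 / 3 * mainLocalFactor r 2 := by
  have hs := summable_local (localWeight_zero r) (summable_tripleWeight_localWeight r)
    Nat.prime_two
  have hl : ∀ x y z : ℝ, HasSum (fun l => parityValue x y z l * (1 / 2 : ℝ) ^ l)
      (x + y * (2 / 3) + z / 3) := by
    intro x y z
    convert hasSum_parityValue x y z (q := 1 / 2) (by norm_num) (by norm_num) using 1
    ring
  have hpos : ∀ j, j ≠ 0 → ∀ x y z : ℝ, (∀ l, twoAdicDensity r j l = parityValue x y z l) →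
      HasSum (fun l => localWeight r 2 0 j l)
        (4 / 3 * (4 * (1 / 8) ^ j * (x + y * (2 / 3) + z / 3))) := by
    intro j hj x y z h
    have := ((hl x y z).mul_left (4 * (1 / 8 : ℝ) ^ j)).mul_left (4 / 3)
    refine this.congr_fun fun l => ?_
    rw [localWeight, if_pos rfl, if_pos rfl, if_neg hj, h]
  have hzero : ∀ x y z : ℝ, (∀ l, twoAdicDensity r 0 l = parityValue x y z l) →
      HasSum (fun l => localWeight r 2 0 0 l) (4 / 3 * (x + y * (2 / 3) + z / 3)) := by
    intro x y z h
    have := (hl x y z).mul_left (4 / 3)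
    refine this.congr_fun fun l => ?_
    rw [localWeight, if_pos rfl, if_pos rfl, if_pos rfl, h, one_mul]
  have hpv : ∀ l, (0 : ℝ) = parityValue 0 0 0 l := fun l => by simp [parityValue]
  have key : ∀ x y z : ℝ, HasSum (fun l => localWeight r 2 0 0 l) x →
      HasSum (fun l => localWeight r 2 0 1 l) y →
      (∀ j, j ≠ 0 → j ≠ 1 → HasSum (fun l => localWeight r 2 0 j l) (z * (1 / 8) ^ j)) →
      ∑' x : ℕ × ℕ × ℕ, localWeight r 2 x.1 x.2.1 x.2.2 =
        x + y + z * (1 / 8) ^ 2 / (1 - 1 / 8) + 0 := by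
    intro x y z h0 h1 h2
    refine tsum_triple_eq hs (g := fun j => if j = 0 then x else if j = 1 then y else
      z * (1 / 8) ^ j) ?_ ?_ ?_ (hasSum_ite_geometric _ _ _ (by norm_num) (by norm_num))
    · intro i j l hi
      rw [localWeight, if_neg (by omega), if_neg (by omega)]
    · intro j l
      rw [localWeight, if_neg one_ne_zero]
      simp
    · intro j
      by_cases hj : j = 0
      · subst hj; simpa using h0
      · by_cases hj1 : j = 1
        · subst hj1; simpa using h1
        · simpa [hj, hj1] using h2 j hj hj1
  by_cases h1 : r % 2 = 1
  · have h2 : ¬ 2 ∣ r := by omega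
    rw [key _ _ 0 (hzero (3 / 4) (-1 / 2) (1 / 2) fun l => by simp [twoAdicDensity, h1])
      (hpos 1 one_ne_zero 0 0 0 fun l => by rw [← hpv l]; simp [twoAdicDensity, h1])
      (fun j hj _ => by
        convert hpos j hj 0 0 0 fun l => by rw [← hpv l]; simp [twoAdicDensity, h1, hj] using 1
        ring), mainLocalFactor, if_neg h2]
    norm_num
  · have h2 : 2 ∣ r := by omega
    by_cases h3 : r % 4 = 2
    -- Here `7/12 = 1/2 + (1/4)/3` is the sum over `l` for each `j ≥ 2`.
    · rw [key _ _ (4 / 3 * (4 * (7 / 12)))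
        (hzero (3 / 4) 0 0 fun l => by simp [twoAdicDensity, h1, h3])
        (hpos 1 one_ne_zero (1 / 4) 0 0 fun l => by simp [twoAdicDensity, h1, h3])
        (fun j hj hj1 => by
          convert hpos j hj (1 / 2) 0 (1 / 4) fun l => by
            simp [twoAdicDensity, h1, h3, hj, hj1] using 1
          ring), mainLocalFactor, if_pos h2]
      norm_num
    · rw [key _ _ 0
        (hzero (3 / 4) 0 0 fun l => by simp [twoAdicDensity, h1, h3])
        (hpos 1 one_ne_zero (1 / 4) 0 (1 / 4) fun l => by simp [twoAdicDensity, h1, h3])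
        (fun j hj hj1 => by
          convert hpos j hj 0 0 0 fun l => by
            rw [← hpv l]; simp [twoAdicDensity, h1, h3, hj, hj1] using 1
          ring), mainLocalFactor, if_pos h2]
      norm_num

end

/-! ### The complete main term and its truncation. -/

section

open Finset

theorem tendsto_prod_primesBelow_of_hasProd {f : ℕ → ℝ} {a : ℝ}
    (h : HasProd (fun p : Nat.Primes => f p) a) :
    Filter.Tendsto (fun N : ℕ => ∏ p ∈ N.primesBelow, f p) Filter.atTop (nhds a) := by
  have h1 : HasProd (Set.mulIndicator {p : ℕ | p.Prime} f) a :=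
    (hasProd_subtype_iff_mulIndicator (s := {p : ℕ | p.Prime})).1 h
  refine h1.tendsto_prod_nat.congr fun N => ?_
  rw [Nat.primesBelow, prod_filter]
  refine prod_congr rfl fun p _ => ?_
  rw [Set.mulIndicator_apply]
  rfl

theorem riemannZeta_two_re : (riemannZeta 2).re = Real.pi ^ 2 / 6 := by
  rw [riemannZeta_two]
  norm_cast

theorem tendsto_prod_one_sub_inv_sq :
    Filter.Tendsto (fun N : ℕ => ∏ p ∈ N.primesBelow, (1 - 1 / (p : ℝ) ^ 2)) Filter.atTop
      (nhds (1 / (riemannZeta 2).re)) := by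
  have h1 := riemannZeta_eulerProduct (s := 2) (by norm_num)
  have h2 := (Complex.continuous_re.tendsto _).comp h1
  have hne : (riemannZeta 2).re ≠ 0 := by rw [riemannZeta_two_re]; positivity
  have h3 := h2.inv₀ hne
  rw [one_div]
  refine h3.congr fun N => ?_
  have h4 : ∏ p ∈ N.primesBelow, (1 - (p : ℂ) ^ (-2 : ℂ))⁻¹ =
      ((∏ p ∈ N.primesBelow, (1 - 1 / (p : ℝ) ^ 2)⁻¹ : ℝ) : ℂ) := by
    rw [Complex.ofReal_prod]
    refine prod_congr rfl fun p _ => ?_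
    rw [Complex.cpow_neg, show (2 : ℂ) = ((2 : ℕ) : ℂ) by norm_num, Complex.cpow_natCast]
    push_cast
    rw [one_div]
  simp only [Function.comp_apply]
  rw [h4, Complex.ofReal_re, prod_inv_distrib, inv_inv]

theorem tendsto_prod_mainLocalFactor {r : ℕ} (hr : 0 < r) :
    Filter.Tendsto (fun N : ℕ => ∏ p ∈ N.primesBelow, mainLocalFactor r p) Filter.atTop
      (nhds (1 / (riemannZeta 2).re * (constB * factorC r))) := by
  simp only [mainLocalFactor, prod_mul_distrib]
  refine tendsto_prod_one_sub_inv_sq.mul (Filter.Tendsto.mul ?_ ?_)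
  · exact tendsto_prod_primesBelow_of_hasProd (f := fun p : ℕ =>
      ((p : ℝ) ^ 4 - 2 * (p : ℝ) ^ 2 - (p : ℝ) + 1) / ((p : ℝ) ^ 2 - 1) ^ 2)
      multipliable_constB.hasProd
  · refine tendsto_const_nhds.congr' ?_
    filter_upwards [Filter.eventually_gt_atTop r] with N hN
    rw [← prod_filter, factorC]
    refine prod_congr ?_ fun _ _ => rfl
    ext p
    rw [mem_filter, Nat.mem_primesBelow, Nat.mem_primeFactors]
    exact ⟨fun h => ⟨⟨(Nat.le_of_dvd hr h.2.1).trans_lt hN, h.1⟩, h.2.1⟩,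
      fun h => ⟨h.1.2, h.2, hr.ne'⟩⟩

/-- The complete main term is the constant of the theorem. -/
theorem tsum_tripleWeight_localWeight {r : ℕ} (hr : 0 < r) :
    ∑' x, 3 / 4 * tripleWeight (localWeight r) x =
      1 / (riemannZeta 2).re * (constB * factorC r) := by
  have h1 := tendsto_prod_tsum_local (localWeight_zero r) (summable_tripleWeight_localWeight r)
  have h2 := (tendsto_prod_mainLocalFactor hr).const_mul (4 / 3)
  have h3 : ∑' x, tripleWeight (localWeight r) x =
      4 / 3 * (1 / (riemannZeta 2).re * (constB * factorC r)) := by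
    refine tendsto_nhds_unique h1 (h2.congr' ?_)
    filter_upwards [Filter.eventually_gt_atTop 2] with N hN
    have h2N : 2 ∈ N.primesBelow := Nat.mem_primesBelow.2 ⟨hN, Nat.prime_two⟩
    rw [← mul_prod_erase _ _ h2N, ← mul_prod_erase _ _ h2N, tsum_localWeight_two, mul_assoc]
    congr 2
    exact prod_congr rfl fun p hp => (tsum_localWeight_odd r
      (Nat.prime_of_mem_primesBelow (mem_of_mem_erase hp)) (ne_of_mem_erase hp)).symm
  rw [tsum_mul_left, h3]
  ring

theorem abs_tsum_sub_sum_le {ι : Type*} {w h : ι → ℝ} (hw : Summable w) (hh : Summable h)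
    (F : Finset ι) (h0 : ∀ x, 0 ≤ h x) (hle : ∀ x, x ∉ F → |w x| ≤ h x) :
    |∑ x ∈ F, w x - ∑' x, w x| ≤ ∑' x, h x := by
  classical
  have h2 : ∑ x ∈ F, w x - ∑' x, w x = -∑' x, ((F : Set ι)ᶜ.indicator w) x := by
    rw [← hw.sum_add_tsum_compl (s := F), _root_.tsum_subtype]
    ring
  rw [h2, abs_neg, ← Real.norm_eq_abs]
  refine tsum_of_norm_bounded hh.hasSum fun x => ?_
  by_cases hx : x ∈ F
  · rw [Set.indicator_of_notMem (by simpa using hx), norm_zero]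
    exact h0 x
  · rw [Set.indicator_of_mem (by simpa using hx)]
    exact hle x hx

theorem summable_ite_one_div_sq (A : ℕ) :
    Summable fun a : ℕ => if A < a then 1 / (a : ℝ) ^ 2 else 0 := by
  refine (Real.summable_one_div_nat_pow.2 one_lt_two).of_nonneg_of_le (fun a => ?_) fun a => ?_
  · split_ifs <;> positivity
  · split_ifs
    · exact le_rfl
    · positivity

theorem tsum_ite_one_div_sq_le {A : ℕ} (hA : 0 < A) :
    ∑' a : ℕ, (if A < a then 1 / (a : ℝ) ^ 2 else 0) ≤ 1 / (A : ℝ) := by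
  refine Real.tsum_le_of_sum_range_le (fun a => by split_ifs <;> positivity) fun M => ?_
  rw [← sum_filter]
  calc _ ≤ ∑ a ∈ Ioc A (max A M), 1 / (a : ℝ) ^ 2 := by
        refine sum_le_sum_of_subset_of_nonneg (fun a ha => ?_) fun a _ _ => by positivity
        simp only [mem_filter, mem_range, mem_Ioc] at ha ⊢
        omega
    _ ≤ 1 / (A : ℝ) - 1 / ((max A M : ℕ) : ℝ) := sum_Ioc_one_div_sq_le hA (le_max_left _ _)
    _ ≤ _ := by
      have : (0 : ℝ) ≤ 1 / ((max A M : ℕ) : ℝ) := by positivity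
      linarith

theorem rpow_neg_quarter_le {x y : ℝ} (hx : 0 < x) (hxy : x ≤ y) :
    y ^ (-(1 / 4) : ℝ) ≤ x ^ (-(1 / 4) : ℝ) :=
  Real.rpow_le_rpow_of_nonpos hx hxy (by norm_num)

/-- The truncated main term differs little from the complete one. -/
theorem exists_abs_truncated_sub_le : ∃ K : ℝ, 0 ≤ K ∧ ∀ (r A P : ℕ) (T : ℝ), 0 < r → 0 < A →
    0 < P → 0 < T →
    |∑ d ∈ (Icc 1 (2 * P)).filter (fun d => ¬ P ∣ d),
        ∑ n ∈ (Icc 1 ⌊T⌋₊).filter (fun n => ¬ P ∣ n),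
          (∑ a ∈ Icc 1 A, (ArithmeticFunction.moebius a : ℝ) * sieveDensity r a d n) /
            ((n : ℝ) * d) -
        1 / (riemannZeta 2).re * (constB * factorC r)| ≤
      K * (1 / A + (P : ℝ) ^ (-(1 / 4) : ℝ) + T ^ (-(1 / 4) : ℝ)) := by
  set G := ∑' x, pairWeight x with hG
  set Z := ∑' a : ℕ, 1 / (a : ℝ) ^ 2 with hZ
  have hsZ : Summable fun a : ℕ => 1 / (a : ℝ) ^ 2 := Real.summable_one_div_nat_pow.2 one_lt_two
  have hG0 : 0 ≤ G := tsum_nonneg pairWeight_nonneg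
  have hZ0 : 0 ≤ Z := tsum_nonneg fun a => by positivity
  refine ⟨4 * (1 + Z) * G, by positivity, fun r A P T hr hA hP hT => ?_⟩
  set η := (P : ℝ) ^ (-(1 / 4) : ℝ) + T ^ (-(1 / 4) : ℝ) with hη
  have hη0 : 0 ≤ η := by positivity
  set w := fun x : ℕ × ℕ × ℕ => 3 / 4 * tripleWeight (localWeight r) x with hw
  have hsw : Summable w := (summable_tripleWeight_localWeight r).mul_left _
  set F : Finset (ℕ × ℕ × ℕ) := Icc 1 A ×ˢ ((Icc 1 (2 * P)).filter (fun d => ¬ P ∣ d) ×ˢ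
    (Icc 1 ⌊T⌋₊).filter (fun n => ¬ P ∣ n)) with hF
  have hsum : ∑ d ∈ (Icc 1 (2 * P)).filter (fun d => ¬ P ∣ d),
        ∑ n ∈ (Icc 1 ⌊T⌋₊).filter (fun n => ¬ P ∣ n),
          (∑ a ∈ Icc 1 A, (ArithmeticFunction.moebius a : ℝ) * sieveDensity r a d n) /
            ((n : ℝ) * d) = ∑ x ∈ F, w x := by
    rw [hF, sum_product_right, sum_product]
    refine sum_congr rfl fun d hd => sum_congr rfl fun n hn => ?_
    rw [sum_div]
    refine sum_congr rfl fun a ha => ?_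
    rw [mem_filter, mem_Icc] at hd hn
    rw [mem_Icc] at ha
    exact moebius_mul_sieveDensity_div r (by omega) (by omega) (by omega)
  set u := fun a : ℕ => (if A < a then 1 / (a : ℝ) ^ 2 else 0) + η * (1 / (a : ℝ) ^ 2) with hu
  have hu0 : ∀ a, 0 ≤ u a := fun a => by
    simp only [hu]; split_ifs <;> positivity
  have hsu : Summable u := (summable_ite_one_div_sq A).add (hsZ.mul_left η)
  have htu : ∑' a, u a ≤ 1 / A + η * Z := by
    rw [(summable_ite_one_div_sq A).tsum_add (hsZ.mul_left η), tsum_mul_left]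
    exact add_le_add_left (tsum_ite_one_div_sq_le hA) _
  have hprod := (hasSum_mul_prod hsu.hasSum summable_pairWeight.hasSum).mul_left 4
  -- A triple outside the box with nonzero product has `a > A` or `dn ≥ min P T`, since `P ∣ d`, `d
  -- > 2P` and `P ∣ n` each give `dn ≥ P`. The first case has a small tail in `a`; in the second the
  -- spare `(dn)^(-1/4)` is at most `η`.
  have hpt : ∀ x, x ∉ F → |w x| ≤ 4 * (u x.1 * pairWeight x.2) := by
    rintro ⟨a, d, n⟩ hx
    by_cases h0 : a * d * n = 0
    · simp only [hw, tripleWeight, if_pos h0, mul_zero, abs_zero]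
      exact mul_nonneg (by norm_num) (mul_nonneg (hu0 a) (pairWeight_nonneg _))
    have ha : 0 < a := Nat.pos_of_ne_zero (by rintro rfl; simp at h0)
    have hd : 0 < d := Nat.pos_of_ne_zero (by rintro rfl; simp at h0)
    have hn : 0 < n := Nat.pos_of_ne_zero (by rintro rfl; simp at h0)
    refine (abs_tripleWeight_localWeight_le r a d n).trans ?_
    refine mul_le_mul_of_nonneg_left ?_ (by norm_num)
    have hpw := pairWeight_nonneg (d, n)
    by_cases hAa : A < a
    · have h1 := one_div_mul_le_pairWeight d n
      calc _ ≤ 1 / (a : ℝ) ^ 2 * pairWeight (d, n) := by gcongr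
        _ ≤ _ := by
          refine mul_le_mul_of_nonneg_right ?_ hpw
          simp only [hu, if_pos hAa]
          have : 0 ≤ η * (1 / (a : ℝ) ^ 2) := by positivity
          linarith
    · rw [one_div_mul_eq_pairWeight]
      have h1 : ((d : ℝ) * n) ^ (-(1 / 4) : ℝ) ≤ η := by
        have hd1 : (1 : ℝ) ≤ d := by exact_mod_cast hd
        have hn1 : (1 : ℝ) ≤ n := by exact_mod_cast hn
        have hP0 : (0 : ℝ) < P := by exact_mod_cast hP
        have hPle : (P : ℝ) ≤ d * n → ((d : ℝ) * n) ^ (-(1 / 4) : ℝ) ≤ η := fun h =>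
          (rpow_neg_quarter_le hP0 h).trans (le_add_of_nonneg_right (by positivity))
        have hTle : T ≤ (d : ℝ) * n → ((d : ℝ) * n) ^ (-(1 / 4) : ℝ) ≤ η := fun h =>
          (rpow_neg_quarter_le hT h).trans (le_add_of_nonneg_left (by positivity))
        have hdle : P ≤ d → (P : ℝ) ≤ d * n := fun h => by
          have : (P : ℝ) ≤ d := by exact_mod_cast h
          nlinarith
        have hnle : P ≤ n → (P : ℝ) ≤ d * n := fun h => by
          have : (P : ℝ) ≤ n := by exact_mod_cast h
          nlinarith
        by_cases hPd : P ∣ d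
        · exact hPle (hdle (Nat.le_of_dvd hd hPd))
        by_cases hd2 : 2 * P < d
        · exact hPle (hdle (by omega))
        by_cases hPn : P ∣ n
        · exact hPle (hnle (Nat.le_of_dvd hn hPn))
        by_cases hnT : ⌊T⌋₊ < n
        · refine hTle ?_
          have := (Nat.floor_lt hT.le).1 hnT
          nlinarith
        · exfalso
          refine hx ?_
          simp only [hF, mem_product, mem_filter, mem_Icc]
          exact ⟨⟨ha, by omega⟩, ⟨⟨hd, by omega⟩, hPd⟩, ⟨hn, by omega⟩, hPn⟩
      calc _ ≤ 1 / (a : ℝ) ^ 2 * (η * pairWeight (d, n)) := by gcongr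
        _ = _ := by simp only [hu, if_neg hAa]; ring
  rw [hsum, ← tsum_tripleWeight_localWeight hr]
  refine (abs_tsum_sub_sum_le hsw hprod.summable F (fun x =>
    mul_nonneg (by norm_num) (mul_nonneg (hu0 _) (pairWeight_nonneg _))) hpt).trans ?_
  rw [hprod.tsum_eq]
  have hA0 : (0 : ℝ) ≤ 1 / A := by positivity
  calc 4 * ((∑' a, u a) * G) ≤ 4 * ((1 / A + η * Z) * G) := by gcongr
    _ ≤ 4 * ((1 + Z) * (1 / A + η) * G) := by
        gcongr
        nlinarith [mul_nonneg hZ0 hA0]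
    _ = _ := by rw [hη]; ring

/-- The constant of the main term is bounded uniformly in `r`. -/
theorem exists_abs_main_le : ∃ K : ℝ, 0 ≤ K ∧ ∀ r : ℕ, 0 < r →
    |1 / (riemannZeta 2).re * (constB * factorC r)| ≤ K := by
  obtain ⟨K, hK, h⟩ := exists_abs_truncated_sub_le
  refine ⟨K * 3, by positivity, fun r hr => ?_⟩
  -- For `P = 1` every `d` is a multiple of `P`, so the truncated sum is empty and the truncation
  -- bound becomes a bound for the constant itself.
  have h1 := h r 1 1 1 hr one_pos one_pos one_pos
  simpa [← two_add_one_eq_three, ← one_add_one_eq_two] using h1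

end

/-! ### Summation over the conductors and the divisors. -/

section

open Finset

theorem sum_Icc_floor_one_div_le {x : ℝ} (hx : 1 ≤ x) :
    ∑ n ∈ Icc 1 ⌊x⌋₊, 1 / (n : ℝ) ≤ 1 + Real.log x := by
  refine le_trans (le_of_eq ?_) (harmonic_floor_le_one_add_log x hx)
  rw [harmonic_eq_sum_Icc]
  push_cast
  simp only [one_div]

theorem sum_Icc_one_div_le {m : ℕ} (hm : 0 < m) :
    ∑ n ∈ Icc 1 m, 1 / (n : ℝ) ≤ 1 + Real.log m := by
  have := sum_Icc_floor_one_div_le (x := (m : ℝ)) (by exact_mod_cast hm)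
  rwa [Nat.floor_natCast] at this

/-- A prime `p ≥ 2^(1/δ)` satisfies `p^δ ≥ 2` and pays for its own factor; the fewer than `M`
smaller primes cost at most `2^M`. -/
theorem two_pow_card_primeFactors_le {δ : ℝ} (hδ : 0 < δ) :
    ∃ C : ℝ, 0 < C ∧ ∀ n : ℕ, n ≠ 0 → (2 : ℝ) ^ #n.primeFactors ≤ C * (n : ℝ) ^ δ := by
  set M := ⌈(2 : ℝ) ^ (1 / δ)⌉₊ with hM
  refine ⟨2 ^ M, by positivity, fun n hn => ?_⟩
  have h1 : ∀ p ∈ n.primeFactors, (2 : ℝ) ≤ (if p < M then 2 else 1) * (p : ℝ) ^ δ := by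
    intro p hp
    have hp1 : (1 : ℝ) ≤ p := by exact_mod_cast (Nat.prime_of_mem_primeFactors hp).one_le
    split_ifs with h
    · have := Real.one_le_rpow hp1 hδ.le
      linarith
    · have h2 : (2 : ℝ) ^ (1 / δ) ≤ p := (Nat.le_ceil _).trans (by exact_mod_cast not_lt.1 h)
      have h3 := Real.rpow_le_rpow (by positivity) h2 hδ.le
      rwa [← Real.rpow_mul (by norm_num), one_div_mul_cancel hδ.ne', Real.rpow_one,
        ← one_mul ((p : ℝ) ^ δ)] at h3
  have h2 : ∏ p ∈ n.primeFactors, (if p < M then (2 : ℝ) else 1) ≤ 2 ^ M := by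
    rw [← prod_filter, prod_const]
    refine pow_le_pow_right₀ (by norm_num) ?_
    calc _ ≤ #(range M) := card_le_card fun p hp => mem_range.2 (mem_filter.1 hp).2
      _ = M := card_range M
  have h3 : ∏ p ∈ n.primeFactors, (p : ℝ) ^ δ ≤ (n : ℝ) ^ δ := by
    rw [Real.finsetProd_rpow _ _ fun p _ => Nat.cast_nonneg p]
    refine Real.rpow_le_rpow (prod_nonneg fun p _ => Nat.cast_nonneg p) ?_ hδ.le
    rw [← Nat.cast_prod, Nat.cast_le]
    exact Nat.le_of_dvd (Nat.pos_of_ne_zero hn) (Nat.prod_primeFactors_dvd n)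
  calc (2 : ℝ) ^ #n.primeFactors = ∏ p ∈ n.primeFactors, (2 : ℝ) := by rw [prod_const]
    _ ≤ ∏ p ∈ n.primeFactors, ((if p < M then 2 else 1) * (p : ℝ) ^ δ) :=
        prod_le_prod (fun _ _ => by norm_num) h1
    _ = _ := prod_mul_distrib
    _ ≤ _ := mul_le_mul h2 h3 (prod_nonneg fun p _ => by positivity) (by positivity)

theorem completionError_le {δ : ℝ} (hδ : 0 < δ) :
    ∃ C : ℝ, 0 < C ∧ ∀ n : ℕ, n ≠ 0 → completionError n ≤ C * (√n * (n : ℝ) ^ δ) := by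
  obtain ⟨C, hC, h⟩ := two_pow_card_primeFactors_le (half_pos hδ)
  refine ⟨8 * C * (1 + 8 ^ (δ / 2) / (δ / 2)) + 1, by positivity, fun n hn => ?_⟩
  have hn1 : (1 : ℝ) ≤ n := by exact_mod_cast Nat.one_le_iff_ne_zero.2 hn
  have hn0 : (0 : ℝ) < n := by linarith
  have h1 : 1 + Real.log (8 * n) ≤ (1 + 8 ^ (δ / 2) / (δ / 2)) * (n : ℝ) ^ (δ / 2) := by
    have h2 := Real.log_le_rpow_div (show (0 : ℝ) ≤ 8 * n by positivity) (half_pos hδ)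
    rw [Real.mul_rpow (by norm_num) hn0.le] at h2
    have h3 := Real.one_le_rpow hn1 (half_pos hδ).le
    calc _ ≤ (n : ℝ) ^ (δ / 2) + 8 ^ (δ / 2) * (n : ℝ) ^ (δ / 2) / (δ / 2) := add_le_add h3 h2
      _ = _ := by ring
  have h4 : (1 : ℝ) ≤ √n * (n : ℝ) ^ δ :=
    one_le_mul_of_one_le_of_one_le (Real.one_le_sqrt.2 hn1) (Real.one_le_rpow hn1 hδ.le)
  have h5 : (n : ℝ) ^ δ = (n : ℝ) ^ (δ / 2) * (n : ℝ) ^ (δ / 2) := by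
    rw [← Real.rpow_add hn0, add_halves]
  have h6 : 0 ≤ 1 + Real.log (8 * n) := by
    have := Real.log_nonneg (show (1 : ℝ) ≤ 8 * n by linarith)
    linarith
  rw [completionError]
  calc _ ≤ 8 * (C * (n : ℝ) ^ (δ / 2) * √n) *
          ((1 + 8 ^ (δ / 2) / (δ / 2)) * (n : ℝ) ^ (δ / 2)) + √n * (n : ℝ) ^ δ := by
        gcongr
        exact h n hn
    _ = _ := by rw [h5]; ring

theorem sum_completionError_div_le {δ : ℝ} (hδ : 0 < δ) :
    ∃ C : ℝ, 0 < C ∧ ∀ T : ℝ, 0 < T →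
      ∑ n ∈ Icc 1 ⌊T⌋₊, completionError n / n ≤ C * (√T * T ^ δ) := by
  obtain ⟨C, hC, h⟩ := completionError_le hδ
  refine ⟨C * 2, by positivity, fun T hT => ?_⟩
  have hsqrt : ∀ m : ℕ, ∑ n ∈ Icc 1 m, 1 / √(n : ℝ) ≤ 2 * √m := by
    intro m
    induction m with
    | zero => simp
    | succ m ih =>
      rw [sum_Icc_succ_top (by omega)]
      have h1 : √(m : ℝ) ^ 2 = m := Real.sq_sqrt (Nat.cast_nonneg m)
      have h2 : √((m + 1 : ℕ) : ℝ) ^ 2 = m + 1 := by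
        rw [Real.sq_sqrt (Nat.cast_nonneg _)]; push_cast; rfl
      have h3 : 0 < √((m + 1 : ℕ) : ℝ) := Real.sqrt_pos.2 (by positivity)
      have h4 : 1 / √((m + 1 : ℕ) : ℝ) ≤ 2 * √((m + 1 : ℕ) : ℝ) - 2 * √(m : ℝ) := by
        rw [div_le_iff₀ h3]
        nlinarith [sq_nonneg (√((m + 1 : ℕ) : ℝ) - √(m : ℝ))]
      linarith
  have h1 : ∀ n ∈ Icc 1 ⌊T⌋₊, completionError n / n ≤ C * T ^ δ * (1 / √(n : ℝ)) := by
    intro n hn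
    rw [mem_Icc] at hn
    have hn0 : (0 : ℝ) < n := by exact_mod_cast hn.1
    have hnT : (n : ℝ) ≤ T := (Nat.le_floor_iff hT.le).1 hn.2
    rw [div_le_iff₀ hn0]
    calc _ ≤ C * (√n * (n : ℝ) ^ δ) := h n (by omega)
      _ ≤ C * (√n * T ^ δ) := by gcongr
      _ = C * T ^ δ * (1 / √(n : ℝ) * (√n * √n)) := by
        have : √(n : ℝ) ≠ 0 := (Real.sqrt_pos.2 hn0).ne'
        field_simp
      _ = _ := by rw [Real.mul_self_sqrt hn0.le]; ring
  calc _ ≤ ∑ n ∈ Icc 1 ⌊T⌋₊, C * T ^ δ * (1 / √(n : ℝ)) := sum_le_sum h1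
    _ ≤ C * T ^ δ * (2 * √(⌊T⌋₊ : ℝ)) := by
      rw [← mul_sum]
      exact mul_le_mul_of_nonneg_left (hsqrt _) (by positivity)
    _ ≤ C * T ^ δ * (2 * √T) := by
      gcongr
      exact Nat.floor_le hT.le
    _ = _ := by ring

theorem sum_multiples_one_div_le {P : ℕ} (hP : 0 < P) {T : ℝ} (hT : 1 ≤ T) :
    ∑ n ∈ (Icc 1 ⌊T⌋₊).filter (fun n => P ∣ n), 1 / (n : ℝ) ≤ (1 + Real.log T) / P := by
  have hP0 : (0 : ℝ) < P := by exact_mod_cast hP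
  set S := (Icc 1 ⌊T⌋₊).filter (fun n => P ∣ n) with hS
  have hinj : Set.InjOn (fun n => n / P) (S : Set ℕ) := by
    intro x hx y hy h
    simp only [hS, coe_filter, Set.mem_ofPred_eq] at hx hy
    exact (Nat.div_left_inj hx.2 hy.2).1 h
  have h1 : ∑ n ∈ S, 1 / (n : ℝ) = 1 / P * ∑ m ∈ S.image (fun n => n / P), 1 / (m : ℝ) := by
    rw [sum_image hinj, mul_sum]
    refine sum_congr rfl fun n hn => ?_
    obtain ⟨k, rfl⟩ := (mem_filter.1 hn).2
    rw [Nat.mul_div_cancel_left _ hP]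
    push_cast
    rw [one_div_mul_one_div]
  have h2 : S.image (fun n => n / P) ⊆ Icc 1 ⌊T⌋₊ := by
    intro m hm
    obtain ⟨n, hn, rfl⟩ := mem_image.1 hm
    rw [hS, mem_filter, mem_Icc] at hn
    rw [mem_Icc]
    exact ⟨Nat.div_pos (Nat.le_of_dvd hn.1.1 hn.2) hP, (Nat.div_le_self _ _).trans hn.1.2⟩
  rw [h1, div_eq_mul_one_div (1 + Real.log T), mul_comm _ (1 / (P : ℝ))]
  refine mul_le_mul_of_nonneg_left ?_ (by positivity)
  exact (sum_le_sum_of_subset_of_nonneg h2 fun _ _ _ => by positivity).trans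
    (sum_Icc_floor_one_div_le hT)

theorem abs_sum_sum_div_le {D N : Finset ℕ} {f : ℕ → ℕ → ℝ} {g : ℕ → ℝ}
    (h : ∀ d ∈ D, ∀ n ∈ N, |f d n| ≤ g n) :
    |∑ d ∈ D, ∑ n ∈ N, f d n / ((n : ℝ) * d)| ≤ (∑ d ∈ D, 1 / (d : ℝ)) * ∑ n ∈ N, g n / n := by
  rw [sum_mul_sum]
  refine (abs_sum_le_sum_abs _ _).trans (sum_le_sum fun d hd => ?_)
  refine (abs_sum_le_sum_abs _ _).trans (sum_le_sum fun n hn => ?_)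
  rw [abs_div, abs_of_nonneg (show (0 : ℝ) ≤ (n : ℝ) * d by positivity), one_div_mul_eq_div,
    div_div]
  have := h d hd n hn
  gcongr

theorem abs_sum_twistedSum_le {P r : ℕ} (hP : 0 < P) (X : ℝ) {Y T : ℝ} (hY : 0 ≤ Y) (hT : 1 ≤ T) :
    |∑ d ∈ Icc 1 (2 * P), ∑ n ∈ Icc 1 ⌊T⌋₊, (twistedSum P X Y n d r : ℝ) / ((n : ℝ) * d)| ≤
      (1 + Real.log (2 * P)) * ((Y + 1) * (1 + Real.log T)) := by
  refine (abs_sum_sum_div_le (g := fun _ => Y + 1) fun d _ n _ =>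
    abs_twistedSum_le P X Y hY n d r).trans ?_
  have h1 := sum_Icc_one_div_le (m := 2 * P) (Nat.mul_pos two_pos hP)
  push_cast at h1
  have h2 : ∑ n ∈ Icc 1 ⌊T⌋₊, (Y + 1) / (n : ℝ) ≤ (Y + 1) * (1 + Real.log T) := by
    simp only [div_eq_mul_one_div (Y + 1), ← mul_sum]
    exact mul_le_mul_of_nonneg_left (sum_Icc_floor_one_div_le hT) (by linarith)
  refine mul_le_mul h1 h2 (sum_nonneg fun n _ => by positivity) ?_
  exact (sum_nonneg fun _ _ => by positivity).trans h1

/-- The double sum of the twisted sums, compared with its main term. -/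
theorem exists_abs_sum_twistedSum_sub_le : ∃ K : ℝ, 0 ≤ K ∧ ∀ (P r A : ℕ) (X Y T : ℝ), P.Prime →
    Odd P → ¬ P ∣ r → 0 < r → 0 < A → 0 < X → 0 ≤ Y → 1 ≤ T →
    |∑ d ∈ Icc 1 (2 * P), ∑ n ∈ Icc 1 ⌊T⌋₊, (twistedSum P X Y n d r : ℝ) / ((n : ℝ) * d) -
        Y * (1 / (riemannZeta 2).re * (constB * factorC r))| ≤
      (1 + Real.log (2 * P)) * (A * ∑ n ∈ Icc 1 ⌊T⌋₊, completionError n / n +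
        (Y / A + √(X + Y) + (Y / P + 1)) * (1 + Real.log T) +
        (Y + 1) / P * (1 + Real.log T)) +
      Y * (K * (1 / A + (P : ℝ) ^ (-(1 / 4) : ℝ) + T ^ (-(1 / 4) : ℝ))) := by
  obtain ⟨K, hK, hmain⟩ := exists_abs_truncated_sub_le
  refine ⟨K, hK, fun P r A X Y T hP hP2 hPr hr hA hX hY hT => ?_⟩
  set D := (Icc 1 (2 * P)).filter (fun d => ¬ P ∣ d) with hD
  set N := (Icc 1 ⌊T⌋₊).filter (fun n => ¬ P ∣ n) with hN
  set N₁ := (Icc 1 ⌊T⌋₊).filter (fun n => P ∣ n) with hN₁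
  set f : ℕ → ℕ → ℝ := fun d n => (twistedSum P X Y n d r : ℝ) with hf
  set g : ℕ → ℕ → ℝ := fun d n =>
    ∑ a ∈ Icc 1 A, (ArithmeticFunction.moebius a : ℝ) * sieveDensity r a d n with hg
  set M := 1 / (riemannZeta 2).re * (constB * factorC r) with hM
  have hH : 0 ≤ 1 + Real.log T := by linarith [Real.log_nonneg hT]
  have hP0 : (0 : ℝ) < P := by exact_mod_cast hP.pos
  have hDsum : ∑ d ∈ D, 1 / (d : ℝ) ≤ 1 + Real.log (2 * P) := by
    have h1 := sum_Icc_one_div_le (m := 2 * P) (Nat.mul_pos two_pos hP.pos)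
    push_cast at h1
    exact (sum_le_sum_of_subset_of_nonneg (filter_subset _ _) fun _ _ _ => by positivity).trans h1
  have hHP : 0 ≤ 1 + Real.log (2 * P) := (sum_nonneg fun _ _ => by positivity).trans hDsum
  -- Multiples `d` of `P` contribute nothing. Multiples `n` of `P` are kept apart and bounded
  -- trivially, as their reciprocals sum to at most `(1 + log T) / P`.
  have hsplit : ∑ d ∈ Icc 1 (2 * P), ∑ n ∈ Icc 1 ⌊T⌋₊, f d n / ((n : ℝ) * d) =
      ∑ d ∈ D, ∑ n ∈ N, f d n / ((n : ℝ) * d) + ∑ d ∈ D, ∑ n ∈ N₁, f d n / ((n : ℝ) * d) := by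
    rw [← sum_add_distrib]
    rw [← sum_filter_add_sum_filter_not (Icc 1 (2 * P)) (fun d => ¬ P ∣ d)]
    rw [sum_eq_zero (s := (Icc 1 (2 * P)).filter (fun d => ¬¬ P ∣ d)), add_zero]
    · refine sum_congr rfl fun d _ => ?_
      rw [add_comm, sum_filter_add_sum_filter_not]
    · intro d hd
      refine sum_eq_zero fun n _ => ?_
      rw [hf]
      simp only
      rw [twistedSum_eq_zero hP X Y (not_not.1 (mem_filter.1 hd).2) hPr]
      simp
  have hdiff : ∑ d ∈ D, ∑ n ∈ N, f d n / ((n : ℝ) * d) -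
      Y * ∑ d ∈ D, ∑ n ∈ N, g d n / ((n : ℝ) * d) =
      ∑ d ∈ D, ∑ n ∈ N, (f d n - Y * g d n) / ((n : ℝ) * d) := by
    simp only [mul_sum, ← sum_sub_distrib]
    refine sum_congr rfl fun d _ => sum_congr rfl fun n _ => ?_
    rw [sub_div, mul_div_assoc]
  set B := Y / A + √(X + Y) + (Y / P + 1) with hB
  have hB0 : 0 ≤ B := by positivity
  have hC0 : ∀ n ∈ Icc 1 ⌊T⌋₊, 0 ≤ completionError n / n := fun n hn =>
    div_nonneg (completionError_pos n (by rw [mem_Icc] at hn; omega)).le (Nat.cast_nonneg n)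
  have h1 : |∑ d ∈ D, ∑ n ∈ N, (f d n - Y * g d n) / ((n : ℝ) * d)| ≤
      (1 + Real.log (2 * P)) * (A * ∑ n ∈ Icc 1 ⌊T⌋₊, completionError n / n +
        B * (1 + Real.log T)) := by
    refine (abs_sum_sum_div_le (g := fun n => A * completionError n + B) fun d hd n hn => ?_).trans
      ?_
    · rw [hD, mem_filter, mem_Icc] at hd
      rw [hN, mem_filter, mem_Icc] at hn
      have := abs_twistedSum_sub_le (r := r) hP hP2 (d := d) (n := n) (by omega) (by omega) hd.2 hn.2
        hX hY hA
      refine this.trans (le_of_eq ?_)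
      rw [hB]; ring
    · refine mul_le_mul hDsum ?_ (sum_nonneg fun n hn => ?_) hHP
      · calc ∑ n ∈ N, (A * completionError n + B) / (n : ℝ)
            ≤ ∑ n ∈ Icc 1 ⌊T⌋₊, (A * completionError n + B) / (n : ℝ) := by
              refine sum_le_sum_of_subset_of_nonneg (filter_subset _ _) fun n hn _ => ?_
              rw [add_div, mul_div_assoc]
              exact add_nonneg (mul_nonneg (Nat.cast_nonneg _) (hC0 n hn)) (by positivity)
          _ = A * ∑ n ∈ Icc 1 ⌊T⌋₊, completionError n / n + B * ∑ n ∈ Icc 1 ⌊T⌋₊, 1 / (n : ℝ) := by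
              rw [mul_sum, mul_sum, ← sum_add_distrib]
              refine sum_congr rfl fun n _ => ?_
              rw [add_div, mul_div_assoc, div_eq_mul_one_div B]
          _ ≤ _ := by
              gcongr
              exact sum_Icc_floor_one_div_le hT
      · rw [add_div, mul_div_assoc]
        exact add_nonneg (mul_nonneg (Nat.cast_nonneg _) (hC0 n (filter_subset _ _ hn)))
          (by positivity)
  have h2 : |∑ d ∈ D, ∑ n ∈ N₁, f d n / ((n : ℝ) * d)| ≤
      (1 + Real.log (2 * P)) * ((Y + 1) / P * (1 + Real.log T)) := by
    refine (abs_sum_sum_div_le (g := fun _ => Y + 1) fun d _ n _ =>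
      abs_twistedSum_le P X Y hY n d r).trans ?_
    refine mul_le_mul hDsum ?_ (sum_nonneg fun n _ => by positivity) hHP
    simp only [div_eq_mul_one_div (Y + 1) (_ : ℝ), ← mul_sum]
    rw [mul_assoc, one_div_mul_eq_div]
    exact mul_le_mul_of_nonneg_left (sum_multiples_one_div_le hP.pos hT) (by linarith)
  have h3 : |Y * ∑ d ∈ D, ∑ n ∈ N, g d n / ((n : ℝ) * d) - Y * M| ≤
      Y * (K * (1 / A + (P : ℝ) ^ (-(1 / 4) : ℝ) + T ^ (-(1 / 4) : ℝ))) := by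
    rw [← mul_sub, abs_mul, abs_of_nonneg hY]
    exact mul_le_mul_of_nonneg_left (hmain r A P T hr hA hP.pos (by linarith)) hY
  rw [← hdiff] at h1
  rw [hsplit]
  rw [abs_le] at h1 h2 h3 ⊢
  constructor <;> linarith [h1.1, h1.2, h2.1, h2.2, h3.1, h3.2]

end

/-! ### Absorbing logarithms and balancing the parameters. -/

section

open Finset

section Exponents

variable {ε e Y Z T : ℝ}

/-- Logarithms are paid for by powers with exponent `e² / 4`, chosen so that `Z^e ≤ Y` turns a power
of `Z = PX` into a small power of `Y`. -/
theorem rpow_sq_div_four_le (he : 0 < e) (hZ : 1 ≤ Z) (h : Z ^ e ≤ Y) :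
    Z ^ (e ^ 2 / 4) ≤ Y ^ (e / 4) := by
  have hZ0 : 0 ≤ Z := by linarith
  rw [show e ^ 2 / 4 = e * (e / 4) by ring, Real.rpow_mul hZ0]
  exact Real.rpow_le_rpow (by positivity) h (by positivity)

/-- For `T ≤ Z`, the factor `Y^(1/9) ≤ 16 Z^(e/9)` is traded for `Z^ε`. For `T ≥ Z`, `√Y ≤ 4
T^(e/2)` is far below `T^(1/4)`. -/
theorem mul_rpow_le_of_le (he : 0 < e) (he4 : e ≤ 1 / 4) (heε : e ≤ ε) (hZ : 1 ≤ Z) (hY : 1 ≤ Y)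
    (hT : 1 ≤ T) (h : Y ≤ 16 * Z ^ e) :
    Y * (Z ^ (e ^ 2 / 4) * T ^ (e ^ 2 / 4)) ≤
      16 * (√Y * T ^ (1 / 4 + ε) + Z ^ ε * Y ^ (8 / 9 : ℝ)) := by
  have hZ0 : 0 < Z := by linarith
  have hY0 : 0 < Y := by linarith
  have hT0 : 0 < T := by linarith
  have he2 : e ^ 2 ≤ e / 4 := by nlinarith
  have hη : 0 ≤ e ^ 2 / 4 := by positivity
  rcases le_total T Z with hTZ | hTZ
  · have h1 : T ^ (e ^ 2 / 4) ≤ Z ^ (e ^ 2 / 4) := Real.rpow_le_rpow hT0.le hTZ hη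
    have h2 : Y ^ (1 / 9 : ℝ) ≤ 16 * Z ^ (e / 9) := by
      calc Y ^ (1 / 9 : ℝ) ≤ (16 * Z ^ e) ^ (1 / 9 : ℝ) :=
            Real.rpow_le_rpow hY0.le h (by norm_num)
        _ = 16 ^ (1 / 9 : ℝ) * Z ^ (e / 9) := by
            rw [Real.mul_rpow (by norm_num) (by positivity), ← Real.rpow_mul hZ0.le]
            ring_nf
        _ ≤ 16 * Z ^ (e / 9) := by
            gcongr
            calc (16 : ℝ) ^ (1 / 9 : ℝ) ≤ 16 ^ (1 : ℝ) :=
                  Real.rpow_le_rpow_of_exponent_le (by norm_num) (by norm_num)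
              _ = 16 := Real.rpow_one _
    calc Y * (Z ^ (e ^ 2 / 4) * T ^ (e ^ 2 / 4))
        ≤ Y * (Z ^ (e ^ 2 / 4) * Z ^ (e ^ 2 / 4)) := by gcongr
      _ = Y ^ (1 / 9 : ℝ) * Y ^ (8 / 9 : ℝ) * Z ^ (e ^ 2 / 4 + e ^ 2 / 4) := by
          rw [← Real.rpow_add hY0, ← Real.rpow_add hZ0]
          norm_num
      _ ≤ 16 * Z ^ (e / 9) * Y ^ (8 / 9 : ℝ) * Z ^ (e ^ 2 / 4 + e ^ 2 / 4) := by gcongr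
      _ = 16 * (Z ^ (e / 9 + (e ^ 2 / 4 + e ^ 2 / 4)) * Y ^ (8 / 9 : ℝ)) := by
          rw [Real.rpow_add hZ0 (e / 9)]; ring
      _ ≤ 16 * (Z ^ ε * Y ^ (8 / 9 : ℝ)) := by
          gcongr
          linarith
      _ ≤ _ := by
          have : 0 ≤ √Y * T ^ (1 / 4 + ε) := by positivity
          linarith
  · have h1 : Z ^ (e ^ 2 / 4) ≤ T ^ (e ^ 2 / 4) := Real.rpow_le_rpow hZ0.le hTZ hη
    have h2 : √Y ≤ 4 * T ^ (e / 2) := by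
      refine Real.sqrt_le_iff.2 ⟨by positivity, h.trans ?_⟩
      rw [mul_pow, ← Real.rpow_natCast (T ^ (e / 2)), ← Real.rpow_mul hT0.le]
      have := Real.rpow_le_rpow hZ0.le hTZ he.le
      norm_num
      exact this
    calc Y * (Z ^ (e ^ 2 / 4) * T ^ (e ^ 2 / 4))
        ≤ Y * (T ^ (e ^ 2 / 4) * T ^ (e ^ 2 / 4)) := by gcongr
      _ = √Y * (√Y * (T ^ (e ^ 2 / 4) * T ^ (e ^ 2 / 4))) := by
          rw [← mul_assoc √Y, Real.mul_self_sqrt hY0.le]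
      _ ≤ √Y * (4 * T ^ (e / 2) * (T ^ (e ^ 2 / 4) * T ^ (e ^ 2 / 4))) := by gcongr
      _ = 4 * (√Y * T ^ (e / 2 + (e ^ 2 / 4 + e ^ 2 / 4))) := by
          rw [Real.rpow_add hT0, Real.rpow_add hT0]; ring
      _ ≤ 4 * (√Y * T ^ (1 / 4 + ε)) := by
          have := Real.rpow_le_rpow_of_exponent_le hT
            (show e / 2 + (e ^ 2 / 4 + e ^ 2 / 4) ≤ 1 / 4 + ε by linarith)
          gcongr
      _ ≤ _ := by
          have h3 : 0 ≤ √Y * T ^ (1 / 4 + ε) := by positivity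
          have h4 : 0 ≤ Z ^ ε * Y ^ (8 / 9 : ℝ) := by positivity
          linarith

/-- When `T ≥ Y²`, already `Y ≤ √Y T^(1/4)`, so the trivial bound is good enough. -/
theorem mul_rpow_le_of_sq_le (he : 0 < e) (he4 : e ≤ 1 / 4) (heε : e ≤ ε) (hZ : 1 ≤ Z)
    (hY : 1 ≤ Y) (h : Z ^ e ≤ Y) (hYT : Y ^ 2 ≤ T) :
    Y * (Z ^ (e ^ 2 / 4) * T ^ (e ^ 2 / 4)) ≤ √Y * T ^ (1 / 4 + ε) := by
  have hY0 : 0 < Y := by linarith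
  have hT : 1 ≤ T := (one_le_pow₀ hY).trans hYT
  have hT0 : 0 < T := by linarith
  have he2 : e ^ 2 ≤ e / 4 := by nlinarith
  have h1 : Y ≤ T ^ (1 / 2 : ℝ) := by
    rw [← Real.sqrt_eq_rpow]
    exact Real.le_sqrt_of_sq_le hYT
  have h2 : √Y ≤ T ^ (1 / 4 : ℝ) := by
    rw [Real.sqrt_eq_rpow]
    calc Y ^ (1 / 2 : ℝ) ≤ (T ^ (1 / 2 : ℝ)) ^ (1 / 2 : ℝ) :=
          Real.rpow_le_rpow hY0.le h1 (by norm_num)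
      _ = _ := by rw [← Real.rpow_mul hT0.le]; norm_num
  have h3 : Z ^ (e ^ 2 / 4) ≤ T ^ (e / 4) := by
    refine (rpow_sq_div_four_le he hZ h).trans (Real.rpow_le_rpow hY0.le ?_ (by positivity))
    nlinarith
  calc Y * (Z ^ (e ^ 2 / 4) * T ^ (e ^ 2 / 4))
      = √Y * (√Y * (Z ^ (e ^ 2 / 4) * T ^ (e ^ 2 / 4))) := by
        rw [← mul_assoc √Y, Real.mul_self_sqrt hY0.le]
    _ ≤ √Y * (T ^ (1 / 4 : ℝ) * (T ^ (e / 4) * T ^ (e ^ 2 / 4))) := by gcongr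
    _ = √Y * T ^ (1 / 4 + (e / 4 + e ^ 2 / 4)) := by
        rw [Real.rpow_add hT0, Real.rpow_add hT0]
    _ ≤ _ := by
        gcongr
        linarith

/-- The power of `Z` becomes `Y^(e/4)`, and `c Y ≤ T` converts it into a power of `T` that fits
inside `T^ε`. -/
theorem sqrt_mul_rpow_le (he : 0 < e) (he4 : e ≤ 1 / 4) (heε : e ≤ ε) {c : ℝ} (hc : 0 < c)
    (hZ : 1 ≤ Z) (hY : 1 ≤ Y) (hT : 1 ≤ T) (h : Z ^ e ≤ Y) (hcY : c * Y ≤ T) :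
    √Y * T ^ (1 / 4 : ℝ) * (Z ^ (e ^ 2 / 4) * T ^ (e ^ 2 / 4)) ≤
      (1 / c) ^ (e / 4) * (√Y * T ^ (1 / 4 + ε)) := by
  have hY0 : 0 < Y := by linarith
  have hT0 : 0 < T := by linarith
  have he2 : e ^ 2 ≤ e / 4 := by nlinarith
  have h3 : Z ^ (e ^ 2 / 4) ≤ (1 / c) ^ (e / 4) * T ^ (e / 4) := by
    refine (rpow_sq_div_four_le he hZ h).trans ?_
    rw [← Real.mul_rpow (by positivity) hT0.le]
    refine Real.rpow_le_rpow hY0.le ?_ (by positivity)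
    rw [one_div_mul_eq_div, le_div_iff₀ hc]
    linarith
  calc _ ≤ √Y * T ^ (1 / 4 : ℝ) * ((1 / c) ^ (e / 4) * T ^ (e / 4) * T ^ (e ^ 2 / 4)) := by gcongr
    _ = (1 / c) ^ (e / 4) * (√Y * T ^ (1 / 4 + (e / 4 + e ^ 2 / 4))) := by
        rw [Real.rpow_add hT0, Real.rpow_add hT0]; ring
    _ ≤ _ := by
        gcongr
        linarith

/-- Total exponent `e/4 + e²/2 ≤ 3/32`, well below `5/18`. -/
theorem rpow_mul_rpow_le (he : 0 < e) (he4 : e ≤ 1 / 4) (hZ : 1 ≤ Z) (hY : 1 ≤ Y) (hT : 0 ≤ T)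
    (h : Z ^ e ≤ Y) (hTY : T ≤ Y ^ 2) :
    Z ^ (e ^ 2 / 4) * T ^ (e ^ 2 / 4) ≤ Y ^ (5 / 18 : ℝ) := by
  have hY0 : 0 < Y := by linarith
  have he2 : e ^ 2 ≤ e / 4 := by nlinarith
  have h1 : T ^ (e ^ 2 / 4) ≤ Y ^ (2 * (e ^ 2 / 4)) := by
    rw [Real.rpow_mul hY0.le]
    refine Real.rpow_le_rpow hT ?_ (by positivity)
    exact_mod_cast hTY
  calc _ ≤ Y ^ (e / 4) * Y ^ (2 * (e ^ 2 / 4)) := by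
        gcongr
        exact rpow_sq_div_four_le he hZ h
    _ = Y ^ (e / 4 + 2 * (e ^ 2 / 4)) := (Real.rpow_add hY0 _ _).symm
    _ ≤ _ := Real.rpow_le_rpow_of_exponent_le hY (by linarith)

theorem one_add_log_le {η : ℝ} (hη : 0 < η) (hT : 1 ≤ T) :
    1 + Real.log T ≤ (1 + 1 / η) * T ^ η := by
  have h1 := Real.log_le_rpow_div (by linarith : 0 ≤ T) hη
  have h2 := Real.one_le_rpow hT hη.le
  calc _ ≤ T ^ η + T ^ η / η := add_le_add h2 h1
    _ = _ := by ring

theorem one_add_log_two_mul_le {η P X : ℝ} (hη : 0 < η) (hP : 1 ≤ P) (hX : 1 ≤ X) :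
    1 + Real.log (2 * P) ≤ (1 + 1 / η) * 2 ^ η * (P * X) ^ η := by
  refine (one_add_log_le hη (by linarith)).trans ?_
  rw [Real.mul_rpow (by norm_num) (by linarith), ← mul_assoc]
  gcongr
  nlinarith

end Exponents

theorem mul_add_mul_le {H₁ H₂ E B G C₁ C₂ C₃ Q V w x : ℝ} (hH₁ : H₁ ≤ C₁ * Q) (hH₂ : H₂ ≤ C₂ * V)
    (hH₂0 : 0 ≤ H₂) (hE : E ≤ 2 * C₃ * w * V) (hB : B ≤ 4 * w + 2 * x) (hG : G ≤ 4 * w)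
    (hE0 : 0 ≤ E) (hB0 : 0 ≤ B) (hG0 : 0 ≤ G) (hC₁ : 0 ≤ C₁) (hQ : 0 ≤ Q) :
    H₁ * (E + B * H₂ + G * H₂) ≤
      C₁ * (2 * C₃ + 8 * C₂) * (w * (Q * V)) + 2 * C₁ * C₂ * (x * (Q * V)) := by
  have h4 : (B + G) * H₂ ≤ (8 * w + 2 * x) * (C₂ * V) :=
    mul_le_mul (by linarith) hH₂ hH₂0 (by linarith)
  calc _ ≤ C₁ * Q * (2 * C₃ * w * V + (8 * w + 2 * x) * (C₂ * V)) :=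
        mul_le_mul hH₁ (by linarith) (by positivity) (by positivity)
    _ = _ := by ring

/-- `P ≥ √Y / 2` gives `Y P^(-1/4) ≪ Y^(7/8)`, and `7/8 < 8/9`. -/
theorem mul_rpow_neg_le {Y P : ℝ} (hY : 1 ≤ Y) (hP : √Y ≤ 2 * P) :
    Y * P ^ (-(1 / 4) : ℝ) ≤ 2 * Y ^ (8 / 9 : ℝ) := by
  have hY0 : 0 < Y := by linarith
  have hs0 : 0 < √Y := Real.sqrt_pos.2 hY0
  have h5 : P ^ (-(1 / 4) : ℝ) ≤ 2 * Y ^ (-(1 / 8) : ℝ) := by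
    calc P ^ (-(1 / 4) : ℝ) ≤ (√Y / 2) ^ (-(1 / 4) : ℝ) :=
          rpow_neg_quarter_le (by positivity) (by linarith)
      _ = 2 ^ (1 / 4 : ℝ) * Y ^ (-(1 / 8) : ℝ) := by
          rw [Real.div_rpow hs0.le (by norm_num), Real.sqrt_eq_rpow, ← Real.rpow_mul hY0.le,
            Real.rpow_neg (by norm_num : (0 : ℝ) ≤ 2), div_inv_eq_mul]
          norm_num
          ring
      _ ≤ _ := by
          gcongr
          calc (2 : ℝ) ^ (1 / 4 : ℝ) ≤ 2 ^ (1 : ℝ) :=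
                Real.rpow_le_rpow_of_exponent_le (by norm_num) (by norm_num)
            _ = 2 := Real.rpow_one _
  calc Y * P ^ (-(1 / 4) : ℝ) ≤ Y * (2 * Y ^ (-(1 / 8) : ℝ)) := by gcongr
    _ = 2 * Y ^ (7 / 8 : ℝ) := by
        rw [show (7 / 8 : ℝ) = 1 + -(1 / 8) by norm_num, Real.rpow_add hY0, Real.rpow_one]
        ring
    _ ≤ _ := by
        have := Real.rpow_le_rpow_of_exponent_le hY (show (7 / 8 : ℝ) ≤ 8 / 9 by norm_num)
        linarith

theorem sqrt_mul_rpow_neg_le {c Y T : ℝ} (hc : 0 < c) (hY : 0 ≤ Y) (hT : 0 < T) (h : c * Y ≤ T) :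
    Y * T ^ (-(1 / 4) : ℝ) ≤ √(1 / c) * (√Y * T ^ (1 / 4 : ℝ)) := by
  have htt : T ^ (1 / 4 : ℝ) * T ^ (1 / 4 : ℝ) = √T := by
    rw [← Real.rpow_add hT, Real.sqrt_eq_rpow]; norm_num
  have h3 : √Y ≤ √(1 / c) * √T := by
    rw [← Real.sqrt_mul (by positivity)]
    refine Real.sqrt_le_sqrt ?_
    rw [one_div_mul_eq_div, le_div_iff₀ hc]
    linarith
  rw [Real.rpow_neg hT.le, ← div_eq_mul_inv, div_le_iff₀ (by positivity)]
  calc Y = √Y * √Y := (Real.mul_self_sqrt hY).symm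
    _ ≤ √Y * (√(1 / c) * √T) := by gcongr
    _ = _ := by rw [← htt]; ring

theorem add_add_le_mul {x y z u v w : ℝ} (hx : 0 ≤ x) (hy : 0 ≤ y) (hz : 0 ≤ z) (hu : 0 ≤ u)
    (hv : 0 ≤ v) (hw : 0 ≤ w) : x * u + y * v + z * w ≤ (x + y + z) * (u + v + w) := by
  have h : (x + y + z) * (u + v + w) = x * u + y * v + z * w +
      (x * v + x * w + y * u + y * w + z * u + z * v) := by ring
  have h' : 0 ≤ x * v + x * w + y * u + y * w + z * u + z * v := by positivity
  linarith

theorem sqrt_quarter_le {Y T : ℝ} (hY : 0 ≤ Y) (hT : 0 ≤ T) (h : T ≤ Y ^ 2) :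
    T ^ (1 / 4 : ℝ) ≤ √Y := by
  calc T ^ (1 / 4 : ℝ) ≤ (Y ^ 2) ^ (1 / 4 : ℝ) := Real.rpow_le_rpow hT h (by norm_num)
    _ = √Y := by
      rw [← Real.rpow_natCast, ← Real.rpow_mul hY, Real.sqrt_eq_rpow]; norm_num

/-- The comparison with the main term for `T ≤ Y ^ 2` and for `Y` at least a power of `P * X`. -/
theorem exists_main_range_le {ε e c : ℝ} (he : 0 < e) (he4 : e ≤ 1 / 4) (heε : e ≤ ε)
    (hc : 0 < c) :
    ∃ K : ℝ, 0 ≤ K ∧ ∀ (P r : ℕ) (X Y T : ℝ), P.Prime → Odd P → ¬ P ∣ r → 0 < r → 1 ≤ Y → Y < X →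
      Y ≤ 2 * (P : ℝ) ^ 2 → 1 ≤ T → c * Y ≤ T → T ≤ Y ^ 2 → ((P : ℝ) * X) ^ e ≤ Y →
      |∑ d ∈ Icc 1 (2 * P), ∑ n ∈ Icc 1 ⌊T⌋₊, (twistedSum P X Y n d r : ℝ) / ((n : ℝ) * d) -
        Y * (1 / (riemannZeta 2).re * (constB * factorC r))| ≤
      K * (√X * Y ^ (5 / 18 : ℝ) + √Y * T ^ (1 / 4 + ε) +
          ((P : ℝ) * X) ^ ε * Y ^ (8 / 9 : ℝ)) := by
  have hη : 0 < e ^ 2 / 4 := by positivity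
  obtain ⟨K, hK, hmain⟩ := exists_abs_sum_twistedSum_sub_le
  obtain ⟨C₃, hC₃, hE⟩ := sum_completionError_div_le hη
  set C₁ := (1 + 1 / (e ^ 2 / 4)) * (2 : ℝ) ^ (e ^ 2 / 4) with hC₁
  set C₂ := 1 + 1 / (e ^ 2 / 4) with hC₂
  have hC₁0 : 0 < C₁ := by positivity
  have hC₂0 : 0 < C₂ := by positivity
  set c' := (1 / c) ^ (e / 4) with hc'
  have hc'0 : 0 < c' := by positivity
  refine ⟨2 * C₁ * C₂ + (C₁ * (2 * C₃ + 8 * C₂) + K + K * √(1 / c)) * c' + 2 * K, by positivity,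
    fun P r X Y T hP hP2 hPr hr hY hYX hYP hT hcY hTY hZ => ?_⟩
  have hP1 : (1 : ℝ) ≤ P := by exact_mod_cast hP.one_le
  have hP0 : (0 : ℝ) < P := by linarith
  have hX1 : 1 ≤ X := by linarith
  have hY0 : 0 < Y := by linarith
  have hT0 : 0 < T := by linarith
  have hZ1 : 1 ≤ (P : ℝ) * X := one_le_mul_of_one_le_of_one_le hP1 hX1
  set Q := ((P : ℝ) * X) ^ (e ^ 2 / 4) with hQ
  set V := T ^ (e ^ 2 / 4) with hV
  set s := √Y with hs
  set t := T ^ (1 / 4 : ℝ) with ht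
  have hQ1 : 1 ≤ Q := Real.one_le_rpow hZ1 hη.le
  have hV1 : 1 ≤ V := Real.one_le_rpow hT hη.le
  have hs1 : 1 ≤ s := Real.one_le_sqrt.2 hY
  have ht1 : 1 ≤ t := Real.one_le_rpow hT (by norm_num)
  have hs0 : 0 < s := by linarith
  have ht0 : 0 < t := by linarith
  have hss : s * s = Y := Real.mul_self_sqrt hY0.le
  have htt : t * t = √T := by
    rw [ht, ← Real.rpow_add hT0, Real.sqrt_eq_rpow]; norm_num
  have hts : t ≤ s := sqrt_quarter_le hY0.le hT0.le hTY
  -- The cut `√Y / T^(1/4)` makes both `A √T` and `Y / A` of size `√Y T^(1/4)`. As `T ≤ Y²`, the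
  -- quotient is at least 1 and rounding up at most doubles it.
  set A := ⌈s / t⌉₊ with hA
  have hst1 : 1 ≤ s / t := (one_le_div ht0).2 hts
  have hA0 : 0 < A := Nat.ceil_pos.2 (by linarith)
  have hA1 : s / t ≤ A := Nat.le_ceil _
  have hA2 : (A : ℝ) ≤ 2 * (s / t) := by
    have := Nat.ceil_lt_add_one (show 0 ≤ s / t by positivity)
    linarith
  have hinvA : 1 / (A : ℝ) ≤ t / s := by
    rw [← one_div_div s t]
    exact one_div_le_one_div_of_le (by positivity) hA1
  have hYs : Y * (t / s) = s * t := by rw [← hss]; field_simp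
  have hsP : s ≤ 2 * P := by
    rw [hs]
    refine Real.sqrt_le_iff.2 ⟨by positivity, ?_⟩
    rw [mul_pow]
    linarith [sq_nonneg (P : ℝ)]
  have hYP' : Y / P ≤ 2 * s := by
    rw [div_le_iff₀ hP0, ← hss]
    linarith [mul_le_mul_of_nonneg_left hsP hs0.le]
  have hst : s ≤ s * t := le_mul_of_one_le_right hs0.le ht1
  have hQV1 : 1 ≤ Q * V := one_le_mul_of_one_le_of_one_le hQ1 hV1
  have hH1 : 1 + Real.log (2 * P) ≤ C₁ * Q := one_add_log_two_mul_le hη hP1 hX1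
  have hH2 : 1 + Real.log T ≤ C₂ * V := one_add_log_le hη hT
  have hH20 : 0 ≤ 1 + Real.log T := by linarith [Real.log_nonneg hT]
  have hW := sqrt_mul_rpow_le he he4 heε hc hZ1 hY hT hZ hcY
  have hQV := rpow_mul_rpow_le he he4 hZ1 hY hT0.le hZ hTY
  have hXY : √(X + Y) ≤ 2 * √X := by
    refine Real.sqrt_le_iff.2 ⟨by positivity, ?_⟩
    rw [mul_pow, Real.sq_sqrt (by linarith)]
    linarith
  have hE' := hE T hT0
  have hE0 : 0 ≤ ∑ n ∈ Icc 1 ⌊T⌋₊, completionError n / n := sum_nonneg fun n hn =>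
    div_nonneg (completionError_pos n (by rw [mem_Icc] at hn; omega)).le (Nat.cast_nonneg n)
  have hYA : Y * (1 / A) ≤ s * t := by
    rw [← hYs]
    exact mul_le_mul_of_nonneg_left hinvA hY0.le
  have hfirst : (1 + Real.log (2 * P)) * (A * (∑ n ∈ Icc 1 ⌊T⌋₊, completionError n / n) +
        (Y / A + √(X + Y) + (Y / P + 1)) * (1 + Real.log T) +
        (Y + 1) / P * (1 + Real.log T)) ≤
      C₁ * (2 * C₃ + 8 * C₂) * (s * t * (Q * V)) + 2 * C₁ * C₂ * (√X * (Q * V)) := by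
    refine mul_add_mul_le hH1 hH2 hH20 ?_ ?_ ?_ (mul_nonneg (Nat.cast_nonneg A) hE0)
      (by positivity) (by positivity) hC₁0.le (by linarith)
    · calc _ ≤ 2 * (s / t) * (C₃ * (√T * V)) := mul_le_mul hA2 hE' hE0 (by positivity)
        _ = _ := by rw [← htt]; field_simp
    · rw [div_eq_mul_one_div Y (A : ℝ)]
      linarith
    · have : (Y + 1) / P ≤ 2 * (Y / P) := by
        rw [← mul_div_assoc]
        exact div_le_div_of_nonneg_right (by linarith) hP0.le
      linarith
  have hsecond : Y * (K * (1 / A + (P : ℝ) ^ (-(1 / 4) : ℝ) + T ^ (-(1 / 4) : ℝ))) ≤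
      (K + K * √(1 / c)) * (s * t) + 2 * K * Y ^ (8 / 9 : ℝ) := by
    have h2 := sqrt_mul_rpow_neg_le hc hY0.le hT0 hcY
    have h4 := mul_rpow_neg_le hY hsP
    calc _ = K * (Y * (1 / A) + Y * (P : ℝ) ^ (-(1 / 4) : ℝ) + Y * T ^ (-(1 / 4) : ℝ)) := by ring
      _ ≤ K * (s * t + 2 * Y ^ (8 / 9 : ℝ) + √(1 / c) * (s * t)) :=
          mul_le_mul_of_nonneg_left (add_le_add (add_le_add hYA h4) h2) hK
      _ = _ := by ring
  have hR1 : 0 ≤ √X * Y ^ (5 / 18 : ℝ) := by positivity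
  have hR2 : 0 ≤ s * T ^ (1 / 4 + ε) := by positivity
  have hY89 : Y ^ (8 / 9 : ℝ) ≤ ((P : ℝ) * X) ^ ε * Y ^ (8 / 9 : ℝ) :=
    le_mul_of_one_le_left (by positivity) (Real.one_le_rpow hZ1 (by linarith))
  have hR3 : 0 ≤ ((P : ℝ) * X) ^ ε * Y ^ (8 / 9 : ℝ) := by positivity
  refine (hmain P r A X Y T hP hP2 hPr hr hA0 (by linarith) hY0.le hT).trans ?_
  set R1 := √X * Y ^ (5 / 18 : ℝ) with hR1d
  set R2 := s * T ^ (1 / 4 + ε) with hR2d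
  set R3 := ((P : ℝ) * X) ^ ε * Y ^ (8 / 9 : ℝ) with hR3d
  have hXQ : √X * (Q * V) ≤ R1 := by
    rw [hR1d]; gcongr
  have hstQ : s * t ≤ s * t * (Q * V) := le_mul_of_one_le_right (by positivity) hQV1
  calc _ ≤ C₁ * (2 * C₃ + 8 * C₂) * (c' * R2) + 2 * C₁ * C₂ * R1 +
        ((K + K * √(1 / c)) * (c' * R2) + 2 * K * R3) := by
        refine add_le_add (hfirst.trans ?_) (hsecond.trans ?_)
        · gcongr
        · have h5 := hstQ.trans hW
          gcongr
    _ = (2 * C₁ * C₂) * R1 + ((C₁ * (2 * C₃ + 8 * C₂) + K + K * √(1 / c)) * c') * R2 +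
        2 * K * R3 := by ring
    _ ≤ _ := add_add_le_mul (by positivity) (by positivity) (by positivity) hR1 hR2 hR3

end

/-! ### The remaining ranges and the conclusion. -/

section

open Finset

/-- Each twisted sum is at most `Y + 1` in absolute value and the weights `1 / (nd)` cost two
logarithms; the main term is `O(Y)` uniformly in `r`. -/
theorem exists_trivial_le {e : ℝ} (he : 0 < e) : ∃ K : ℝ, 0 ≤ K ∧ ∀ (P r : ℕ) (X Y T : ℝ),
    0 < P → 0 < r → 1 ≤ Y → 1 ≤ X → 1 ≤ T →
    |∑ d ∈ Icc 1 (2 * P), ∑ n ∈ Icc 1 ⌊T⌋₊, (twistedSum P X Y n d r : ℝ) / ((n : ℝ) * d) -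
        Y * (1 / (riemannZeta 2).re * (constB * factorC r))| ≤
      K * (Y * (((P : ℝ) * X) ^ (e ^ 2 / 4) * T ^ (e ^ 2 / 4))) := by
  have hη : 0 < e ^ 2 / 4 := by positivity
  obtain ⟨K, hK, hmain⟩ := exists_abs_main_le
  set C₁ := (1 + 1 / (e ^ 2 / 4)) * (2 : ℝ) ^ (e ^ 2 / 4) with hC₁
  set C₂ := 1 + 1 / (e ^ 2 / 4) with hC₂
  have hC₁0 : 0 < C₁ := by positivity
  have hC₂0 : 0 < C₂ := by positivity
  refine ⟨2 * C₁ * C₂ + K, by positivity, fun P r X Y T hP hr hY hX hT => ?_⟩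
  have hP1 : (1 : ℝ) ≤ P := by exact_mod_cast hP
  have hH1 : 1 + Real.log (2 * P) ≤ C₁ * ((P : ℝ) * X) ^ (e ^ 2 / 4) :=
    one_add_log_two_mul_le hη hP1 hX
  have hH2 : 1 + Real.log T ≤ C₂ * T ^ (e ^ 2 / 4) := one_add_log_le hη hT
  have hQ1 : 1 ≤ ((P : ℝ) * X) ^ (e ^ 2 / 4) :=
    Real.one_le_rpow (one_le_mul_of_one_le_of_one_le hP1 hX) hη.le
  have hV1 : 1 ≤ T ^ (e ^ 2 / 4) := Real.one_le_rpow hT hη.le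
  have hH20 : 0 ≤ 1 + Real.log T := by linarith [Real.log_nonneg hT]
  generalize ((P : ℝ) * X) ^ (e ^ 2 / 4) = Q at *
  generalize T ^ (e ^ 2 / 4) = V at *
  have h1 := abs_sum_twistedSum_le (r := r) hP X (by linarith : 0 ≤ Y) hT
  have h2 : |Y * (1 / (riemannZeta 2).re * (constB * factorC r))| ≤ Y * K := by
    rw [abs_mul, abs_of_nonneg (by linarith)]
    exact mul_le_mul_of_nonneg_left (hmain r hr) (by linarith)
  have h3 : (1 + Real.log (2 * P)) * ((Y + 1) * (1 + Real.log T)) ≤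
      C₁ * Q * (2 * Y * (C₂ * V)) := by
    refine mul_le_mul hH1 (mul_le_mul (by linarith) hH2 hH20 (by linarith))
      (mul_nonneg (by linarith) hH20) (by positivity)
  have h4 : Y * K ≤ K * (Y * (Q * V)) := by
    rw [mul_comm Y K]
    refine mul_le_mul_of_nonneg_left ?_ hK
    exact le_mul_of_one_le_right (by linarith) (one_le_mul_of_one_le_of_one_le hQ1 hV1)
  refine (abs_sub _ _).trans ?_
  calc _ ≤ C₁ * Q * (2 * Y * (C₂ * V)) + K * (Y * (Q * V)) :=
        add_le_add (h1.trans h3) (h2.trans h4)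
    _ = _ := by ring

theorem mainTheorem4 (ε : ℝ) (hε : 0 < ε) (c : ℝ) (hc : 0 < c) :
    ∃ K : ℝ, ∀ (P r : ℕ) (X Y T : ℝ), P.Prime → 0 < r → 1 ≤ Y → Y < X →
      (r : ℝ) ^ 2 * (X + Y) < 4 * (P : ℝ) ^ 2 → c * Y ≤ T →
      |(∑ d ∈ Finset.Icc 1 (2 * P), ∑ n ∈ Finset.Icc 1 ⌊T⌋₊,
            (twistedSum P X Y n d r : ℝ) / ((n : ℝ) * (d : ℝ))) -
          Y / (riemannZeta 2).re * constB * factorC r| ≤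
        K * (Real.sqrt X * Y ^ (5 / 18 : ℝ) + Real.sqrt Y * T ^ (1 / 4 + ε : ℝ) +
          ((P : ℝ) * X) ^ ε * Y ^ (8 / 9 : ℝ)) := by
  set e := min ε (1 / 4) with he_def
  have he : 0 < e := lt_min hε (by norm_num)
  have heε : e ≤ ε := min_le_left _ _
  have he4 : e ≤ 1 / 4 := min_le_right _ _
  obtain ⟨K₀, hK₀, hconst⟩ := exists_abs_main_le
  obtain ⟨K₁, hK₁, htriv⟩ := exists_trivial_le he
  obtain ⟨K₂, hK₂, hrange⟩ := exists_main_range_le he he4 heε hc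
  refine ⟨16 * K₁ + K₂ + K₀ * (1 / c), fun P r X Y T hP hr hY hYX h4 hcT => ?_⟩
  have hP1 : (1 : ℝ) ≤ P := by exact_mod_cast hP.one_le
  have hr1 : (1 : ℝ) ≤ r := by exact_mod_cast hr
  have hY0 : 0 < Y := by linarith
  have hX1 : 1 ≤ X := by linarith
  have hT0 : 0 < T := (mul_pos hc hY0).trans_le hcT
  have hZ1 : 1 ≤ (P : ℝ) * X := one_le_mul_of_one_le_of_one_le hP1 hX1
  have hXYr : X + Y ≤ (r : ℝ) ^ 2 * (X + Y) :=
    le_mul_of_one_le_left (by linarith) (one_le_pow₀ hr1)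
  rw [show Y / (riemannZeta 2).re * constB * factorC r =
    Y * (1 / (riemannZeta 2).re * (constB * factorC r)) by ring]
  set R₁ := √X * Y ^ (5 / 18 : ℝ) with hR₁
  set R₂ := √Y * T ^ (1 / 4 + ε) with hR₂
  set R₃ := ((P : ℝ) * X) ^ ε * Y ^ (8 / 9 : ℝ) with hR₃
  have hR₁1 : 1 ≤ R₁ := one_le_mul_of_one_le_of_one_le (Real.one_le_sqrt.2 hX1)
    (Real.one_le_rpow hY (by norm_num))
  have hR₂0 : 0 ≤ R₂ := by positivity
  have hR₃0 : 0 ≤ R₃ := by positivity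
  have hc0 : 0 ≤ K₀ * (1 / c) := by positivity
  have hR0 : 0 ≤ R₁ + R₂ + R₃ := by linarith
  have hweak : ∀ {k : ℝ}, k ≤ 16 * K₁ + K₂ + K₀ * (1 / c) →
      k * (R₁ + R₂ + R₃) ≤ (16 * K₁ + K₂ + K₀ * (1 / c)) * (R₁ + R₂ + R₃) :=
    fun h => mul_le_mul_of_nonneg_right h hR0
  -- For `T < 1` the sum over `n` is empty and `Y ≤ 1 / c` bounds the main term.
  rcases lt_or_ge T 1 with hT | hT
  · rw [Nat.floor_eq_zero.2 hT]
    simp only [Icc_eq_empty_of_lt one_pos, sum_empty, sum_const_zero, zero_sub, abs_neg]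
    have hYc : Y ≤ 1 / c := by
      rw [le_div_iff₀ hc]
      linarith
    rw [abs_mul, abs_of_pos hY0, mul_comm]
    refine le_trans ?_ (hweak (k := K₀ * (1 / c)) (by linarith))
    calc _ ≤ K₀ * (1 / c) := mul_le_mul (hconst r hr) hYc hY0.le hK₀
      _ ≤ _ := le_mul_of_one_le_right hc0 (by linarith)
  have ht := htriv P r X Y T hP.pos hr hY hX1 hT
  -- Beyond this case `Y > 16`. That excludes `P = 2`, where `X + Y < 16`, and `P ∣ r`, where `r² (X
  -- + Y) ≥ 4 P²`.
  by_cases h1 : Y ≤ 16 * ((P : ℝ) * X) ^ e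
  · refine (ht.trans ?_).trans (hweak (k := 16 * K₁) (by linarith))
    calc _ ≤ K₁ * (16 * (R₂ + R₃)) :=
          mul_le_mul_of_nonneg_left (mul_rpow_le_of_le he he4 heε hZ1 hY hT h1) hK₁
      _ = 16 * K₁ * (R₂ + R₃) := by ring
      _ ≤ _ := mul_le_mul_of_nonneg_left (by linarith) (by positivity)
  have hZe : 1 ≤ ((P : ℝ) * X) ^ e := Real.one_le_rpow hZ1 he.le
  have hZY : ((P : ℝ) * X) ^ e ≤ Y := by linarith
  rcases le_total (Y ^ 2) T with hYT | hYT
  · refine (ht.trans ?_).trans (hweak (k := K₁) (by linarith))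
    refine mul_le_mul_of_nonneg_left ?_ hK₁
    exact (mul_rpow_le_of_sq_le he he4 heε hZ1 hY hZY hYT).trans (by linarith)
  have hP2 : P ≠ 2 := by
    rintro rfl
    norm_num at h4
    linarith
  have hPr : ¬ P ∣ r := by
    intro h
    have h5 : (P : ℝ) ≤ r := by exact_mod_cast Nat.le_of_dvd hr h
    have h6 : (P : ℝ) ^ 2 ≤ (r : ℝ) ^ 2 := pow_le_pow_left₀ (by linarith) h5 2
    have h7 : (P : ℝ) ^ 2 * 4 ≤ (r : ℝ) ^ 2 * (X + Y) :=
      mul_le_mul h6 (by linarith) (by norm_num) (by positivity)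
    linarith
  exact (hrange P r X Y T hP (hP.odd_of_ne_two hP2) hPr hr hY hYX (by linarith) hT hcT hYT
    hZY).trans (hweak (by linarith))

end
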